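/- Let $K$ be a number field with algebraic closure $\bar K$, and let $W$ be a finitely generated subgroup of $K^\times$ of positive rank (the rank of $W$ modulo torsion). For $n\ge 1$ let $\zeta_n$ be a primitive $n$-th root of unity, let $W^{1/n}\subset\bar K^\times$ be the set of all $n$-th roots of all elements of $W$, and let $K(\zeta_\infty)$ be obtained from $K$ by adjoining all roots of unity. (i) There is a positive integer $z$, computable from $K$ and $W$, such that for all positive integers $t$ $$[K(\zeta_\infty, W^{1/zt}) : K(\zeta_\infty, W^{1/z})]=t^{\operatorname{rank} W}.$$ (ii) There is a finite Galois extension $K_W/K$, computable from $K$ and $W$, such that for all coprime positive integers $m,t$ $$K(\zeta_m, W^{1/m})\cap K(\zeta_t, W^{1/t})\subset K_W.$$ (iii) There is a positive integer $c$, computable from $K$ and $W$, such that for all positive integers $m,t$ with $m$ coprime to both $t$ and $c$ $$K(\zeta_m, W^{1/m})\cap K(\zeta_t, W^{1/t})=K\quad\text{and}\quad [K(\zeta_m, W^{1/m}):K]=\varphi(m)\,m^{\operatorname{rank} W}.$$ Given moreover a finite Galois extension $F/K$ inside $\bar K$ and a positive integer $d$, there is such a $c$, computable from $K$, $W$, $F$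 and $d$, with $d\mid c$ and with $K(\zeta_m,W^{1/m})\cap F=K$ for all positive integers $m$ coprime to $c$. In both cases the stated properties, except for $d\mid c$, remain true if $c$ is replaced by the product of its distinct prime divisors. Here ``computable'' means that one algorithm, for all inputs, returns the object after finitely many steps, where $K$ is given by the minimal polynomial over $\mathbb Z$ of an algebraic integer $\theta$ with $K=\mathbb Q(\theta)$, elements of $K$ are given as integer polynomials in $\theta$ divided by positive integers, $W$ is given by a finite list of generators, and a finite Galois extension of $K$ is given by a finite list of polynomials over $K$ whose roots generate it. -/

import Mathlib

open Polynomial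

universe u v

/-! ### Cyclotomic–Kummer fields

`L` is an algebraic closure of the number field `K` and `W` is a subgroup of `Kˣ`. -/

section Fields

variable {K : Type*} (L : Type*) [Field K] [Field L] [Algebra K L]

/-- The rank of a subgroup of `Kˣ`, i.e. the rank of the group modulo its torsion. -/
noncomputable def groupRank (W : Subgroup Kˣ) : ℕ := Module.finrank ℤ (Additive W)

/-- `W^{1/n}`: all `n`-th roots in `L` of all elements of `W`. -/
def rootsOf (W : Subgroup Kˣ) (n : ℕ) : Set L :=
  {x | ∃ w ∈ W, x ^ n = algebraMap K L (w : K)}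

/-- `K(ζ_m, W^{1/m})`. -/
def cyclotomicKummer (W : Subgroup Kˣ) (m : ℕ) : IntermediateField K L :=
  IntermediateField.adjoin K ({x : L | x ^ m = 1} ∪ rootsOf L W m)

/-- `K(ζ_∞, W^{1/n})`. -/
def cyclotomicInftyKummer (W : Subgroup Kˣ) (n : ℕ) : IntermediateField K L :=
  IntermediateField.adjoin K ({x : L | ∃ k : ℕ, 0 < k ∧ x ^ k = 1} ∪ rootsOf L W n)

/-- For all `m, t ≥ 1` such that `m` is coprime to `t` and to `c`, the fields
`K(ζ_m, W^{1/m})` and `K(ζ_t, W^{1/t})` intersect in `K`, and the former has the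
maximal degree over `K`. -/
def IsIndependenceConstant (W : Subgroup Kˣ) (c : ℕ) : Prop :=
  ∀ m t : ℕ, 0 < m → 0 < t → m.Coprime t → m.Coprime c →
    cyclotomicKummer L W m ⊓ cyclotomicKummer L W t = ⊥ ∧
    Module.finrank K (cyclotomicKummer L W m) = m.totient * m ^ groupRank W

/-- For all `m ≥ 1` coprime to `c`, the fields `K(ζ_m, W^{1/m})` and `F` intersect in `K`. -/
def IsDisjointnessConstant (W : Subgroup Kˣ) (F : IntermediateField K L) (c : ℕ) : Prop :=
  ∀ m : ℕ, 0 < m → m.Coprime c → cyclotomicKummer L W m ⊓ F = ⊥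

end Fields

/-! ### Finite descriptions, which serve as input and output of the algorithms -/

/-- The polynomial with the given list of integer coefficients, constant term first. -/
noncomputable def intPoly (l : List ℤ) : ℤ[X] := l.foldr (fun a p => C a + X * p) 0

/-- A description of an element of `ℚ(θ)`: integers `a₀, …, aₖ` and `d : ℕ`, standing for
`(a₀ + a₁ θ + ⋯ + aₖ θᵏ) / (d + 1)`. -/
abbrev EltCode : Type := List ℤ × ℕ

/-- A description of a number field with a finitely generated subgroup of its multiplicative
group: the minimal polynomial over `ℤ` of an integral generator `θ` of the field, and a list
of generators of the group. -/
abbrev GroupCode : Type := List ℤ × List EltCode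

/-- A description of a finite Galois extension of `ℚ(θ)`: a finite list of polynomials over
`ℚ(θ)`, each given by its coefficients, constant term first; the extension is generated by all
their roots. -/
abbrev ExtCode : Type := List (List EltCode)

section Codes

variable {K : Type*} [Field K]

/-- The element described by an `EltCode`. -/
noncomputable def EltCode.eval (θ : K) (e : EltCode) : K :=
  aeval θ (intPoly e.1) / ((e.2 : K) + 1)

/-- The polynomial over `K` with the given list of coefficients. -/
noncomputable def codedPoly (θ : K) (l : List EltCode) : K[X] :=
  l.foldr (fun a p => C (EltCode.eval θ a) + X * p) 0

/-- The extension of `K` inside `L` described by an `ExtCode`: the splitting field of the listed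
polynomials. -/
noncomputable def ExtCode.field (L : Type*) [Field L] [Algebra K L] (θ : K) (E : ExtCode) :
    IntermediateField K L :=
  IntermediateField.adjoin K {x : L | ∃ l ∈ E, x ∈ (codedPoly θ l).rootSet L}

/-- `s` describes the number field `K`, through its generator `θ`, and the subgroup `W` of
`Kˣ`. -/
structure GroupCode.Describes [CharZero K] (s : GroupCode) (θ : K) (W : Subgroup Kˣ) : Prop where
  integral : IsIntegral ℤ θ
  generates : IntermediateField.adjoin ℚ {θ} = ⊤
  minpoly_eq : minpoly ℤ θ = intPoly s.1
  gens_ne_zero : ∀ e ∈ s.2, EltCode.eval θ e ≠ 0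
  closure_eq : W = Subgroup.closure {u : Kˣ | ∃ e ∈ s.2, (u : K) = EltCode.eval θ e}

end Codes

/-! ### Every number field, group and finite Galois extension has a description -/

section Existence

theorem exists_foldr_eq {R A : Type*} [CommRing R] (g : A → R) (hg : Function.Surjective g)
    (p : R[X]) : ∃ l : List A, l.foldr (fun a q => C (g a) + X * q) 0 = p := by
  suffices h : ∀ (n : ℕ) (p : R[X]), p.natDegree < n →
      ∃ l : List A, l.foldr (fun a q => C (g a) + X * q) 0 = p from h _ p (Nat.lt_succ_self _)
  intro n
  induction n with
  | zero => intro p hp; omega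
  | succ n ih =>
    intro p hp
    obtain ⟨a, ha⟩ := hg (p.coeff 0)
    by_cases h0 : p.natDegree = 0
    · refine ⟨[a], ?_⟩
      simp only [List.foldr_cons, List.foldr_nil, mul_zero, add_zero, ha]
      exact (eq_C_of_natDegree_eq_zero h0).symm
    · obtain ⟨l, hl⟩ := ih p.divX (by rw [natDegree_divX_eq_natDegree_tsub_one]; omega)
      refine ⟨a :: l, ?_⟩
      simp only [List.foldr_cons, hl, ha]
      rw [add_comm, X_mul_divX_add]

theorem exists_intPoly (p : ℤ[X]) : ∃ l : List ℤ, intPoly l = p :=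
  exists_foldr_eq (fun a : ℤ => a) Function.surjective_id p

variable {K : Type*} [Field K] [NumberField K]

theorem EltCode.eval_surjective (θ : K) (hθ : IntermediateField.adjoin ℚ {θ} = ⊤) :
    Function.Surjective (EltCode.eval θ) := by
  intro x
  have hx : x ∈ IntermediateField.adjoin ℚ {θ} := hθ ▸ IntermediateField.mem_top
  have hi : IsIntegral ℚ θ := Algebra.IsIntegral.isIntegral θ
  rw [← IntermediateField.mem_toSubalgebra,
    IntermediateField.adjoin_simple_toSubalgebra_of_isAlgebraic hi.isAlgebraic,
    Algebra.adjoin_singleton_eq_range_aeval] at hx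
  obtain ⟨q, rfl⟩ := hx
  obtain ⟨b, hb0, hb⟩ := IsLocalization.integerNormalization_spec (nonZeroDivisors ℤ) q
  have hb0 : b ≠ 0 := nonZeroDivisors.ne_zero hb0
  obtain ⟨l, hl⟩ :=
    exists_intPoly (C b * IsLocalization.integerNormalization (nonZeroDivisors ℤ) q)
  refine ⟨(l, (b * b).natAbs - 1), ?_⟩
  have hpos : 0 < (b * b).natAbs := Int.natAbs_pos.mpr (mul_ne_zero hb0 hb0)
  have hd : (((b * b).natAbs - 1 : ℕ) : K) + 1 = (b : K) * b := by
    have h1 : (((b * b).natAbs - 1 : ℕ) : ℤ) + 1 = b * b := by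
      have h2 := Int.natAbs_of_nonneg (mul_self_nonneg b)
      omega
    exact_mod_cast congrArg (fun n : ℤ => (n : K)) h1
  have hbK : (b : K) ≠ 0 := Int.cast_ne_zero.mpr hb0
  have he : aeval θ (IsLocalization.integerNormalization (nonZeroDivisors ℤ) q)
      = (b : K) * aeval θ q := by
    rw [← aeval_map_algebraMap ℚ, hb, map_zsmul, zsmul_eq_mul]
  simp only [EltCode.eval, hl, hd, map_mul, aeval_C, he]
  rw [algebraMap_int_eq, eq_intCast, ← mul_assoc,
    mul_div_cancel_left₀ _ (mul_ne_zero hbK hbK)]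
  rfl

theorem GroupCode.exists_describes (W : Subgroup Kˣ) (hW : W.FG) :
    ∃ (s : GroupCode) (θ : K), s.Describes θ W := by
  obtain ⟨α, hα⟩ := Field.exists_primitive_element ℚ K
  have halg : IsAlgebraic ℤ α :=
    (IsFractionRing.isAlgebraic_iff ℤ ℚ K).mpr (Algebra.IsAlgebraic.isAlgebraic α)
  obtain ⟨n, hn, hint⟩ := halg.exists_integral_multiple
  have hgen : IntermediateField.adjoin ℚ {n • α} = ⊤ := by
    rw [eq_top_iff, ← hα, IntermediateField.adjoin_simple_le_iff]
    have h1 : n • α ∈ IntermediateField.adjoin ℚ {n • α} :=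
      IntermediateField.mem_adjoin_simple_self ℚ _
    have h2 := IntermediateField.smul_mem _ h1 (x := (n : ℚ)⁻¹)
    have hnK : (n : K) ≠ 0 := Int.cast_ne_zero.mpr hn
    convert h2 using 1
    rw [Algebra.smul_def, zsmul_eq_mul, map_inv₀, map_intCast]
    field_simp
  obtain ⟨l, hl⟩ := exists_intPoly (minpoly ℤ (n • α))
  obtain ⟨S, hS⟩ := hW
  choose g hg using EltCode.eval_surjective (n • α) hgen
  refine ⟨(l, S.toList.map fun u : Kˣ => g (u : K)), n • α, hint, hgen, hl.symm, ?_, ?_⟩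
  · intro e he
    obtain ⟨u, -, rfl⟩ := List.mem_map.mp he
    rw [hg]
    exact Units.ne_zero _
  · rw [← hS]
    congr 1
    ext u
    simp only [Finset.mem_coe, Set.mem_ofPred_eq, List.mem_map, Finset.mem_toList]
    constructor
    · intro hu
      exact ⟨_, ⟨u, hu, rfl⟩, (hg _).symm⟩
    · rintro ⟨_, ⟨v, hv, rfl⟩, h⟩
      rw [hg] at h
      rwa [Units.ext h]

theorem ExtCode.exists_field_eq (L : Type*) [Field L] [Algebra K L] [IsAlgClosure K L] (θ : K)
    (hθ : IntermediateField.adjoin ℚ {θ} = ⊤) (F : IntermediateField K L)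
    [FiniteDimensional K F] [IsGalois K F] : ∃ E : ExtCode, ExtCode.field L θ E = F := by
  obtain ⟨p, -, hp⟩ := IsGalois.is_separable_splitting_field K F
  obtain ⟨l, hl⟩ := exists_foldr_eq (EltCode.eval θ) (EltCode.eval_surjective θ hθ) p
  have hl' : codedPoly θ l = p := hl
  refine ⟨[l], ?_⟩
  rw [(IntermediateField.isSplittingField_iff.mp hp).2]
  simp [ExtCode.field, hl']

end Existence

/-! Everything is controlled by one integer `z`. Let `a i` be a basis of W modulo torsion.
`IsRadicalBasis` asks that whenever ∏ (a i)^(e i) is an n-th power in K(ζ_∞), n divides z * e i for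
all i. Two facts provide such a `z` with an explicit bound. First, automorphisms over K commute on
K(ζ_∞), so a radical over K that lies in K(ζ_∞) falls into K, up to a root of unity, after raising
it to a power depending only on [K : ℚ] (`exists_pow_cyclotomicExponent_eq`). Second, an element of
Kˣ with some power in W has its M!-th power in W, where M is bounded by heights; this is a
pigeonhole argument on bounded algebraic integers (`pow_factorial_mem_of_pow_mem`). Kummer theory,
in the form of Dedekind's independence of the characters σ ↦ σ y / y, turns the divisibility into
the degrees of (i).

For (iii), let H = K(ζ_t, W^{1/t}) and let m be coprime to t and `z`. If all bad primes divide `z`,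
then H lies in an unramified subfield at each prime p dividing m: embed L in an algebraic closure of
Frac W(𝔽̄_p) and use Hensel's lemma. Over such fields the p-power cyclotomic polynomials stay
irreducible (Eisenstein), so adjoining ζ_m to H has degree φ(m); the radicals add m^rank by Kummer
theory. The degree over H equals the degree over K, hence the intersection is K
(`inf_le_of_relfinrank_le`). For a further extension F, large primes are again unramified, and the
generators of F have degrees prime to m, so F creates no new radicals of order m
(`mem_of_mem_sup_adjoin`).

For (ii), primes dividing `z` have to be allowed. The comparison is made over the level n = z^(2z+3)
instead of over K. There the degrees are maximal also at p ∣ z, because a root of unity of order N p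
never appears at level n when n ∣ N (`IsRadicalBasis.notMem_of_isPrimitiveRoot`). So the fields of
levels n m and n t meet in the field of level n.

Computability needs no arithmetic in number fields. The natural number encoding the input bounds all
its entries, and `z` is the factorial of a primitive recursive bound in that number; this makes it
divisible by all relevant exponents and bad primes. -/

/-! ### Kummer theory -/

section Kummer

variable (k : Type*) {L : Type*} [Field k] [Field L] [Algebra k L]

/-- A nonzero element which every `k`-automorphism of `L` multiplies by an element of `k`. -/
def IsKummerElt (y : L) : Prop :=
  y ≠ 0 ∧ ∀ σ : L ≃ₐ[k] L, ∃ c : k, σ y = algebraMap k L c * y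

variable {k}

theorem IsKummerElt.one : IsKummerElt k (1 : L) :=
  ⟨one_ne_zero, fun σ => ⟨1, by simp⟩⟩

theorem IsKummerElt.mul {x y : L} (hx : IsKummerElt k x) (hy : IsKummerElt k y) :
    IsKummerElt k (x * y) := by
  refine ⟨mul_ne_zero hx.1 hy.1, fun σ => ?_⟩
  obtain ⟨c, hc⟩ := hx.2 σ
  obtain ⟨d, hd⟩ := hy.2 σ
  exact ⟨c * d, by rw [map_mul, hc, hd, map_mul]; ring⟩

theorem IsKummerElt.inv {x : L} (hx : IsKummerElt k x) : IsKummerElt k x⁻¹ := by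
  refine ⟨inv_ne_zero hx.1, fun σ => ?_⟩
  obtain ⟨c, hc⟩ := hx.2 σ
  exact ⟨c⁻¹, by rw [map_inv₀, hc, mul_inv, map_inv₀]⟩

theorem IsKummerElt.pow {x : L} (hx : IsKummerElt k x) (n : ℕ) : IsKummerElt k (x ^ n) := by
  induction n with
  | zero => simpa using IsKummerElt.one
  | succ n ih => rw [pow_succ]; exact ih.mul hx

theorem IsKummerElt.zpow {x : L} (hx : IsKummerElt k x) (n : ℤ) : IsKummerElt k (x ^ n) := by
  cases n with
  | ofNat n => simpa using hx.pow n
  | negSucc n => rw [zpow_negSucc]; exact (hx.pow _).inv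

theorem IsKummerElt.prod_zpow {ι : Type*} [Fintype ι] {β : ι → L}
    (hβ : ∀ i, IsKummerElt k (β i)) (g : ι → ℤ) : IsKummerElt k (∏ i, β i ^ g i) := by
  classical
  induction (Finset.univ : Finset ι) using Finset.induction_on with
  | empty => simpa using IsKummerElt.one
  | insert i s hi ih => rw [Finset.prod_insert hi]; exact ((hβ i).zpow _).mul ih

/-- Since σ fixes y ^ n, the quotient σ y / y is an n-th root of unity. -/
theorem IsKummerElt.of_pow_mem {y : L} (hy : y ≠ 0) {n : ℕ}
    (hroots : ∀ ζ : L, ζ ^ n = 1 → ζ ∈ (algebraMap k L).range)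
    (hyn : y ^ n ∈ (algebraMap k L).range) : IsKummerElt k y := by
  refine ⟨hy, fun σ => ?_⟩
  obtain ⟨b, hb⟩ := hyn
  obtain ⟨c, hc⟩ := hroots (σ y / y) (by
    rw [div_pow, ← map_pow, ← hb, AlgEquiv.commutes, hb, div_self (pow_ne_zero _ hy)])
  exact ⟨c, by rw [hc, div_mul_cancel₀ _ hy]⟩

/-- The character `σ ↦ σ y / y` attached to a Kummer element. -/
noncomputable def IsKummerElt.char {y : L} (hy : IsKummerElt k y) : (L ≃ₐ[k] L) →* L where
  toFun σ := σ y / y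
  map_one' := by simp [hy.1]
  map_mul' σ τ := by
    have h0 := hy.1
    obtain ⟨c, hc⟩ := hy.2 σ
    obtain ⟨d, hd⟩ := hy.2 τ
    rw [AlgEquiv.mul_apply, hd, map_mul, AlgEquiv.commutes, hc]
    field_simp

theorem IsKummerElt.char_apply_mul {y : L} (hy : IsKummerElt k y) (σ : L ≃ₐ[k] L) :
    hy.char σ * y = σ y := div_mul_cancel₀ _ hy.1

variable [IsGalois k L]

theorem mem_range_of_forall_fixed {x : L} (h : ∀ σ : L ≃ₐ[k] L, σ x = x) :
    x ∈ (algebraMap k L).range :=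
  (InfiniteGalois.mem_range_algebraMap_iff_fixed x).mpr h

/-- Equality of the characters means that y / x is fixed by every automorphism, and L / k is Galois.
-/
theorem IsKummerElt.exists_of_char_eq {x y : L} (hx : IsKummerElt k x) (hy : IsKummerElt k y)
    (h : hx.char = hy.char) : ∃ c : k, y = algebraMap k L c * x := by
  have hx0 := hx.1
  obtain ⟨c, hc⟩ := mem_range_of_forall_fixed (k := k) (x := y / x) fun σ => by
    rw [map_div₀, ← hx.char_apply_mul, ← hy.char_apply_mul, h,
      mul_div_mul_left _ _ (fun h0 => ?_)]
    have := hy.char_apply_mul σ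
    rw [h0, zero_mul] at this
    exact hy.1 (by simpa using this.symm)
  exact ⟨c, by rw [hc, div_mul_cancel₀ _ hx0]⟩

/-- A Kummer element in the span of a set of Kummer elements is proportional to one of them. -/
theorem IsKummerElt.exists_of_mem_span {S : Set L} (hS : ∀ m ∈ S, IsKummerElt k m) {y : L}
    (hy : IsKummerElt k y) (hyS : y ∈ Submodule.span k S) :
    ∃ m ∈ S, ∃ c : k, y = algebraMap k L c * m := by
  by_contra! hcon
  have hne : ∀ m (hm : m ∈ S), (hS m hm).char ≠ hy.char := fun m hm h => by
    obtain ⟨c, hc⟩ := (hS m hm).exists_of_char_eq hy h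
    exact hcon m hm c hc
  let T : Set ((L ≃ₐ[k] L) →* L) := {χ | χ ≠ hy.char}
  -- The map `ev` sends x to σ ↦ σ x, which for a Kummer element is the element times its character.
  -- If no member of S were proportional to y, the character of y would lie in the L-span of other
  -- characters, against Dedekind's independence.
  let ev : L →ₗ[k] ((L ≃ₐ[k] L) → L) := LinearMap.pi fun σ => σ.toLinearMap
  have key : ∀ x ∈ Submodule.span k S,
      ev x ∈ Submodule.span L ((fun χ : (L ≃ₐ[k] L) →* L => (χ : (L ≃ₐ[k] L) → L)) '' T) := by
    intro x hx
    induction hx using Submodule.span_induction with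
    | mem m hm =>
      have : ev m = m • ((hS m hm).char : (L ≃ₐ[k] L) → L) := by
        funext σ
        have := (hS m hm).char_apply_mul σ
        simp [ev, ← this, mul_comm]
      rw [this]
      exact Submodule.smul_mem _ _ (Submodule.subset_span ⟨_, hne m hm, rfl⟩)
    | zero => simp
    | add x y _ _ hx hy => rw [map_add]; exact Submodule.add_mem _ hx hy
    | smul c x _ hx =>
      have : ev (c • x) = algebraMap k L c • ev x := by
        funext σ
        simp [ev, Algebra.smul_def]
      rw [this]
      exact Submodule.smul_mem _ _ hx
  have h1 := key y hyS
  have h2 : ev y = y • (hy.char : (L ≃ₐ[k] L) → L) := by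
    funext σ
    have := hy.char_apply_mul σ
    simp [ev, ← this, mul_comm]
  rw [h2, Submodule.smul_mem_iff _ hy.1] at h1
  exact (linearIndependent_monoidHom (L ≃ₐ[k] L) L).notMem_span_image
    (s := T) (x := hy.char) (by simp [T]) h1

theorem exists_prod_zpow_of_mem_closure {ι M : Type*} [Fintype ι] [CommGroupWithZero M] {β : ι → M}
    (hβ : ∀ i, β i ≠ 0) {m : M} (hm : m ∈ Submonoid.closure (Set.range β)) :
    ∃ g : ι → ℤ, m = ∏ i, β i ^ g i := by
  classical
  induction hm using Submonoid.closure_induction with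
  | mem x hx =>
    obtain ⟨i, rfl⟩ := hx
    refine ⟨Pi.single i 1, ?_⟩
    rw [Finset.prod_eq_single i] <;> simp +contextual
  | one => exact ⟨0, by simp⟩
  | mul x y _ _ hx hy =>
    obtain ⟨g, rfl⟩ := hx
    obtain ⟨h, rfl⟩ := hy
    exact ⟨g + h, by simp [zpow_add₀ (hβ _), Finset.prod_mul_distrib]⟩

/-- As L / k is algebraic, the field generated by the β i is already the algebra generated by them,
so monomials span it. -/
theorem toSubmodule_adjoin_range {ι : Type*} (β : ι → L) :
    Subalgebra.toSubmodule (IntermediateField.adjoin k (Set.range β)).toSubalgebra =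
      Submodule.span k (Submonoid.closure (Set.range β) : Set L) := by
  rw [IntermediateField.adjoin_toSubalgebra_of_isAlgebraic
    fun x _ => Algebra.IsAlgebraic.isAlgebraic x, Algebra.adjoin_eq_span]

/-- A Kummer element in the field generated by Kummer elements `β i` is, up to a factor in the
base field, a product of powers of the `β i`. -/
theorem IsKummerElt.exists_of_mem_adjoin {ι : Type*} [Fintype ι] {β : ι → L}
    (hβ : ∀ i, IsKummerElt k (β i)) {y : L} (hy : IsKummerElt k y)
    (hyβ : y ∈ IntermediateField.adjoin k (Set.range β)) :
    ∃ (g : ι → ℤ) (c : k), y = algebraMap k L c * ∏ i, β i ^ g i := by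
  have h1 : y ∈ Submodule.span k (Submonoid.closure (Set.range β) : Set L) := by
    rw [← toSubmodule_adjoin_range]; exact hyβ
  have hcl : ∀ m ∈ (Submonoid.closure (Set.range β) : Set L), ∃ g : ι → ℤ, m = ∏ i, β i ^ g i :=
    fun m hm => exists_prod_zpow_of_mem_closure (fun i => (hβ i).1) hm
  obtain ⟨m, hm, c, hc⟩ := IsKummerElt.exists_of_mem_span (fun m hm => by
    obtain ⟨g, rfl⟩ := hcl m hm
    exact IsKummerElt.prod_zpow hβ g) hy h1
  obtain ⟨g, rfl⟩ := hcl m hm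
  exact ⟨g, c, hc⟩

theorem finite_adjoin_range {ι : Type*} [Finite ι] (β : ι → L) :
    FiniteDimensional k (IntermediateField.adjoin k (Set.range β)) :=
  have := Set.finite_range β
  IntermediateField.finiteDimensional_adjoin fun x _ => Algebra.IsIntegral.isIntegral x

/-- Adjoining `t`-th roots of `r` elements gives an extension of degree at most `t ^ r`. -/
theorem finrank_adjoin_range_le {r t : ℕ} (ht : 0 < t) {β : Fin r → L} (hβ0 : ∀ i, β i ≠ 0)
    (hβ : ∀ i, β i ^ t ∈ (algebraMap k L).range) :
    Module.finrank k (IntermediateField.adjoin k (Set.range β)) ≤ t ^ r := by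
  -- Exponents matter only modulo t, because the t-th powers of the β i are scalars.
  have hsub : Submodule.span k (Submonoid.closure (Set.range β) : Set L) ≤
      Submodule.span k (Set.range fun g : Fin r → Fin t => ∏ i, β i ^ (g i : ℕ)) := by
    rw [Submodule.span_le]
    intro m hm
    obtain ⟨g, rfl⟩ := exists_prod_zpow_of_mem_closure hβ0 hm
    choose b hb using hβ
    have ht' : (t : ℤ) ≠ 0 := by exact_mod_cast ht.ne'
    have : ∏ i, β i ^ g i = (∏ i, b i ^ (g i / t)) •
        ∏ i, β i ^ (((⟨(g i % t).toNat, by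
          have := Int.emod_lt_of_pos (g i) (by exact_mod_cast ht : (0 : ℤ) < t)
          have := Int.emod_nonneg (g i) ht'
          omega⟩ : Fin t) : ℕ)) := by
      rw [Algebra.smul_def, map_prod, ← Finset.prod_mul_distrib]
      refine Finset.prod_congr rfl fun i _ => ?_
      have h1 : (((g i % t).toNat : ℕ) : ℤ) = g i % t :=
        Int.toNat_of_nonneg (Int.emod_nonneg _ ht')
      rw [map_zpow₀, hb, ← zpow_natCast (β i) t, ← zpow_mul, ← zpow_natCast, h1,
        ← zpow_add₀ (hβ0 i), Int.mul_ediv_add_emod]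
    rw [this]
    exact Submodule.smul_mem _ _ (Submodule.subset_span ⟨_, rfl⟩)
  have h2 : Module.finrank k (IntermediateField.adjoin k (Set.range β)) =
      Module.finrank k (Submodule.span k (Submonoid.closure (Set.range β) : Set L)) := by
    rw [← toSubmodule_adjoin_range]; rfl
  rw [h2]
  have := FiniteDimensional.span_of_finite k
    (Set.finite_range fun g : Fin r → Fin t => ∏ i, β i ^ (g i : ℕ))
  refine (Submodule.finrank_mono hsub).trans ((finrank_range_le_card _).trans ?_)
  simp

/-- Adjoining `t`-th roots of `r` elements which are independent modulo `t`-th powers gives an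
extension of degree `t ^ r`. -/
theorem finrank_adjoin_range_eq {r t : ℕ} (ht : 0 < t) {β : Fin r → L}
    (hβ : ∀ i, IsKummerElt k (β i)) (hβt : ∀ i, β i ^ t ∈ (algebraMap k L).range)
    (hind : ∀ f : Fin r → ℤ, ∏ i, β i ^ f i ∈ (algebraMap k L).range → ∀ i, (t : ℤ) ∣ f i) :
    Module.finrank k (IntermediateField.adjoin k (Set.range β)) = t ^ r := by
  refine le_antisymm (finrank_adjoin_range_le ht (fun i => (hβ i).1) hβt) ?_
  -- These t ^ r monomials have distinct characters: two with the same character are proportional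
  -- over k, so by `hind` their exponents agree modulo t and hence agree. Independence of characters
  -- then gives linear independence.
  let mon : (Fin r → Fin t) → L := fun g => ∏ i, β i ^ ((g i : ℕ) : ℤ)
  have hmon : ∀ g, IsKummerElt k (mon g) := fun g => IsKummerElt.prod_zpow hβ _
  have hinj : Function.Injective fun g => (hmon g).char := by
    intro g h hgh
    obtain ⟨c, hc⟩ := (hmon g).exists_of_char_eq (hmon h) hgh
    have h1 := hind (fun i => ((h i : ℕ) : ℤ) - ((g i : ℕ) : ℤ)) ⟨c, by
      simp only [zpow_sub₀ (hβ _).1, Finset.prod_div_distrib]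
      exact ((div_eq_iff (hmon g).1).mpr hc).symm⟩
    funext i
    obtain ⟨q, hq⟩ := h1 i
    have hg := (g i).2
    have hh := (h i).2
    apply Fin.ext
    have hq0 : q = 0 := by
      by_contra hq0
      rcases lt_or_gt_of_ne hq0 with hq1 | hq1 <;> nlinarith
    subst hq0
    omega
  have hLI : LinearIndependent k mon := by
    rw [Fintype.linearIndependent_iff]
    intro c hc
    have h1 := (Fintype.linearIndependent_iff.mp
      ((linearIndependent_monoidHom (L ≃ₐ[k] L) L).comp _ hinj))
      (fun g => algebraMap k L (c g) * mon g) (by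
        funext σ
        have h2 := congrArg σ hc
        simp only [map_sum, map_smul, map_zero] at h2
        rw [Finset.sum_apply, Pi.zero_apply, ← h2]
        refine Finset.sum_congr rfl fun g _ => ?_
        simp only [Function.comp, Pi.smul_apply, smul_eq_mul]
        rw [mul_assoc, mul_comm (mon g), (hmon g).char_apply_mul, Algebra.smul_def])
    intro g
    have := h1 g
    simpa [(hmon g).1] using this
  have hmem : ∀ g, mon g ∈ IntermediateField.adjoin k (Set.range β) := fun g =>
    prod_mem fun i _ => zpow_mem (IntermediateField.subset_adjoin k (Set.range β) ⟨i, rfl⟩) _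
  have := finite_adjoin_range (k := k) β
  have hLI' : LinearIndependent k
      (fun g => (⟨mon g, hmem g⟩ : IntermediateField.adjoin k (Set.range β))) :=
    LinearIndependent.of_comp (IntermediateField.adjoin k (Set.range β)).val.toLinearMap hLI
  simpa using hLI'.fintype_card_le_finrank

end Kummer

/-! ### The cyclotomic character and radicals in cyclotomic extensions -/

section Cyclotomic

/-- `K(ζ_∞)`. -/
def cyclotomicInfty (K L : Type*) [Field K] [Field L] [Algebra K L] : IntermediateField K L :=
  IntermediateField.adjoin K {x : L | ∃ k : ℕ, 0 < k ∧ x ^ k = 1}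

/-- The bound does not depend on N. Write N = 2^k m with m odd and take x ≡ 2 mod m, x ≡ 3 mod 2^k:
then x is coprime to N, and a common divisor of x^e - 1 with m, respectively 2^k, divides 2^e - 1,
respectively 3^e - 1. -/
theorem exists_coprime_gcd_pow_sub_one_dvd {N e : ℕ} (hN : 0 < N) :
    ∃ x, 0 < x ∧ x.Coprime N ∧ (x ^ e - 1).gcd N ∣ (2 ^ e - 1) * (3 ^ e - 1) := by
  obtain ⟨k, m, hm, rfl⟩ := Nat.exists_eq_two_pow_mul_odd hN.ne'
  have hcop : m.Coprime (2 ^ k) := (Nat.coprime_two_right.mpr hm).pow_right _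
  obtain ⟨y, hy1, hy2⟩ := Nat.chineseRemainder hcop 2 3
  -- Adding the modulus makes the residue positive.
  have hz1 : y + 2 ^ k * m ≡ 2 [MOD m] := by
    simpa using hy1.add (Nat.modEq_zero_iff_dvd.mpr (dvd_mul_left m (2 ^ k)))
  have hz2 : y + 2 ^ k * m ≡ 3 [MOD 2 ^ k] := by
    simpa using hy2.add (Nat.modEq_zero_iff_dvd.mpr (dvd_mul_right (2 ^ k) m))
  generalize hx : y + 2 ^ k * m = x at hz1 hz2
  have hxpos : 0 < x := by omega
  have aux : ∀ a b : ℕ, 0 < a → x ≡ a [MOD b] → (x ^ e - 1).gcd b ∣ a ^ e - 1 := by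
    intro a b ha hxa
    have h1 : x ^ e ≡ 1 [MOD (x ^ e - 1).gcd b] :=
      ((Nat.modEq_iff_dvd' (Nat.one_le_pow _ _ hxpos)).mpr (Nat.gcd_dvd_left _ _)).symm
    have h2 : x ^ e ≡ a ^ e [MOD (x ^ e - 1).gcd b] := (hxa.pow e).of_dvd (Nat.gcd_dvd_right _ _)
    exact (Nat.modEq_iff_dvd' (Nat.one_le_pow _ _ ha)).mp (h1.symm.trans h2)
  refine ⟨x, hxpos, Nat.Coprime.mul_right ?_ ?_, ?_⟩
  · rw [Nat.Coprime, hz2.gcd_eq]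
    exact Nat.Coprime.pow_right _ (by norm_num)
  · rw [Nat.Coprime, hz1.gcd_eq]
    exact Nat.coprime_two_left.mpr hm
  · refine (Nat.gcd_mul_right_dvd_mul_gcd _ _ _).trans ?_
    rw [mul_comm]
    exact mul_dvd_mul (aux 2 m (by norm_num) hz1) (aux 3 _ (by norm_num) hz2)

variable {K L : Type*} [Field K] [Field L] [Algebra K L]

theorem apply_eq_pow_of_primitiveRoot {N : ℕ} [NeZero N] {ζ₀ : L} (hζ₀ : IsPrimitiveRoot ζ₀ N)
    {F : Type*} [FunLike F L L] [MonoidHomClass F L L] {σ : F} {x : ℕ} (hσ : σ ζ₀ = ζ₀ ^ x) {ζ : L}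
    (hζ : ζ ^ N = 1) : σ ζ = ζ ^ x := by
  obtain ⟨i, -, rfl⟩ := hζ₀.eq_pow_of_pow_eq_one hζ
  rw [map_pow, hσ, ← pow_mul, ← pow_mul, mul_comm]

theorem exists_apply_eq_pow [IsAlgClosed L] [CharZero L] (σ : L ≃ₐ[K] L) {N : ℕ} (hN : 0 < N) :
    ∃ x : ℕ, ∀ ζ : L, ζ ^ N = 1 → σ ζ = ζ ^ x := by
  have : NeZero N := ⟨hN.ne'⟩
  obtain ⟨ζ₀, hζ₀⟩ := HasEnoughRootsOfUnity.exists_primitiveRoot L N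
  obtain ⟨x, -, hx⟩ := hζ₀.eq_pow_of_pow_eq_one (ξ := σ ζ₀) (by
    rw [← map_pow, hζ₀.pow_eq_one, map_one])
  exact ⟨x, fun ζ hζ => apply_eq_pow_of_primitiveRoot hζ₀ hx.symm hζ⟩

/-- Automorphisms raise roots of unity of a given order to powers, and taking powers commutes. -/
theorem apply_comm_of_mem_cyclotomicInfty [IsAlgClosed L] [CharZero L] (σ τ : L ≃ₐ[K] L) {α : L}
    (hα : α ∈ cyclotomicInfty K L) : σ (τ α) = τ (σ α) := by
  induction hα using IntermediateField.adjoin_induction with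
  | mem x hx =>
    obtain ⟨k, hk, hxk⟩ := hx
    obtain ⟨a, ha⟩ := exists_apply_eq_pow σ hk
    obtain ⟨b, hb⟩ := exists_apply_eq_pow τ hk
    rw [ha x hxk, hb x hxk, map_pow, map_pow, ha x hxk, hb x hxk, ← pow_mul, ← pow_mul, mul_comm]
  | algebraMap x => simp
  | add x y _ _ hx hy => simp [hx, hy]
  | inv x _ hx => simp [hx]
  | mul x y _ _ hx hy => simp [hx, hy]

variable [NumberField K] [IsAlgClosure K L] [CharZero L]

/-- The automorphisms of `L` over `K` realize all `[K : ℚ]!`-th powers on roots of unity. -/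
theorem exists_aut_apply_eq_pow {N x : ℕ} (hN : 0 < N) (hx : x.Coprime N) :
    ∃ σ : L ≃ₐ[K] L, ∀ ζ : L, ζ ^ N = 1 → σ ζ = ζ ^ x ^ (Module.finrank ℚ K).factorial := by
  have := IsAlgClosure.isAlgClosed K (K := L)
  have : NeZero N := ⟨hN.ne'⟩
  have : Algebra.IsAlgebraic ℚ L := Algebra.IsAlgebraic.trans ℚ K L
  have : IsAlgClosure ℚ L := ⟨inferInstance, inferInstance⟩
  obtain ⟨ζ₀, hζ₀⟩ := HasEnoughRootsOfUnity.exists_primitiveRoot L N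
  -- Over ℚ the cyclotomic polynomial is the minimal polynomial of both ζ₀ and ζ₀ ^ x, which yields
  -- an automorphism over ℚ; it remains to make a power of it fix K.
  have hconj : IsConjRoot ℚ (ζ₀ ^ x) ζ₀ := by
    rw [IsConjRoot, ← cyclotomic_eq_minpoly_rat hζ₀ hN,
      ← cyclotomic_eq_minpoly_rat (hζ₀.pow_of_coprime x hx) hN]
  obtain ⟨τ, hτ⟩ := hconj.exists_algEquiv
  have hτpow : ∀ i : ℕ, ∀ ζ : L, ζ ^ N = 1 → (τ ^ i) ζ = ζ ^ x ^ i := by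
    intro i
    induction i with
    | zero => simp
    | succ i ih =>
      intro ζ hζ
      rw [pow_succ', AlgEquiv.mul_apply, ih ζ hζ, map_pow,
        apply_eq_pow_of_primitiveRoot hζ₀ hτ hζ, ← pow_mul, pow_succ', mul_comm]
  let j : K →ₐ[ℚ] L := IsScalarTower.toAlgHom ℚ K L
  -- K has only [K : ℚ] embeddings into L, so two of the powers τ^0, …, τ^[K : ℚ] agree on K. Their
  -- quotient is a power with exponent at most [K : ℚ], which divides the factorial.
  obtain ⟨a, b, hab, hj⟩ := Fintype.exists_ne_map_eq_of_card_lt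
    (fun i : Fin (Module.finrank ℚ K + 1) => ((τ ^ (i : ℕ) : L ≃ₐ[ℚ] L) : L →ₐ[ℚ] L).comp j)
    (by rw [AlgHom.card]; simp)
  have key : ∀ a b : ℕ, a < b → b ≤ Module.finrank ℚ K →
      ((τ ^ a : L ≃ₐ[ℚ] L) : L →ₐ[ℚ] L).comp j = ((τ ^ b : L ≃ₐ[ℚ] L) : L →ₐ[ℚ] L).comp j →
      ∀ y : K, (τ ^ (Module.finrank ℚ K).factorial) (algebraMap K L y) = algebraMap K L y := by
    intro a b hab hb h y
    have h1 : ∀ y : K, (τ ^ (b - a)) (algebraMap K L y) = algebraMap K L y := by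
      intro y
      have h2 : (τ ^ a) (algebraMap K L y) = (τ ^ b) (algebraMap K L y) := DFunLike.congr_fun h y
      have h3 : b = a + (b - a) := by omega
      rw [h3, pow_add, AlgEquiv.mul_apply] at h2
      exact ((τ ^ a).injective h2).symm
    obtain ⟨q, hq⟩ := Nat.dvd_factorial (show 0 < b - a by omega)
      (show b - a ≤ Module.finrank ℚ K by omega)
    rw [hq, pow_mul]
    generalize τ ^ (b - a) = ρ at h1
    induction q generalizing y with
    | zero => simp
    | succ q ih =>
      clear hq
      have ih' : ∀ y, (ρ ^ q) (algebraMap K L y) = algebraMap K L y := by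
        intro y
        clear ih
        induction q with
        | zero => simp
        | succ q ih => rw [pow_succ, AlgEquiv.mul_apply, h1, ih]
      rw [pow_succ, AlgEquiv.mul_apply, h1, ih']
  have hfix : ∀ y : K,
      (τ ^ (Module.finrank ℚ K).factorial) (algebraMap K L y) = algebraMap K L y := by
    rcases lt_or_gt_of_ne (Fin.val_ne_of_ne hab) with h | h
    · exact key a b h (by omega) hj
    · exact key b a h (by omega) hj.symm
  exact ⟨AlgEquiv.ofRingEquiv (f := (τ ^ (Module.finrank ℚ K).factorial).toRingEquiv) hfix,
    hτpow _⟩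

variable (K) in
/-- An exponent which moves all radicals over `K` in `K(ζ_∞)` into `K`, up to roots of unity. -/
noncomputable def cyclotomicExponent : ℕ :=
  (2 ^ (Module.finrank ℚ K).factorial - 1) * (3 ^ (Module.finrank ℚ K).factorial - 1)

/-- Let τ act on the n-th roots of unity by the exponent u. Any σ multiplies α by an n-th root of
unity ω, and since σ and τ commute on α it multiplies τ α by ω^u. So α^u / τ α lies in K, that is,
α^(u-1) is in K up to a root of unity; also α^n is in K, so the same holds for α^gcd(u-1, n), and
this gcd divides a constant. -/
theorem exists_pow_cyclotomicExponent_eq {α : L} (hα0 : α ≠ 0) (hα : α ∈ cyclotomicInfty K L)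
    {n : ℕ} (hn : 0 < n) (hαn : α ^ n ∈ (algebraMap K L).range) :
    ∃ (h : K) (ζ : L), ζ ^ n = 1 ∧ α ^ cyclotomicExponent K = algebraMap K L h * ζ := by
  have := IsAlgClosure.isAlgClosed K (K := L)
  set e := (Module.finrank ℚ K).factorial with he
  obtain ⟨x, hx0, hx, hdvd⟩ := exists_coprime_gcd_pow_sub_one_dvd (e := e) hn
  obtain ⟨τ, hτ⟩ := exists_aut_apply_eq_pow (K := K) (L := L) hn hx
  rw [← he] at hτ
  set u := x ^ e with hu
  have hu1 : 1 ≤ u := Nat.one_le_pow _ _ hx0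
  obtain ⟨w, hw⟩ := hαn
  have hquot : ∀ σ : L ≃ₐ[K] L, (σ α / α) ^ n = 1 := fun σ => by
    rw [div_pow, ← map_pow, ← hw, AlgEquiv.commutes, hw, div_self (pow_ne_zero _ hα0)]
  have hτα : τ α ≠ 0 := (_root_.map_ne_zero _).mpr hα0
  obtain ⟨b, hb⟩ := mem_range_of_forall_fixed (k := K) (x := α ^ u / τ α) fun σ => by
    have h1 : σ α = (σ α / α) * α := (div_mul_cancel₀ _ hα0).symm
    have h0 : σ α / α ≠ 0 := div_ne_zero ((_root_.map_ne_zero _).mpr hα0) hα0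
    rw [map_div₀, map_pow, apply_comm_of_mem_cyclotomicInfty σ τ hα, h1, map_mul,
      hτ _ (hquot σ), mul_pow, mul_div_mul_left _ _ (pow_ne_zero _ h0)]
  have hη := hquot τ
  have h1 : α ^ (u - 1) = algebraMap K L b * (τ α / α) := by
    rw [hb, div_mul_div_cancel₀ hτα, eq_div_iff hα0, ← pow_succ, Nat.sub_add_cancel hu1]
  have hα_unit : α ^ (((u - 1).gcd n : ℕ) : ℤ) =
      algebraMap K L (b ^ (u - 1).gcdA n * w ^ (u - 1).gcdB n) * (τ α / α) ^ (u - 1).gcdA n := by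
    rw [Nat.gcd_eq_gcd_ab, zpow_add₀ hα0, zpow_mul, zpow_mul, zpow_natCast, zpow_natCast, h1, ← hw,
      mul_zpow, map_mul, map_zpow₀, map_zpow₀]
    ring
  obtain ⟨q, hq⟩ := hdvd
  refine ⟨(b ^ (u - 1).gcdA n * w ^ (u - 1).gcdB n) ^ q, ((τ α / α) ^ (u - 1).gcdA n) ^ q, ?_, ?_⟩
  · have h2 : ((τ α / α) ^ (u - 1).gcdA n) ^ n = 1 := by
      rw [← zpow_natCast, ← zpow_mul, mul_comm, zpow_mul, zpow_natCast, hη, one_zpow]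
    rw [← pow_mul, mul_comm, pow_mul, h2, one_pow]
  · rw [cyclotomicExponent, ← he, hq, pow_mul, ← zpow_natCast α, hα_unit, mul_pow, map_pow]

/-- The roots of unity in `K` have bounded order. -/
theorem pow_cyclotomicExponent_eq_one {ζ : K} {n : ℕ} (hn : 0 < n) (hζ : ζ ^ n = 1) :
    ζ ^ cyclotomicExponent K = 1 := by
  have : CharZero (AlgebraicClosure K) := inferInstance
  set L := AlgebraicClosure K
  set e := (Module.finrank ℚ K).factorial with he
  obtain ⟨x, hx0, hx, hdvd⟩ := exists_coprime_gcd_pow_sub_one_dvd (e := e) hn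
  obtain ⟨τ, hτ⟩ := exists_aut_apply_eq_pow (K := K) (L := L) hn hx
  have hζ0 : ζ ≠ 0 := by
    rintro rfl
    simp [hn.ne'] at hζ
  -- The automorphism τ fixes ζ, which lies in K, but also raises it to the power x ^ e.
  have h1 : ζ ^ x ^ e = ζ := by
    apply (algebraMap K L).injective
    rw [map_pow, ← hτ _ (by rw [← map_pow, hζ, map_one]), AlgEquiv.commutes]
  have h2 : ζ ^ (x ^ e - 1) = 1 := by
    have h3 : x ^ e - 1 + 1 = x ^ e := Nat.sub_add_cancel (Nat.one_le_pow _ _ hx0)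
    rw [← h3, pow_succ] at h1
    exact (mul_eq_right₀ hζ0).mp h1
  obtain ⟨q, hq⟩ := hdvd
  rw [cyclotomicExponent, ← he, hq, pow_mul, pow_gcd_eq_one.mpr ⟨h2, hζ⟩, one_pow]

theorem cyclotomicExponent_pos : 0 < cyclotomicExponent K := by
  have h : 0 < (Module.finrank ℚ K).factorial := Nat.factorial_pos _
  refine Nat.mul_pos ?_ ?_ <;> exact Nat.sub_pos_of_lt (Nat.one_lt_pow h.ne' (by norm_num))

end Cyclotomic

/-! ### Embeddings into the maximal unramified extension of the `p`-adic numbers -/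

section Unramified

variable (p : ℕ) [Fact p.Prime]

/-- The Witt vectors of an algebraic closure of `𝔽_p`, i.e. the completed ring of integers of the
maximal unramified extension of `ℚ_p`. -/
abbrev UnramifiedRing : Type := WittVector p (AlgebraicClosure (ZMod p))

theorem UnramifiedRing.isUnit_natCast {n : ℕ} (hn : ¬ p ∣ n) : IsUnit (n : UnramifiedRing p) := by
  apply WittVector.isUnit_of_coeff_zero_ne_zero
  have h : WittVector.constantCoeff (n : UnramifiedRing p) = n := map_natCast _ n
  change WittVector.constantCoeff (n : UnramifiedRing p) ≠ 0
  rw [h, Ne, CharP.cast_eq_zero_iff (AlgebraicClosure (ZMod p)) p]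
  exact hn

theorem UnramifiedRing.isUnit_intCast {n : ℤ} (hn : ¬ (p : ℤ) ∣ n) :
    IsUnit (n : UnramifiedRing p) := by
  rcases Int.natAbs_eq n with h | h <;> rw [h]
  · rw [Int.cast_natCast]
    exact UnramifiedRing.isUnit_natCast p (by rwa [← Int.natCast_dvd])
  · rw [Int.cast_neg, Int.cast_natCast, IsUnit.neg_iff]
    exact UnramifiedRing.isUnit_natCast p (by rwa [← Int.natCast_dvd])

instance UnramifiedRing.charZero : CharZero (UnramifiedRing p) := by
  refine charZero_of_inj_zero fun n hn => ?_
  by_contra hn0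
  obtain ⟨a, m, hm, rfl⟩ := Nat.exists_eq_pow_mul_and_not_dvd hn0 p (Fact.out : p.Prime).ne_one
  rw [Nat.cast_mul, (UnramifiedRing.isUnit_natCast p hm).mul_left_eq_zero, Nat.cast_pow] at hn
  exact WittVector.p_nonzero p _ (eq_zero_of_pow_eq_zero hn)

/-- Hensel's lemma: a monic polynomial over the unramified ring with separable reduction has all
its roots in that ring. -/
theorem UnramifiedRing.exists_of_root {q : (UnramifiedRing p)[X]} (hq : q.Monic)
    (hsep : (q.map WittVector.constantCoeff).Separable) {Ω : Type*} [Field Ω]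
    (f : UnramifiedRing p →+* Ω) (hf : Function.Injective f) {y : Ω} (hy : (q.map f).IsRoot y) :
    ∃ a, f a = y := by
  classical
  set q' := q.map WittVector.constantCoeff with hq'
  have hq'm : q'.Monic := hq.map _
  have hlift : ∀ a : AlgebraicClosure (ZMod p), q'.IsRoot a →
      ∃ b : UnramifiedRing p, q.IsRoot b ∧ WittVector.constantCoeff b = a := by
    intro a ha
    set a₀ : UnramifiedRing p := WittVector.teichmuller p a with ha₀
    have h0 : WittVector.constantCoeff a₀ = a := WittVector.teichmuller_coeff_zero p a
    have hmem : ∀ x : UnramifiedRing p,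
        x ∈ Ideal.span {(p : UnramifiedRing p)} ↔ WittVector.constantCoeff x = 0 := fun x =>
      WittVector.mem_span_p_iff_coeff_zero_eq_zero x
    obtain ⟨b, hb, hba⟩ := HenselianRing.is_henselian
      (I := Ideal.span {(p : UnramifiedRing p)}) q hq a₀
      (by rw [hmem, ← eval₂_hom, ← eval_map, h0]; exact ha)
      (by
        refine IsUnit.map _ (WittVector.isUnit_of_coeff_zero_ne_zero _ ?_)
        change WittVector.constantCoeff (q.derivative.eval a₀) ≠ 0
        rw [← eval₂_hom, ← eval_map, h0, ← derivative_map]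
        exact hsep.eval₂_derivative_ne_zero (RingHom.id _) ha)
    refine ⟨b, hb, ?_⟩
    rw [hmem, map_sub, h0, sub_eq_zero] at hba
    exact hba
  choose! b hb hba using hlift
  have hinj : Set.InjOn (fun a => f (b a)) (q'.roots.toFinset : Set _) := by
    intro x hx y hy hxy
    have hx' : q'.IsRoot x := by simpa [hq'm.ne_zero] using hx
    have hy' : q'.IsRoot y := by simpa [hq'm.ne_zero] using hy
    rw [← hba x hx', ← hba y hy', hf hxy]
  have hsub : q'.roots.toFinset.image (fun a => f (b a)) ⊆ (q.map f).roots.toFinset := by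
    intro z hz
    obtain ⟨x, hx, rfl⟩ := Finset.mem_image.mp hz
    have hx' : q'.IsRoot x := by simpa [hq'm.ne_zero] using hx
    simp only [Multiset.mem_toFinset, mem_roots (hq.map f).ne_zero]
    exact (hb x hx').map
  -- By separability the reduction has deg q distinct roots. Their Hensel lifts are deg q distinct
  -- roots in Ω, hence all of them.
  have hcard : (q.map f).roots.toFinset.card ≤
      (q'.roots.toFinset.image (fun a => f (b a))).card := by
    rw [Finset.card_image_of_injOn hinj, Multiset.toFinset_card_of_nodup (nodup_roots hsep),
      ← (IsAlgClosed.splits q').natDegree_eq_card_roots, hq.natDegree_map]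
    refine (Multiset.toFinset_card_le _).trans ((card_roots' _).trans ?_)
    rw [hq.natDegree_map]
  have hmem : y ∈ (q.map f).roots.toFinset := by
    simpa [(hq.map f).ne_zero] using hy
  rw [← Finset.eq_of_subset_of_card_le hsub hcard] at hmem
  obtain ⟨x, -, hx⟩ := Finset.mem_image.mp hmem
  exact ⟨b x, hx⟩

/-- After X ↦ X + 1 the polynomial is Eisenstein at p, because p is still a prime element of the
unramified ring. Gauss's lemma passes to the fraction field. -/
theorem UnramifiedRing.irreducible_cyclotomic (v : ℕ) :
    Irreducible (cyclotomic (p ^ v) (FractionRing (UnramifiedRing p))) := by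
  cases v with
  | zero => rw [pow_zero, cyclotomic_one]; exact irreducible_X_sub_C 1
  | succ v =>
    have hE := cyclotomic_prime_pow_comp_X_add_one_isEisensteinAt p v
    set 𝔓 : Ideal (UnramifiedRing p) := Ideal.span {(p : UnramifiedRing p)}
    have hirr : Irreducible (p : UnramifiedRing p) := WittVector.irreducible p
    have hprime : 𝔓.IsPrime := (Ideal.span_singleton_prime hirr.ne_zero).mpr hirr.prime
    set g : ℤ[X] := (cyclotomic (p ^ (v + 1)) ℤ).comp (X + 1) with hg
    have hgm : g.Monic := by
      have : (X + 1 : ℤ[X]) = X + C 1 := by simp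
      rw [hg, this]
      exact (cyclotomic.monic _ ℤ).comp (monic_X_add_C 1) (by rw [natDegree_X_add_C]; norm_num)
    set G := g.map (Int.castRingHom (UnramifiedRing p)) with hG
    have hGm : G.Monic := hgm.map _
    have hGE : G.IsEisensteinAt 𝔓 := by
      refine hGm.isEisensteinAt_of_mem_of_notMem hprime.ne_top ?_ ?_
      · intro n hn
        rw [hG, hgm.natDegree_map] at hn
        have h1 := hE.mem hn
        rw [Ideal.submodule_span_eq, Ideal.mem_span_singleton] at h1
        obtain ⟨c, hc⟩ := h1
        rw [hG, coeff_map, hc, map_mul, map_natCast]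
        exact Ideal.mul_mem_right _ _ (Ideal.mem_span_singleton_self _)
      · have h0 : G.coeff 0 = p := by
          rw [hG, coeff_map, coeff_zero_eq_eval_zero, hg, eval_comp, eval_add, eval_X, eval_one,
            zero_add, eval_one_cyclotomic_prime_pow, map_natCast]
        rw [h0, Ideal.span_singleton_pow, Ideal.mem_span_singleton]
        rintro ⟨c, hc⟩
        rw [pow_two, mul_assoc] at hc
        exact hirr.not_isUnit (IsUnit.of_mul_eq_one c
          (mul_left_cancel₀ hirr.ne_zero (by rw [mul_one]; exact hc.symm)))
    have hGc : G = (cyclotomic (p ^ (v + 1)) (UnramifiedRing p)).comp (X + C 1) := by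
      simp [hG, hg, Polynomial.map_comp]
    have hGirr : Irreducible G := by
      refine hGE.irreducible hprime hGm.isPrimitive ?_
      rw [hGc, natDegree_comp, natDegree_X_add_C, mul_one, natDegree_cyclotomic]
      exact Nat.totient_pos.mpr (pow_pos (Fact.out : p.Prime).pos _)
    have hC : Irreducible (cyclotomic (p ^ (v + 1)) (UnramifiedRing p)) := by
      have h2 : algEquivAevalXAddC (1 : UnramifiedRing p)
          (cyclotomic (p ^ (v + 1)) (UnramifiedRing p)) = G := by
        rw [hGc]; rfl
      rwa [← h2, MulEquiv.irreducible_iff] at hGirr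
    rw [(cyclotomic.monic _ _).irreducible_iff_irreducible_map_fraction_map
      (K := FractionRing (UnramifiedRing p)), map_cyclotomic] at hC
    exact hC

/-- `U` is a subfield of `L` which behaves like the preimage of the maximal unramified extension
of `ℚ_p` under an embedding of `L` into an algebraic closure of `ℚ_p`. -/
structure IsUnramifiedSubfield {L : Type v} [Field L] (U : Subfield L) : Prop where
  integral_mem : ∀ ρ : L, IsIntegral ℤ ρ → ∀ (f g : ℤ[X]) (n : ℤ), ¬ (p : ℤ) ∣ n →
    f * minpoly ℤ ρ + g * derivative (minpoly ℤ ρ) = C n → ρ ∈ U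
  radical_mem : ∀ (w x : L) (t n : ℕ), w ∈ U → ¬ p ∣ n → ¬ p ∣ t → IsIntegral ℤ (n * w) →
    IsIntegral ℤ (n * w⁻¹) → w ≠ 0 → x ^ t = w → x ∈ U
  irreducible_cyclotomic : ∀ (k : Type v) [Field k] (f : k →+* L), (∀ x, f x ∈ U) → ∀ v : ℕ,
    Irreducible (cyclotomic (p ^ v) k)

/-- Embed L into an algebraic closure of the fraction field of the unramified ring and take for U
the preimage of that fraction field. Membership in U comes from Hensel's lemma, irreducibility from
Eisenstein's criterion. -/
theorem exists_isUnramifiedSubfield (L : Type v) [Field L] [CharZero L]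
    [Algebra.IsAlgebraic ℚ L] : ∃ U : Subfield L, IsUnramifiedSubfield p U := by
  let Ω := AlgebraicClosure (FractionRing (UnramifiedRing p))
  have : CharZero (FractionRing (UnramifiedRing p)) :=
    charZero_of_injective_algebraMap
      (IsFractionRing.injective (UnramifiedRing p) (FractionRing (UnramifiedRing p)))
  have : CharZero Ω := charZero_of_injective_algebraMap
    (algebraMap (FractionRing (UnramifiedRing p)) Ω).injective
  let ι : L →ₐ[ℚ] Ω := IsAlgClosed.lift
  let j : UnramifiedRing p →+* Ω := (algebraMap (FractionRing (UnramifiedRing p)) Ω).comp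
    (algebraMap (UnramifiedRing p) (FractionRing (UnramifiedRing p)))
  have hj : Function.Injective j := (algebraMap (FractionRing (UnramifiedRing p)) Ω).injective.comp
    (IsFractionRing.injective (UnramifiedRing p) (FractionRing (UnramifiedRing p)))
  have hjU : ∀ x : L, (∃ a, j a = ι x) →
      x ∈ (algebraMap (FractionRing (UnramifiedRing p)) Ω).fieldRange.comap (ι : L →+* Ω) := by
    rintro x ⟨a, ha⟩
    exact ⟨_, ha⟩
  -- The unramified ring is integrally closed, so algebraic integers in U come from the ring itself.
  have hint : ∀ x ∈ (algebraMap (FractionRing (UnramifiedRing p)) Ω).fieldRange.comap (ι : L →+* Ω),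
      IsIntegral ℤ x → ∃ a, j a = ι x := by
    rintro x ⟨e, he⟩ hx
    have h1 : IsIntegral ℤ e := by
      obtain ⟨q, hq, hq0⟩ := hx
      refine ⟨q, hq, (algebraMap (FractionRing (UnramifiedRing p)) Ω).injective ?_⟩
      have h2 := congrArg (ι : L →+* Ω) hq0
      rw [hom_eval₂, map_zero] at h2
      rw [hom_eval₂, map_zero, he, ← h2]
      congr 1
      exact RingHom.ext_int _ _
    obtain ⟨a, ha⟩ := IsIntegrallyClosed.isIntegral_iff.mp (h1.tower_top (A := UnramifiedRing p))
    exact ⟨a, by rw [← ha] at he; exact he⟩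
  refine ⟨(algebraMap (FractionRing (UnramifiedRing p)) Ω).fieldRange.comap (ι : L →+* Ω),
    ?_, ?_, ?_⟩
  · intro ρ hρ f g n hn hfg
    apply hjU
    refine UnramifiedRing.exists_of_root p
      (q := (minpoly ℤ ρ).map (Int.castRingHom (UnramifiedRing p)))
      ((minpoly.monic hρ).map _) ?_ j hj ?_
    -- Modulo p the given combination of the minimal polynomial and its derivative is a nonzero
    -- constant, so the reduction is separable.
    · have hunit : IsUnit ((n : ℤ) : AlgebraicClosure (ZMod p)) := by
        have := (UnramifiedRing.isUnit_intCast p hn).map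
          (WittVector.constantCoeff (p := p) (R := AlgebraicClosure (ZMod p)))
        rwa [map_intCast] at this
      rw [Polynomial.map_map, separable_def]
      generalize WittVector.constantCoeff.comp (Int.castRingHom (UnramifiedRing p)) = π
      have h2 := congrArg (Polynomial.map π) hfg
      rw [Polynomial.map_add, Polynomial.map_mul, Polynomial.map_mul, map_C, ← derivative_map] at h2
      obtain ⟨m, hm⟩ := hunit.exists_left_inv
      refine ⟨C m * f.map π, C m * g.map π, ?_⟩
      rw [mul_assoc, mul_assoc, ← mul_add, h2, ← C_mul]
      simp [hm]
    · rw [Polynomial.map_map, IsRoot, eval_map]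
      have h3 : j.comp (Int.castRingHom (UnramifiedRing p)) = Int.castRingHom Ω :=
        RingHom.ext_int _ _
      rw [h3]
      have h4 := congrArg (ι : L →+* Ω) (minpoly.aeval ℤ ρ)
      rw [map_zero, aeval_def, hom_eval₂] at h4
      rw [← h4]
      congr 1
      exact RingHom.ext_int _ _
  · intro w x t n hw hn ht hnw hnw' hw0 hx
    -- As n is a unit in the ring, integrality of n * y puts y into the ring. Applied to w and w⁻¹
    -- this makes w a unit, so X ^ t - w has separable reduction.
    have hnU : ∀ y ∈ (algebraMap (FractionRing (UnramifiedRing p)) Ω).fieldRange.comap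
        (ι : L →+* Ω), IsIntegral ℤ ((n : L) * y) → ∃ a, j a = ι y := by
      intro y hy hny
      obtain ⟨a, ha⟩ := hint _ (mul_mem (natCast_mem _ n) hy) hny
      obtain ⟨m, hm⟩ := (UnramifiedRing.isUnit_natCast p hn).exists_left_inv
      refine ⟨m * a, ?_⟩
      have h5 := congrArg j hm
      rw [map_mul, map_natCast, map_one] at h5
      rw [map_mul, ha, map_mul, map_natCast, ← mul_assoc, h5, one_mul]
    obtain ⟨a, ha⟩ := hnU w hw hnw
    obtain ⟨b, hb⟩ := hnU w⁻¹ (inv_mem hw) hnw'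
    have hab : a * b = 1 := hj (by
      rw [map_mul, ha, hb, ← map_mul, mul_inv_cancel₀ hw0, map_one, map_one])
    apply hjU
    have ht0 : t ≠ 0 := by rintro rfl; simp at ht
    refine UnramifiedRing.exists_of_root p (q := X ^ t - C a) (monic_X_pow_sub_C a ht0) ?_ j hj ?_
    · rw [Polynomial.map_sub, Polynomial.map_pow, map_X, map_C]
      refine separable_X_pow_sub_C _ ?_ ?_
      · rwa [Ne, CharP.cast_eq_zero_iff (AlgebraicClosure (ZMod p)) p]
      · intro h0
        have := congrArg (WittVector.constantCoeff (p := p)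
          (R := AlgebraicClosure (ZMod p))) hab
        rw [map_mul, h0, zero_mul, map_one] at this
        exact zero_ne_one this
    · simp [IsRoot, ha, ← hx]
  · intro k _ f hf v
    let g : k →+* FractionRing (UnramifiedRing p) :=
      ((algebraMap (FractionRing (UnramifiedRing p)) Ω).rangeRestrictFieldEquiv.symm :
        _ →+* FractionRing (UnramifiedRing p)).comp
        (((ι : L →+* Ω).comp f).codRestrict
          (algebraMap (FractionRing (UnramifiedRing p)) Ω).fieldRange hf)
    -- Through U the field k embeds into the fraction field, and irreducibility of a monic
    -- polynomial descends along the embedding.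
    refine (cyclotomic.monic _ _).irreducible_of_irreducible_map g _ ?_
    rw [map_cyclotomic]
    exact UnramifiedRing.irreducible_cyclotomic p v

end Unramified

/-! ### Algebraic integers with bounded conjugates -/

section Bounded

theorem norm_aeval_le {P : ℤ[X]} {D A C : ℕ} (hD : P.natDegree ≤ D) (hA : ∀ i, |P.coeff i| ≤ A)
    (hC : 1 ≤ C) {z : ℂ} (hz : ‖z‖ ≤ C) : ‖aeval z P‖ ≤ ((D + 1) * A * C ^ D : ℕ) := by
  rw [aeval_eq_sum_range' (Nat.lt_succ_of_le hD)]
  have hC' : (1 : ℝ) ≤ C := by exact_mod_cast hC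
  calc ‖∑ i ∈ Finset.range (D + 1), P.coeff i • z ^ i‖
      ≤ ∑ i ∈ Finset.range (D + 1), (A : ℝ) * C ^ D := by
        refine norm_sum_le_of_le _ fun i hi => ?_
        rw [zsmul_eq_mul, norm_mul, norm_pow, Complex.norm_intCast]
        have h1 : |(P.coeff i : ℝ)| ≤ A := by exact_mod_cast hA i
        have h2 : ‖z‖ ^ i ≤ (C : ℝ) ^ D :=
          (pow_le_pow_left₀ (norm_nonneg _) hz i).trans
            (pow_le_pow_right₀ hC' (Nat.lt_succ_iff.mp (Finset.mem_range.mp hi)))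
        exact mul_le_mul h1 h2 (by positivity) (by positivity)
    _ = ((D + 1) * A * C ^ D : ℕ) := by
        rw [Finset.sum_const, Finset.card_range, nsmul_eq_mul]
        push_cast
        ring

theorem map_aeval_int {R S : Type*} [CommRing R] [CommRing S] (φ : R →+* S) (y : R) (q : ℤ[X]) :
    φ (aeval y q) = aeval (φ y) q := by
  rw [aeval_def, aeval_def, hom_eval₂]
  congr 1
  exact RingHom.ext_int _ _

theorem IsIntegral.aeval_int {R : Type*} [CommRing R] {y : R} (hy : IsIntegral ℤ y) (q : ℤ[X]) :
    IsIntegral ℤ (aeval y q) :=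
  adjoin_le_integralClosure hy (aeval_mem_adjoin_singleton ℤ y)

theorem natDegree_minpoly_int {X : Type*} [Field X] [CharZero X] {y : X} (hy : IsIntegral ℤ y) :
    (minpoly ℤ y).natDegree = (minpoly ℚ y).natDegree := by
  rw [minpoly.isIntegrallyClosed_eq_field_fractions' ℚ hy, (minpoly.monic hy).natDegree_map]

variable {X : Type*} [Field X] [CharZero X] [Algebra.IsAlgebraic ℚ X]

theorem exists_ringHom_of_root {y : X} (hy : IsIntegral ℤ y) {z : ℂ}
    (hz : z ∈ ((minpoly ℤ y).map (Int.castRingHom ℂ)).roots) : ∃ φ : X →+* ℂ, φ y = z := by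
  have h1 : aeval z (minpoly ℤ y) = 0 := by
    rw [mem_roots ((minpoly.monic hy).map _).ne_zero, IsRoot, eval_map] at hz
    exact hz
  have h2 : z ∈ (minpoly ℚ y).rootSet ℂ := by
    rw [mem_rootSet, minpoly.isIntegrallyClosed_eq_field_fractions' ℚ hy, aeval_map_algebraMap]
    exact ⟨((minpoly.monic hy).map _).ne_zero, h1⟩
  rw [← Algebra.IsAlgebraic.range_eval_eq_rootSet_minpoly] at h2
  obtain ⟨φ, hφ⟩ := h2
  exact ⟨φ, hφ⟩

theorem abs_coeff_minpoly_le {y : X} (hy : IsIntegral ℤ y) {C D : ℕ} (hC : 1 ≤ C)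
    (hD : (minpoly ℚ y).natDegree ≤ D) (hyC : ∀ φ : X →+* ℂ, ‖φ y‖ ≤ C) (i : ℕ) :
    |(minpoly ℤ y).coeff i| ≤ ((2 * C) ^ D : ℕ) := by
  have h1 := coeff_bdd_of_roots_le (B := C) (Int.castRingHom ℂ) (minpoly.monic hy)
    (IsAlgClosed.splits _) ((natDegree_minpoly_int hy).le.trans hD) (fun z hz => by
      obtain ⟨φ, rfl⟩ := exists_ringHom_of_root hy hz
      exact hyC φ) i
  have hC' : (1 : ℝ) ≤ C := by exact_mod_cast hC
  rw [max_eq_left hC', coeff_map, eq_intCast, Complex.norm_intCast] at h1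
  have h2 : (D.choose (D / 2) : ℝ) ≤ 2 ^ D := by exact_mod_cast Nat.choose_le_two_pow _ _
  have h3 : |((minpoly ℤ y).coeff i : ℝ)| ≤ ((2 * C) ^ D : ℕ) := by
    refine h1.trans ?_
    push_cast
    rw [mul_pow, mul_comm]
    gcongr
  exact_mod_cast h3

/-- A nonzero algebraic integer divides a nonzero integer of bounded size, with a bounded
cofactor. -/
theorem exists_int_multiple {y : X} (hy : IsIntegral ℤ y) (hy0 : y ≠ 0) {C D : ℕ} (hC : 1 ≤ C)
    (hD : (minpoly ℚ y).natDegree ≤ D) (hyC : ∀ φ : X →+* ℂ, ‖φ y‖ ≤ C) :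
    ∃ (n : ℤ) (q : ℤ[X]), n ≠ 0 ∧ |n| ≤ ((2 * C) ^ D : ℕ) ∧ y * aeval y q = n ∧
      ∀ φ : X →+* ℂ, ‖φ (aeval y q)‖ ≤ ((D + 1) * (2 * C) ^ D * C ^ D : ℕ) := by
  have hcoeff := abs_coeff_minpoly_le hy hC hD hyC
  -- The cofactor is read off from m(y) = 0 by moving the constant term of m to the other side.
  refine ⟨-(minpoly ℤ y).coeff 0, (minpoly ℤ y).divX, ?_, ?_, ?_, fun φ => ?_⟩
  · have h := minpoly.coeff_zero_ne_zero (hy.tower_top (A := ℚ)) hy0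
    rw [minpoly.isIntegrallyClosed_eq_field_fractions' ℚ hy, coeff_map] at h
    exact neg_ne_zero.mpr fun h0 => h (by rw [h0, map_zero])
  · rw [abs_neg]; exact hcoeff 0
  · have h := congrArg (aeval y) (X_mul_divX_add (minpoly ℤ y))
    rw [minpoly.aeval, map_add, map_mul, aeval_X, aeval_C] at h
    rw [Int.cast_neg, ← eq_intCast (algebraMap ℤ X)]
    exact eq_neg_of_add_eq_zero_left h
  · rw [map_aeval_int]
    refine norm_aeval_le ?_ (fun i => ?_) hC (hyC φ)
    · rw [natDegree_divX_eq_natDegree_tsub_one, natDegree_minpoly_int hy]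
      omega
    · rw [coeff_divX]; exact hcoeff _

/-- A bound for the discriminant-like integer in `exists_separable_combination`. -/
def separableBound (C D : ℕ) : ℕ := (2 * ((D + 1) * (D * (2 * C) ^ D) * C ^ D + 1)) ^ D

/-- The minimal polynomial of an algebraic integer stays separable modulo all primes that do not
divide an integer of bounded size. -/
theorem exists_separable_combination {ρ : X} (hρ : IsIntegral ℤ ρ) {C D : ℕ} (hC : 1 ≤ C)
    (hD : (minpoly ℚ ρ).natDegree ≤ D) (hρC : ∀ φ : X →+* ℂ, ‖φ ρ‖ ≤ C) :
    ∃ (f g : ℤ[X]) (n : ℤ), n ≠ 0 ∧ |n| ≤ separableBound C D ∧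
      f * minpoly ℤ ρ + g * derivative (minpoly ℤ ρ) = Polynomial.C n := by
  have hcoeff := abs_coeff_minpoly_le hρ hC hD hρC
  set m := minpoly ℤ ρ with hm
  have hmD : m.natDegree ≤ D := (natDegree_minpoly_int hρ).le.trans hD
  -- The element y = m'(ρ) plays the part of the discriminant: it has a bounded integer multiple n =
  -- y * q(y), and then m divides m' * q(m') - n because this polynomial vanishes at ρ.
  set y := aeval ρ (derivative m) with hy
  have hyint : IsIntegral ℤ y := hρ.aeval_int _
  have hy0 : y ≠ 0 := by
    have hirr := minpoly.irreducible (hρ.tower_top (A := ℚ))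
    have h1 := hirr.separable.aeval_derivative_ne_zero (minpoly.aeval ℚ ρ)
    rw [minpoly.isIntegrallyClosed_eq_field_fractions' ℚ hρ, derivative_map,
      aeval_map_algebraMap] at h1
    exact h1
  have hyD : (minpoly ℚ y).natDegree ≤ D := by
    have hρQ := hρ.tower_top (A := ℚ)
    have hyQ := hyint.tower_top (A := ℚ)
    refine le_trans ?_ hD
    rw [← IntermediateField.adjoin.finrank hρQ, ← IntermediateField.adjoin.finrank hyQ]
    have := IntermediateField.adjoin.finiteDimensional hρQ
    refine Submodule.finrank_mono (R := ℚ) (M := X)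
      (s := Subalgebra.toSubmodule (IntermediateField.adjoin ℚ {y}).toSubalgebra)
      (t := Subalgebra.toSubmodule (IntermediateField.adjoin ℚ {ρ}).toSubalgebra) ?_
    have hle : IntermediateField.adjoin ℚ {y} ≤ IntermediateField.adjoin ℚ {ρ} := by
      rw [IntermediateField.adjoin_simple_le_iff, hy, ← aeval_map_algebraMap ℚ]
      exact IntermediateField.algebra_adjoin_le_adjoin ℚ {ρ} (aeval_mem_adjoin_singleton ℚ ρ)
    exact hle
  have hyC : ∀ φ : X →+* ℂ, ‖φ y‖ ≤ (((D + 1) * (D * (2 * C) ^ D) * C ^ D + 1 : ℕ) : ℝ) := by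
    intro φ
    rw [hy, map_aeval_int]
    refine (norm_aeval_le (D := D) (A := D * (2 * C) ^ D) ((natDegree_derivative_le _).trans
      (by omega)) (fun i => ?_) hC (hρC φ)).trans (by exact_mod_cast Nat.le_succ _)
    rcases lt_or_ge i D with hi | hi
    · rw [coeff_derivative, abs_mul, mul_comm]
      push_cast
      refine mul_le_mul ?_ (by exact_mod_cast hcoeff (i + 1)) (abs_nonneg _) (by positivity)
      rw [abs_of_nonneg (by positivity)]
      exact_mod_cast hi
    · rw [coeff_eq_zero_of_natDegree_lt, abs_zero]
      · positivity
      · rcases Nat.eq_zero_or_pos m.natDegree with h0 | h0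
        · exact absurd (hm ▸ h0) (minpoly.natDegree_pos hρ).ne'
        · exact (natDegree_derivative_lt h0.ne').trans_le (hmD.trans hi)
  obtain ⟨n, q, hn0, hn, hq, -⟩ := exists_int_multiple hyint hy0 (by omega) hyD hyC
  have hdvd : m ∣ derivative m * (q.comp (derivative m)) - Polynomial.C n := by
    rw [hm]
    refine minpoly.isIntegrallyClosed_dvd hρ ?_
    rw [map_sub, map_mul, aeval_comp, ← hm, ← hy, hq, aeval_C, eq_intCast, sub_self]
  obtain ⟨f, hf⟩ := hdvd
  refine ⟨-f, q.comp (derivative m), n, hn0, hn, ?_⟩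
  linear_combination hf

end Bounded

/-! ### The saturation of a finitely generated group of units in a number field -/

section Saturation

variable {K : Type*} [Field K]

theorem exists_prod_zpow_of_mem_closure_range {ι G : Type*} [Fintype ι] [CommGroup G] {w : ι → G}
    {g : G} (hg : g ∈ Subgroup.closure (Set.range w)) : ∃ e : ι → ℤ, g = ∏ i, w i ^ e i := by
  classical
  induction hg using Subgroup.closure_induction with
  | mem x hx =>
    obtain ⟨i, rfl⟩ := hx
    refine ⟨Pi.single i 1, ?_⟩
    rw [Finset.prod_eq_single i] <;> simp +contextual
  | one => exact ⟨0, by simp⟩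
  | mul x y _ _ hx hy =>
    obtain ⟨g, rfl⟩ := hx
    obtain ⟨h, rfl⟩ := hy
    exact ⟨g + h, by simp [zpow_add, Finset.prod_mul_distrib]⟩
  | inv x _ hx =>
    obtain ⟨g, rfl⟩ := hx
    exact ⟨-g, by simp⟩

/-- Modulo `W`, each element of the saturation of `W` has a representative which is bounded in
terms of generators of `W`. -/
theorem exists_bounded_representative {ι : Type*} [Fintype ι] (w : ι → Kˣ) {Δ B : ℕ}
    (hΔ : 1 ≤ Δ) (hB : 1 ≤ B) (hwint : ∀ i, IsIntegral ℤ ((Δ : K) * (w i : K)))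
    (hwB : ∀ i, ∀ φ : K →+* ℂ, ‖φ (w i : K)‖ ≤ B) {h : Kˣ} {n : ℕ} (hn : 0 < n)
    (hh : h ^ n ∈ Subgroup.closure (Set.range w)) :
    ∃ y : K, IsIntegral ℤ y ∧ (∀ φ : K →+* ℂ, ‖φ y‖ ≤ ((Δ * B) ^ Fintype.card ι : ℕ)) ∧
      ∃ g ∈ Subgroup.closure (Set.range w), (Δ : K) ^ Fintype.card ι * (h : K) = y * (g : K) := by
  obtain ⟨e, he⟩ := exists_prod_zpow_of_mem_closure_range hh
  have hn' : (n : ℤ) ≠ 0 := by exact_mod_cast hn.ne'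
  -- Division of the exponents by n with remainder moves the quotients into the group; what is left
  -- is an n-th root of a product with exponents f i < n.
  set g : Kˣ := ∏ i, w i ^ (e i / n) with hg
  set f : ι → ℕ := fun i => (e i % n).toNat with hf
  have hfe : ∀ i, (f i : ℤ) = e i % n := fun i => Int.toNat_of_nonneg (Int.emod_nonneg _ hn')
  have hfn : ∀ i, f i ≤ n := fun i => by
    have h1 := Int.emod_lt_of_pos (e i) (by exact_mod_cast hn : (0 : ℤ) < n)
    have h2 := hfe i
    omega
  have hpow : (h * g⁻¹) ^ n = ∏ i, w i ^ f i := by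
    rw [mul_pow, inv_pow, he, hg, ← Finset.prod_pow, ← div_eq_mul_inv, ← Finset.prod_div_distrib]
    refine Finset.prod_congr rfl fun i _ => ?_
    rw [← zpow_natCast, ← zpow_natCast, ← zpow_mul, div_eq_mul_inv, ← zpow_sub, hfe, Int.emod_def,
      mul_comm (n : ℤ)]
  -- As f i ≤ n, one factor Δ per generator suffices: after taking n-th powers, n factors Δ are
  -- available for w i ^ f i.
  have hpowK : ((Δ : K) ^ Fintype.card ι * ((h * g⁻¹ : Kˣ) : K)) ^ n =
      ∏ i, ((Δ : K) ^ (n - f i) * ((Δ : K) * (w i : K)) ^ f i) := by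
    rw [mul_pow, ← Units.val_pow_eq_pow_val, hpow, Units.coe_prod, ← pow_mul, mul_comm _ n, pow_mul,
      ← Finset.card_univ, ← Finset.prod_const, ← Finset.prod_mul_distrib]
    refine Finset.prod_congr rfl fun i _ => ?_
    rw [mul_pow, ← mul_assoc, ← pow_add, Nat.sub_add_cancel (hfn i), Units.val_pow_eq_pow_val]
  refine ⟨(Δ : K) ^ Fintype.card ι * ((h * g⁻¹ : Kˣ) : K), ?_, fun φ => ?_, g, ?_, ?_⟩
  · refine IsIntegral.of_pow hn ?_
    rw [hpowK]
    have hΔint : IsIntegral ℤ (Δ : K) := by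
      simpa using isIntegral_algebraMap (R := ℤ) (A := K) (x := (Δ : ℤ))
    exact IsIntegral.prod _ fun i _ => (hΔint.pow _).mul ((hwint i).pow _)
  · have hΔ' : (1 : ℝ) ≤ Δ := by exact_mod_cast hΔ
    have hB' : (1 : ℝ) ≤ B := by exact_mod_cast hB
    rw [← pow_le_pow_iff_left₀ (norm_nonneg _) (by positivity) hn.ne', ← norm_pow, ← map_pow, hpowK,
      map_prod, norm_prod]
    calc ∏ i, ‖φ ((Δ : K) ^ (n - f i) * ((Δ : K) * (w i : K)) ^ f i)‖
        ≤ ∏ i : ι, ((Δ * B : ℝ) ^ n) := by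
          refine Finset.prod_le_prod (fun i _ => norm_nonneg _) fun i _ => ?_
          rw [mul_pow, ← mul_assoc, ← pow_add, Nat.sub_add_cancel (hfn i), map_mul, map_pow,
            map_pow, map_natCast, norm_mul, norm_pow, norm_pow, Complex.norm_natCast, mul_pow]
          gcongr
          exact (pow_le_pow_left₀ (norm_nonneg _) (hwB i φ) _).trans
            (pow_le_pow_right₀ hB' (hfn i))
      _ = (((Δ * B) ^ Fintype.card ι : ℕ) : ℝ) ^ n := by
          rw [Finset.prod_const, Finset.card_univ]
          push_cast
          rw [← pow_mul, ← pow_mul, mul_comm n]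
  · exact Subgroup.prod_mem _ fun i _ => Subgroup.zpow_mem _ (Subgroup.subset_closure (Set.mem_range_self i)) _
  · rw [Units.val_mul, mul_assoc, mul_assoc, ← Units.val_mul, inv_mul_cancel, Units.val_one, mul_one]

variable [NumberField K]

/-- The powers of θ form a basis and the trace form is nondegenerate. -/
theorem eq_zero_of_trace_mul_pow_eq_zero {θ : K} (hθ : IntermediateField.adjoin ℚ {θ} = ⊤) {y : K}
    (hy : ∀ i < Module.finrank ℚ K, Algebra.trace ℚ K (y * θ ^ i) = 0) : y = 0 := by
  have hint : IsIntegral ℚ θ := Algebra.IsIntegral.isIntegral θ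
  let pb : PowerBasis ℚ K := (IntermediateField.adjoin.powerBasis hint).map
    ((IntermediateField.equivOfEq hθ).trans IntermediateField.topEquiv)
  have hgen : pb.gen = θ := rfl
  have hdim : pb.dim = Module.finrank ℚ K := pb.finrank.symm
  have hzero : Algebra.traceForm ℚ K y = 0 := by
    refine pb.basis.ext fun i => ?_
    rw [pb.coe_basis, hgen, LinearMap.zero_apply, Algebra.traceForm_apply]
    exact hy _ (hdim ▸ i.2)
  exact (traceForm_nondegenerate ℚ K).1 y fun z => by
    have := DFunLike.congr_fun hzero z
    simpa using this

/-- Among sufficiently many algebraic integers in `K` with bounded conjugates, two coincide. -/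
theorem exists_ne_map_eq_of_bounded {θ : K} (hθ : IntermediateField.adjoin ℚ {θ} = ⊤)
    (hθint : IsIntegral ℤ θ) {R B D M : ℕ} (hR : 1 ≤ R) (hθR : ∀ φ : K →+* ℂ, ‖φ θ‖ ≤ R)
    (hD : Module.finrank ℚ K ≤ D) (hM : (2 * (D * (B * R ^ D)) + 1) ^ D ≤ M) (y : Fin (M + 1) → K)
    (hyint : ∀ i, IsIntegral ℤ (y i)) (hyB : ∀ i, ∀ φ : K →+* ℂ, ‖φ (y i)‖ ≤ B) :
    ∃ i j, i ≠ j ∧ y i = y j := by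
  set T := D * (B * R ^ D) with hT
  have hR' : (1 : ℝ) ≤ R := by exact_mod_cast hR
  -- The traces of y i * θ ^ k are rational integers in [-T, T] and determine y i, so at most (2 * T
  -- + 1) ^ D values of y i are possible.
  have htr : ∀ i (k : Fin (Module.finrank ℚ K)), ∃ t : ℤ,
      (t : ℚ) = Algebra.trace ℚ K (y i * θ ^ (k : ℕ)) ∧ t ∈ Finset.Icc (-(T : ℤ)) T := by
    intro i k
    have h1 : IsIntegral ℤ (Algebra.trace ℚ K (y i * θ ^ (k : ℕ))) :=
      Algebra.isIntegral_trace ((hyint i).mul (hθint.pow _))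
    obtain ⟨t, ht⟩ := IsIntegrallyClosed.isIntegral_iff.mp h1
    refine ⟨t, ht, ?_⟩
    have h2 := trace_eq_sum_embeddings (K := ℚ) ℂ (x := y i * θ ^ (k : ℕ))
    rw [← ht] at h2
    have h3 : ‖(t : ℂ)‖ ≤ T := by
      have h4 : (t : ℂ) = ∑ σ : K →ₐ[ℚ] ℂ, σ (y i * θ ^ (k : ℕ)) := by
        rw [← h2]; simp
      rw [h4]
      calc ‖∑ σ : K →ₐ[ℚ] ℂ, σ (y i * θ ^ (k : ℕ))‖
          ≤ ∑ σ : K →ₐ[ℚ] ℂ, (B * R ^ D : ℝ) := by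
            refine norm_sum_le_of_le _ fun σ _ => ?_
            rw [map_mul, map_pow, norm_mul, norm_pow]
            refine mul_le_mul (hyB i σ) ?_ (by positivity) (by positivity)
            exact (pow_le_pow_left₀ (norm_nonneg _) (hθR σ) _).trans
              (pow_le_pow_right₀ hR' (k.2.le.trans hD))
        _ ≤ T := by
            rw [Finset.sum_const, Finset.card_univ, AlgHom.card, nsmul_eq_mul, hT]
            push_cast
            gcongr
    rw [Complex.norm_intCast] at h3
    have h5 : |t| ≤ (T : ℤ) := by exact_mod_cast h3
    rw [Finset.mem_Icc]
    exact abs_le.mp h5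
  choose t ht htT using htr
  have hcard : Fintype.card (Fin (Module.finrank ℚ K) → Finset.Icc (-(T : ℤ)) T) <
      Fintype.card (Fin (M + 1)) := by
    rw [Fintype.card_fun, Fintype.card_fin, Fintype.card_fin, Fintype.card_coe, Int.card_Icc]
    have : ((T : ℤ) + 1 - -(T : ℤ)).toNat = 2 * T + 1 := by omega
    rw [this]
    exact Nat.lt_succ_of_le ((Nat.pow_le_pow_right (by omega) hD).trans hM)
  obtain ⟨i, j, hij, h⟩ := Fintype.exists_ne_map_eq_of_card_lt
    (fun i k => (⟨t i k, htT i k⟩ : Finset.Icc (-(T : ℤ)) T)) hcard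
  refine ⟨i, j, hij, sub_eq_zero.mp (eq_zero_of_trace_mul_pow_eq_zero hθ fun k hk => ?_)⟩
  have h1 := congrArg Subtype.val (congrFun h ⟨k, hk⟩)
  simp only at h1
  rw [sub_mul, map_sub, ← ht i ⟨k, hk⟩, ← ht j ⟨k, hk⟩, h1, sub_self]

/-- The exponent of the saturation of `W` modulo `W` is bounded. -/
theorem pow_factorial_mem_of_pow_mem {ι : Type*} [Fintype ι] (w : ι → Kˣ) {Δ B : ℕ}
    (hΔ : 1 ≤ Δ) (hB : 1 ≤ B) (hwint : ∀ i, IsIntegral ℤ ((Δ : K) * (w i : K)))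
    (hwB : ∀ i, ∀ φ : K →+* ℂ, ‖φ (w i : K)‖ ≤ B)
    {θ : K} (hθ : IntermediateField.adjoin ℚ {θ} = ⊤)
    (hθint : IsIntegral ℤ θ) {R D M : ℕ} (hR : 1 ≤ R) (hθR : ∀ φ : K →+* ℂ, ‖φ θ‖ ≤ R)
    (hD : Module.finrank ℚ K ≤ D)
    (hM : (2 * (D * ((Δ * B) ^ Fintype.card ι * R ^ D)) + 1) ^ D ≤ M) {h : Kˣ} {n : ℕ} (hn : 0 < n)
    (hh : h ^ n ∈ Subgroup.closure (Set.range w)) :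
    h ^ M.factorial ∈ Subgroup.closure (Set.range w) := by
  -- Apply the bounded representatives to h^0, …, h^M. If two of them coincide, the difference of
  -- the exponents is at most M, hence divides M!, and that power of h lies in the group.
  have hrep : ∀ i : Fin (M + 1), _ := fun i =>
    exists_bounded_representative w hΔ hB hwint hwB (h := h ^ (i : ℕ)) hn (by
      rw [← pow_mul, mul_comm, pow_mul]; exact Subgroup.pow_mem _ hh _)
  choose y hyint hyB g hg hgy using hrep
  obtain ⟨i, j, hij, hy⟩ := exists_ne_map_eq_of_bounded hθ hθint hR hθR hD hM y hyint hyB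
  have hΔ0 : (Δ : K) ^ Fintype.card ι ≠ 0 := pow_ne_zero _ (by exact_mod_cast (by omega : Δ ≠ 0))
  have hij' : h ^ (i : ℕ) * (g i)⁻¹ = h ^ (j : ℕ) * (g j)⁻¹ := by
    have h1 := hgy i
    rw [hy] at h1
    have h2 := hgy j
    apply Units.ext
    apply mul_left_cancel₀ hΔ0
    rw [Units.val_mul, Units.val_mul, ← mul_assoc, ← mul_assoc, h1, h2, Units.mul_inv_cancel_right,
      Units.mul_inv_cancel_right]
  have key : ∀ a b : Fin (M + 1), (a : ℕ) < b → h ^ (a : ℕ) * (g a)⁻¹ = h ^ (b : ℕ) * (g b)⁻¹ →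
      h ^ M.factorial ∈ Subgroup.closure (Set.range w) := by
    intro a b hab hab'
    have h1 : h ^ ((b : ℕ) - a) = g b * (g a)⁻¹ := by
      have h2 : (b : ℕ) = (b - a) + a := by omega
      rw [h2, pow_add] at hab'
      have h3 : h ^ ((b : ℕ) - a) = h ^ ((b : ℕ) - a) * h ^ (a : ℕ) * (g b)⁻¹ * g b *
        (h ^ (a : ℕ))⁻¹ := by group
      rw [h3, ← hab', mul_comm (h ^ (a : ℕ))]
      rw [mul_assoc, mul_assoc, mul_comm (h ^ (a : ℕ)), mul_assoc, inv_mul_cancel, mul_one, mul_comm]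
    obtain ⟨q, hq⟩ := Nat.dvd_factorial (show 0 < (b : ℕ) - a by omega) (show (b : ℕ) - a ≤ M by omega)
    rw [hq, pow_mul, h1]
    exact Subgroup.pow_mem _ (Subgroup.mul_mem _ (hg b) (Subgroup.inv_mem _ (hg a))) _
  rcases lt_or_gt_of_ne (Fin.val_ne_of_ne hij) with h1 | h1
  · exact key i j h1 hij'
  · exact key j i h1 hij'.symm

end Saturation

/-! ### Bases modulo torsion -/

section Basis

/-- The quotient of W by its torsion is finitely generated and torsion-free, hence free; the `a i`
lift a basis. -/
theorem Subgroup.exists_basis_mod_torsion {G : Type*} [CommGroup G] (W : Subgroup G) (hW : W.FG)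
    {r : ℕ} (hr : Module.finrank ℤ (Additive W) = r) :
    ∃ a : Fin r → G, (∀ i, a i ∈ W) ∧
      (∀ w ∈ W, ∃ (e : Fin r → ℤ) (ζ : G), IsOfFinOrder ζ ∧ w = ζ * ∏ i, a i ^ e i) ∧
      ∀ e : Fin r → ℤ, IsOfFinOrder (∏ i, a i ^ e i) → e = 0 := by
  subst hr
  set M := Additive W
  set T := Submodule.torsion ℤ M
  have hfg : Module.Finite ℤ M := by
    rw [Module.Finite.iff_addGroup_fg, ← GroupFG.iff_add_fg, Group.fg_iff_subgroup_fg]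
    exact hW
  have : Module.Free ℤ (M ⧸ T) := Module.free_of_finite_type_torsion_free'
  have hrank : Module.finrank ℤ (M ⧸ T) = Module.finrank ℤ M :=
    finrank_quotient_eq_of_le_torsion le_rfl
  let b := Module.finBasisOfFinrankEq ℤ (M ⧸ T) hrank
  choose a ha using fun i => Submodule.mkQ_surjective T (b i)
  have hprod : ∀ e : Fin (Module.finrank ℤ M) → ℤ, (∏ i, ((a i).toMul : G) ^ e i) =
      ((∑ i, e i • a i).toMul : W) := by
    intro e
    rw [toMul_sum, Subgroup.val_finsetProd]
    rfl
  have htors : ∀ m : M, m ∈ T ↔ IsOfFinOrder ((m.toMul : W) : G) := by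
    intro m
    have h1 : m ∈ T ↔ m ∈ AddCommGroup.torsion M := by
      rw [← Submodule.torsion_int]; rfl
    exact h1.trans ((isOfFinAddOrder_ofMul_iff (x := m.toMul)).trans
      (Submonoid.isOfFinOrder_coe (H := W.toSubmonoid)).symm)
  refine ⟨fun i => ((a i).toMul : W), fun i => (a i).toMul.2, fun w hw => ?_, fun e he => ?_⟩
  · let m : M := Additive.ofMul ⟨w, hw⟩
    let e := b.repr (T.mkQ m)
    refine ⟨e, ((m - ∑ i, e i • a i).toMul : W), ?_, ?_⟩
    · rw [← htors, ← Submodule.ker_mkQ T, LinearMap.mem_ker, map_sub, map_sum, sub_eq_zero]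
      simp only [map_smul, ha]
      exact (b.sum_repr _).symm
    · rw [hprod, ← Subgroup.coe_mul, ← toMul_add, sub_add_cancel]
      rfl
  · rw [hprod, ← htors, ← Submodule.ker_mkQ T, LinearMap.mem_ker, map_sum] at he
    simp only [map_smul, ha] at he
    funext i
    exact Fintype.linearIndependent_iff.mp b.linearIndependent e he i

variable {K : Type*} (L : Type*) [Field K] [Field L] [Algebra K L]

/-- `a` is a basis of `W` modulo torsion, the torsion of `W` has exponent dividing `z`, and `z`
bounds the extent to which products of the `a i` become powers in `K(ζ_∞)`. -/
structure IsRadicalBasis (W : Subgroup Kˣ) {r : ℕ} (a : Fin r → Kˣ) (z : ℕ) : Prop where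
  pos : 0 < z
  mem : ∀ i, a i ∈ W
  gen : ∀ w ∈ W, ∃ (e : Fin r → ℤ) (ζ : Kˣ), ζ ^ z = 1 ∧ w = ζ * ∏ i, a i ^ e i
  dvd : ∀ (x : L) (n : ℕ) (e : Fin r → ℤ), 0 < n → x ∈ cyclotomicInfty K L →
    x ^ n = ∏ i, algebraMap K L (a i) ^ e i → ∀ i, (n : ℤ) ∣ z * e i

/-- Let x ^ n = b with b the product of the a i ^ e i, and let c be `cyclotomicExponent K`. Up to a
root of unity x ^ c is some h in K, so h ^ n = b ^ c lies in W and h ^ E lies in W. Expanding h ^ E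
in the basis with exponents g i and comparing gives e i * c * E = g i * n. -/
theorem exists_isRadicalBasis [NumberField K] [IsAlgClosure K L] [CharZero L] {W : Subgroup Kˣ}
    (hW : W.FG) {E : ℕ} (hE : ∀ (h : Kˣ) (n : ℕ), 0 < n → h ^ n ∈ W → h ^ E ∈ W) :
    ∃ a : Fin (groupRank W) → Kˣ, ∀ z : ℕ, 0 < z → cyclotomicExponent K * E ∣ z →
      IsRadicalBasis L W a z := by
  obtain ⟨a, haW, hgen, hind⟩ := W.exists_basis_mod_torsion hW (r := groupRank W) rfl
  have hcoe : ∀ e : Fin (groupRank W) → ℤ,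
      ∏ i, algebraMap K L (a i) ^ e i = algebraMap K L ((∏ i, a i ^ e i : Kˣ) : K) := by
    intro e
    rw [Units.coe_prod, map_prod]
    exact Finset.prod_congr rfl fun i _ => by rw [Units.val_zpow_eq_zpow_val, map_zpow₀]
  refine ⟨a, fun z hz hdvd => ⟨hz, haW, fun w hw => ?_, fun x n e hn hx hxn i => ?_⟩⟩
  · obtain ⟨e, ζ, hζ, h⟩ := hgen w hw
    obtain ⟨n, hn, hζn⟩ := isOfFinOrder_iff_pow_eq_one.mp hζ
    refine ⟨e, ζ, ?_, h⟩
    obtain ⟨q, rfl⟩ := (dvd_mul_right _ _).trans hdvd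
    apply Units.ext
    rw [Units.val_pow_eq_pow_val, Units.val_one, pow_mul,
      pow_cyclotomicExponent_eq_one hn (by rw [← Units.val_pow_eq_pow_val, hζn, Units.val_one]),
      one_pow]
  · rw [hcoe] at hxn
    set b : Kˣ := ∏ i, a i ^ e i with hb
    have hx0 : x ≠ 0 := by
      rintro rfl
      rw [zero_pow hn.ne', eq_comm, map_eq_zero] at hxn
      exact b.ne_zero hxn
    obtain ⟨h, ζ, hζ, hxh⟩ := exists_pow_cyclotomicExponent_eq hx0 hx hn ⟨_, hxn.symm⟩
    have hhn : h ^ n = (b : K) ^ cyclotomicExponent K := by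
      apply (algebraMap K L).injective
      have h1 := congrArg (· ^ n) hxh
      simp only [mul_pow, hζ, mul_one] at h1
      rw [map_pow, ← h1, map_pow, ← hxn, ← pow_mul, ← pow_mul, mul_comm]
    have hh0 : h ≠ 0 := by
      rintro rfl
      rw [zero_pow hn.ne'] at hhn
      exact pow_ne_zero _ b.ne_zero hhn.symm
    have hun : (Units.mk0 h hh0) ^ n = b ^ cyclotomicExponent K := by
      apply Units.ext
      rw [Units.val_pow_eq_pow_val, Units.val_mk0, hhn, Units.val_pow_eq_pow_val]
    have hbW : b ∈ W := Subgroup.prod_mem _ fun i _ => Subgroup.zpow_mem _ (haW i) _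
    obtain ⟨g, ξ, hξ, hg⟩ := hgen _ (hE _ n hn (hun ▸ Subgroup.pow_mem _ hbW _))
    have h2 : ∏ i, a i ^ (e i * (cyclotomicExponent K * E : ℕ) - g i * n) = ξ ^ n := by
      have h3 := congrArg (· ^ n) hg
      simp only [← pow_mul] at h3
      rw [mul_comm E, pow_mul, hun, ← pow_mul, mul_pow, hb, ← Finset.prod_pow,
        ← Finset.prod_pow] at h3
      simp only [zpow_sub, zpow_mul, zpow_natCast]
      rw [Finset.prod_mul_distrib, h3, Finset.prod_inv_distrib, mul_inv_cancel_right]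
    have h4 := congrFun (hind _ (h2 ▸ hξ.pow)) i
    simp only [Pi.zero_apply, sub_eq_zero] at h4
    obtain ⟨q, rfl⟩ := hdvd
    rw [Nat.cast_mul, mul_right_comm, mul_comm _ (e i), h4]
    exact ⟨g i * q, by ring⟩

end Basis

/-! ### Kummer extensions of intermediate fields, and degrees over `K(ζ_∞)` -/

section KummerDegree

open IntermediateField

variable {K L : Type*} [Field K] [Field L] [Algebra K L]

theorem IntermediateField.mem_range_algebraMap_iff {k : IntermediateField K L} {x : L} :
    x ∈ (algebraMap k L).range ↔ x ∈ k :=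
  ⟨by rintro ⟨y, rfl⟩; exact y.2, fun h => ⟨⟨x, h⟩, rfl⟩⟩

theorem IntermediateField.extendScalars_sup_adjoin (k : IntermediateField K L) (S : Set L) :
    extendScalars (le_sup_left : k ≤ k ⊔ adjoin K S) = adjoin k S :=
  restrictScalars_injective K (by
    rw [extendScalars_restrictScalars, restrictScalars_adjoin_eq_sup])

theorem IntermediateField.relfinrank_sup_adjoin (k : IntermediateField K L) (S : Set L) :
    relfinrank k (k ⊔ adjoin K S) = Module.finrank k (adjoin k S) := by
  rw [relfinrank_eq_finrank_of_le le_sup_left, extendScalars_sup_adjoin]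

theorem IntermediateField.mem_sup_adjoin_iff {k : IntermediateField K L} {S : Set L} {x : L} :
    x ∈ k ⊔ adjoin K S ↔ x ∈ adjoin k S := by
  rw [← restrictScalars_adjoin_eq_sup, mem_restrictScalars]

theorem IntermediateField.relfinrank_sup_adjoin_simple [Algebra.IsAlgebraic K L]
    (k : IntermediateField K L) (x : L) :
    relfinrank k (k ⊔ adjoin K {x}) = (minpoly k x).natDegree := by
  rw [relfinrank_sup_adjoin, adjoin.finrank (Algebra.IsIntegral.isIntegral x)]

theorem mem_cyclotomicInfty {ζ : L} {n : ℕ} (hn : 0 < n) (hζ : ζ ^ n = 1) :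
    ζ ∈ cyclotomicInfty K L :=
  subset_adjoin K _ ⟨n, hn, hζ⟩

theorem ne_zero_of_pow_eq_unit {β : L} {n : ℕ} (hn : 0 < n) {a : Kˣ}
    (h : β ^ n = algebraMap K L a) : β ≠ 0 := by
  rintro rfl
  rw [zero_pow hn.ne', eq_comm, map_eq_zero] at h
  exact a.ne_zero h

variable {W : Subgroup Kˣ} {r : ℕ} {a : Fin r → Kˣ} {z : ℕ}

/-- Dividing x by the product of the γ i ^ e i leaves an n-th root of the torsion part of w. -/
theorem IsRadicalBasis.exists_eq_of_mem_rootsOf (hb : IsRadicalBasis L W a z) {n : ℕ} (hn : 0 < n)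
    {γ : Fin r → L} (hγ : ∀ i, γ i ^ n = algebraMap K L (a i)) {x : L} (hx : x ∈ rootsOf L W n) :
    ∃ (e : Fin r → ℤ) (ζ : L) (ξ : Kˣ), ξ ^ z = 1 ∧ ζ ^ n = algebraMap K L ξ ∧
      x = ζ * ∏ i, γ i ^ e i := by
  obtain ⟨w, hw, hxw⟩ := hx
  obtain ⟨e, ξ, hξ, rfl⟩ := hb.gen w hw
  have hγ0 : ∏ i, γ i ^ e i ≠ 0 :=
    Finset.prod_ne_zero_iff.mpr fun i _ => zpow_ne_zero _ (ne_zero_of_pow_eq_unit hn (hγ i))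
  refine ⟨e, x * (∏ i, γ i ^ e i)⁻¹, ξ, hξ, ?_, (inv_mul_cancel_right₀ hγ0 x).symm⟩
  have h1 : (∏ i, γ i ^ e i) ^ n = algebraMap K L ((∏ i, a i ^ e i : Kˣ) : K) := by
    rw [← Finset.prod_pow, Units.coe_prod, map_prod]
    refine Finset.prod_congr rfl fun i _ => ?_
    rw [← zpow_natCast, ← zpow_mul, mul_comm, zpow_mul, zpow_natCast, hγ,
      Units.val_zpow_eq_zpow_val, map_zpow₀]
  rw [mul_pow, inv_pow, hxw, h1, Units.val_mul, map_mul, mul_inv_cancel_right₀]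
  rw [← h1]
  exact pow_ne_zero _ hγ0

theorem IsRadicalBasis.cyclotomicInftyKummer_eq (hb : IsRadicalBasis L W a z) {n : ℕ} (hn : 0 < n)
    {γ : Fin r → L} (hγ : ∀ i, γ i ^ n = algebraMap K L (a i)) :
    cyclotomicInftyKummer L W n = cyclotomicInfty K L ⊔ adjoin K (Set.range γ) := by
  rw [cyclotomicInftyKummer, adjoin_union]
  refine le_antisymm (sup_le le_sup_left (adjoin_le_iff.mpr fun x hx => ?_))
    (sup_le_sup le_rfl (adjoin.mono _ _ _ ?_))
  · obtain ⟨e, ζ, ξ, hξ, hζ, rfl⟩ := hb.exists_eq_of_mem_rootsOf hn hγ hx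
    refine mul_mem ((le_sup_left : cyclotomicInfty K L ≤ _)
      (mem_cyclotomicInfty (Nat.mul_pos hn hb.pos) ?_))
      (prod_mem fun i _ => zpow_mem ((le_sup_right : adjoin K (Set.range γ) ≤ _)
        (subset_adjoin K _ (Set.mem_range_self i))) _)
    rw [pow_mul, hζ, ← map_pow, ← Units.val_pow_eq_pow_val, hξ, Units.val_one, map_one]
  · rintro _ ⟨i, rfl⟩
    exact ⟨a i, hb.mem i, hγ i⟩

variable [IsGalois K L]

theorem relfinrank_sup_adjoin_range_le {k : IntermediateField K L} {r t : ℕ} (ht : 0 < t)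
    {β : Fin r → L} (hβ0 : ∀ i, β i ≠ 0) (hβ : ∀ i, β i ^ t ∈ k) :
    relfinrank k (k ⊔ adjoin K (Set.range β)) ≤ t ^ r := by
  rw [relfinrank_sup_adjoin]
  exact finrank_adjoin_range_le ht hβ0 fun i => mem_range_algebraMap_iff.mpr (hβ i)

theorem relfinrank_sup_adjoin_range_eq {k : IntermediateField K L} {r t : ℕ} (ht : 0 < t)
    {β : Fin r → L} (hβ0 : ∀ i, β i ≠ 0) (hβ : ∀ i, β i ^ t ∈ k)
    (hroots : ∀ ζ : L, ζ ^ t = 1 → ζ ∈ k)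
    (hind : ∀ f : Fin r → ℤ, ∏ i, β i ^ f i ∈ k → ∀ i, (t : ℤ) ∣ f i) :
    relfinrank k (k ⊔ adjoin K (Set.range β)) = t ^ r := by
  rw [relfinrank_sup_adjoin]
  refine finrank_adjoin_range_eq ht (fun i => IsKummerElt.of_pow_mem (hβ0 i)
    (fun ζ hζ => mem_range_algebraMap_iff.mpr (hroots ζ hζ))
    (mem_range_algebraMap_iff.mpr (hβ i))) (fun i => mem_range_algebraMap_iff.mpr (hβ i))
    fun f hf => hind f (mem_range_algebraMap_iff.mp hf)

theorem exists_of_mem_sup_adjoin_range {k : IntermediateField K L} {r t m : ℕ}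
    {β : Fin r → L} (hβ0 : ∀ i, β i ≠ 0) (hβ : ∀ i, β i ^ t ∈ k)
    (hroots : ∀ ζ : L, ζ ^ t = 1 → ζ ∈ k) {y : L} (hy0 : y ≠ 0) (hym : y ^ m ∈ k)
    (hroots' : ∀ ζ : L, ζ ^ m = 1 → ζ ∈ k) (hy : y ∈ k ⊔ adjoin K (Set.range β)) :
    ∃ (g : Fin r → ℤ) (x : L), x ∈ k ∧ y = x * ∏ i, β i ^ g i := by
  obtain ⟨g, c, h⟩ := IsKummerElt.exists_of_mem_adjoin (k := k)
    (fun i => IsKummerElt.of_pow_mem (hβ0 i)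
      (fun ζ hζ => mem_range_algebraMap_iff.mpr (hroots ζ hζ))
      (mem_range_algebraMap_iff.mpr (hβ i)))
    (IsKummerElt.of_pow_mem hy0 (fun ζ hζ => mem_range_algebraMap_iff.mpr (hroots' ζ hζ))
      (mem_range_algebraMap_iff.mpr hym)) (mem_sup_adjoin_iff.mp hy)
  exact ⟨g, c, c.2, h⟩

/-- By Kummer theory ∏ β i ^ f i = x * ∏ γ i ^ g i with x in K(ζ_∞). Then x ^ (m t) is the product
of the a i ^ (t f i - m g i), to which the defining property of `z` applies. -/
theorem IsRadicalBasis.exists_dvd (hb : IsRadicalBasis L W a z) {m t : ℕ} (hm : 0 < m) (ht : 0 < t)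
    {β γ : Fin r → L} (hβ : ∀ i, β i ^ m = algebraMap K L (a i))
    (hγ : ∀ i, γ i ^ t = algebraMap K L (a i)) {f : Fin r → ℤ}
    (hf : ∏ i, β i ^ f i ∈ cyclotomicInfty K L ⊔ adjoin K (Set.range γ)) :
    ∃ g : Fin r → ℤ, ∀ i, ((m * t : ℕ) : ℤ) ∣ z * (t * f i - m * g i) := by
  have hβ0 : ∀ i, β i ≠ 0 := fun i => ne_zero_of_pow_eq_unit hm (hβ i)
  have hγ0 : ∀ i, γ i ≠ 0 := fun i => ne_zero_of_pow_eq_unit ht (hγ i)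
  obtain ⟨g, x, hx, h⟩ := exists_of_mem_sup_adjoin_range (t := t) (m := m) hγ0
    (fun i => hγ i ▸ IntermediateField.algebraMap_mem _ _) (fun ζ hζ => mem_cyclotomicInfty ht hζ)
    (Finset.prod_ne_zero_iff.mpr fun i _ => zpow_ne_zero _ (hβ0 i))
    (by
      rw [← Finset.prod_pow]
      refine prod_mem fun i _ => ?_
      rw [← zpow_natCast, ← zpow_mul, mul_comm, zpow_mul, zpow_natCast, hβ]
      exact zpow_mem (IntermediateField.algebraMap_mem _ _) _)
    (fun ζ hζ => mem_cyclotomicInfty hm hζ) hf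
  refine ⟨g, hb.dvd x (m * t) _ (Nat.mul_pos hm ht) hx ?_⟩
  have hx' : x = (∏ i, β i ^ f i) * (∏ i, γ i ^ g i)⁻¹ := by
    rw [h, mul_inv_cancel_right₀ (Finset.prod_ne_zero_iff.mpr fun i _ => zpow_ne_zero _ (hγ0 i))]
  rw [hx', ← Finset.prod_inv_distrib, ← Finset.prod_mul_distrib, ← Finset.prod_pow]
  refine Finset.prod_congr rfl fun i _ => ?_
  have ha0 : algebraMap K L (a i) ≠ 0 := by simp
  rw [zpow_sub₀ ha0, zpow_mul, zpow_mul, zpow_natCast, zpow_natCast]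
  conv_rhs => rw [← hβ i, div_eq_mul_inv]
  conv_rhs => rw [← pow_mul, hβ i, ← hγ i, ← pow_mul]
  rw [mul_pow, ← zpow_natCast, ← zpow_mul, mul_comm (f i), zpow_mul, zpow_natCast, inv_pow,
    ← zpow_natCast (γ i ^ g i), ← zpow_mul, mul_comm (g i), zpow_mul, zpow_natCast, mul_comm t m]

/-- The loss by the factor z is absorbed by the level n: with n = z c, cancelling n and z leaves c m
∣ f i - m g i. -/
theorem IsRadicalBasis.dvd_of_dvd (hb : IsRadicalBasis L W a z) {m n : ℕ} (hm : 0 < m) (hn : 0 < n)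
    (hzn : z ∣ n) {β γ : Fin r → L} (hβ : ∀ i, β i ^ (n * m) = algebraMap K L (a i))
    (hγ : ∀ i, γ i ^ n = algebraMap K L (a i)) {f : Fin r → ℤ}
    (hf : ∏ i, β i ^ f i ∈ cyclotomicInfty K L ⊔ adjoin K (Set.range γ)) (i : Fin r) :
    (m : ℤ) ∣ f i := by
  obtain ⟨g, hg⟩ := hb.exists_dvd (Nat.mul_pos hn hm) hn hβ hγ hf
  obtain ⟨q, hq⟩ := hg i
  obtain ⟨c, rfl⟩ := hzn
  have hz0 : (z : ℤ) ≠ 0 := by exact_mod_cast hb.pos.ne'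
  have hn0 : ((z * c : ℕ) : ℤ) ≠ 0 := by exact_mod_cast hn.ne'
  refine ⟨g i + c * q, ?_⟩
  have h1 : ((z * c : ℕ) : ℤ) * (z * (f i - m * (g i + c * q))) = 0 := by
    push_cast at hq ⊢
    linear_combination hq
  rcases mul_eq_zero.mp h1 with h2 | h2
  · exact absurd h2 hn0
  · rcases mul_eq_zero.mp h2 with h3 | h3
    · exact absurd h3 hz0
    · linarith

theorem IsRadicalBasis.dvd_of_coprime (hb : IsRadicalBasis L W a z) {m t : ℕ} (hm : 0 < m)
    (ht : 0 < t) (hmz : m.Coprime z) (hmt : m.Coprime t) {β γ : Fin r → L}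
    (hβ : ∀ i, β i ^ m = algebraMap K L (a i))
    (hγ : ∀ i, γ i ^ t = algebraMap K L (a i)) {f : Fin r → ℤ}
    (hf : ∏ i, β i ^ f i ∈ cyclotomicInfty K L ⊔ adjoin K (Set.range γ)) (i : Fin r) :
    (m : ℤ) ∣ f i := by
  obtain ⟨g, hg⟩ := hb.exists_dvd hm ht hβ hγ hf
  have h1 : (m : ℤ) ∣ z * (t * f i - m * g i) :=
    (by exact_mod_cast dvd_mul_right m t : (m : ℤ) ∣ ((m * t : ℕ) : ℤ)).trans (hg i)
  have h2 := (Nat.isCoprime_iff_coprime.mpr hmz).dvd_of_dvd_mul_left h1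
  have h3 : (m : ℤ) ∣ t * f i := by
    have := dvd_add h2 (dvd_mul_right (m : ℤ) (g i))
    rwa [sub_add_cancel] at this
  exact (Nat.isCoprime_iff_coprime.mpr hmt).dvd_of_dvd_mul_left h3

/-- The degrees over `K(ζ_∞)`. -/
theorem IsRadicalBasis.relfinrank_cyclotomicInftyKummer [IsAlgClosed L]
    (hb : IsRadicalBasis L W a z) {t : ℕ} (ht : 0 < t) :
    relfinrank (cyclotomicInftyKummer L W z) (cyclotomicInftyKummer L W (z * t)) = t ^ r := by
  have hzt : 0 < z * t := Nat.mul_pos hb.pos ht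
  choose β hβ using fun i => IsAlgClosed.exists_pow_nat_eq (algebraMap K L (a i)) hzt
  have hβ0 : ∀ i, β i ≠ 0 := fun i => ne_zero_of_pow_eq_unit hzt (hβ i)
  have hγ : ∀ i, (β i ^ t) ^ z = algebraMap K L (a i) := fun i => by
    rw [← pow_mul, mul_comm, hβ]
  rw [hb.cyclotomicInftyKummer_eq hb.pos hγ, hb.cyclotomicInftyKummer_eq hzt hβ]
  have hle : adjoin K (Set.range fun i => β i ^ t) ≤ adjoin K (Set.range β) := by
    refine adjoin_le_iff.mpr ?_
    rintro _ ⟨i, rfl⟩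
    exact pow_mem (subset_adjoin K _ (Set.mem_range_self i)) t
  -- The β i ^ t generate the smaller field over K(ζ_∞), so the larger one arises from it by
  -- adjoining the t-th roots β i.
  rw [← sup_eq_right.mpr hle, ← sup_assoc]
  refine relfinrank_sup_adjoin_range_eq ht hβ0 (fun i => ?_) (fun ζ hζ => ?_) fun f hf i => ?_
  · exact (le_sup_right : adjoin K (Set.range fun i => β i ^ t) ≤ _)
      (subset_adjoin K _ (Set.mem_range_self i))
  · exact (le_sup_left : cyclotomicInfty K L ≤ _) (mem_cyclotomicInfty ht hζ)
  · exact hb.dvd_of_dvd ht hb.pos dvd_rfl hβ hγ hf i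

end KummerDegree

/-! ### Cyclotomic extensions of intermediate fields -/

section CyclotomicDegree

open IntermediateField

/-- `K(ζ_n)`. -/
def muField (K L : Type*) [Field K] [Field L] [Algebra K L] (n : ℕ) : IntermediateField K L :=
  adjoin K {x : L | x ^ n = 1}

variable {K : Type u} {L : Type v} [Field K] [Field L] [Algebra K L]

theorem mem_muField {ζ : L} {n : ℕ} (hζ : ζ ^ n = 1) : ζ ∈ muField K L n :=
  subset_adjoin K _ hζ

theorem muField_le_iff {n : ℕ} {k : IntermediateField K L} :
    muField K L n ≤ k ↔ ∀ ζ : L, ζ ^ n = 1 → ζ ∈ k :=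
  adjoin_le_iff

theorem muField_one : muField K L 1 = ⊥ := by
  rw [eq_bot_iff, muField_le_iff]
  intro ζ hζ
  rw [pow_one] at hζ
  rw [hζ]
  exact one_mem _

theorem muField_mono {m n : ℕ} (h : m ∣ n) : muField K L m ≤ muField K L n := by
  obtain ⟨c, rfl⟩ := h
  exact muField_le_iff.mpr fun ζ hζ => mem_muField (by rw [pow_mul, hζ, one_pow])

theorem muField_le_cyclotomicInfty {n : ℕ} (hn : 0 < n) :
    muField K L n ≤ cyclotomicInfty K L :=
  muField_le_iff.mpr fun _ hζ => mem_cyclotomicInfty hn hζ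

theorem mem_of_coprime_pow_mem {k : IntermediateField K L} {m n : ℕ} (h : m.Coprime n) {x : L}
    (hm : x ^ m ∈ k) (hn : x ^ n ∈ k) : x ∈ k := by
  by_cases hx : x = 0
  · rw [hx]; exact zero_mem _
  · have h1 : x = (x ^ m) ^ m.gcdA n * (x ^ n) ^ m.gcdB n := by
      rw [← zpow_natCast, ← zpow_natCast, ← zpow_mul, ← zpow_mul, ← zpow_add₀ hx,
        ← Nat.gcd_eq_gcd_ab, h, Nat.cast_one, zpow_one]
    rw [h1]
    exact mul_mem (zpow_mem hm _) (zpow_mem hn _)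

theorem muField_mul_of_coprime {m n : ℕ} (h : m.Coprime n) :
    muField K L (m * n) = muField K L m ⊔ muField K L n := by
  refine le_antisymm (muField_le_iff.mpr fun ζ hζ => mem_of_coprime_pow_mem h ?_ ?_)
    (sup_le (muField_mono (dvd_mul_right _ _)) (muField_mono (dvd_mul_left _ _)))
  · exact (le_sup_right : muField K L n ≤ _) (mem_muField (by rw [← pow_mul, hζ]))
  · exact (le_sup_left : muField K L m ≤ _) (mem_muField (by rw [← pow_mul, mul_comm, hζ]))

theorem muField_eq_adjoin_simple {n : ℕ} [NeZero n] {ζ : L} (hζ : IsPrimitiveRoot ζ n) :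
    muField K L n = adjoin K {ζ} := by
  refine le_antisymm (muField_le_iff.mpr fun ξ hξ => ?_)
    (adjoin_simple_le_iff.mpr (mem_muField hζ.pow_eq_one))
  obtain ⟨i, -, rfl⟩ := hζ.eq_pow_of_pow_eq_one hξ
  exact pow_mem (mem_adjoin_simple_self K ζ) i

/-- By multiplicativity of degrees only prime steps have to be checked. The equation avoids the
quotient of totients. -/
theorem relfinrank_muField_mul_eq (k : IntermediateField K L) {N m : ℕ} (hm : 0 < m)
    (hstep : ∀ j p : ℕ, 0 < j → p.Prime → j * p ∣ m →
      relfinrank (k ⊔ muField K L (N * j)) (k ⊔ muField K L (N * j * p)) * (N * j).totient =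
        (N * j * p).totient) :
    relfinrank (k ⊔ muField K L N) (k ⊔ muField K L (N * m)) * N.totient = (N * m).totient := by
  induction m using induction_on_primes with
  | zero => omega
  | one => rw [mul_one, relfinrank_self, one_mul]
  | prime_mul p m hp ih =>
    have hm' : 0 < m := Nat.pos_of_mul_pos_left hm
    have h1 := relfinrank_mul_relfinrank
      (sup_le_sup le_rfl (muField_mono (dvd_mul_right N m)) :
        k ⊔ muField K L N ≤ k ⊔ muField K L (N * m))
      (sup_le_sup le_rfl (muField_mono (dvd_mul_right (N * m) p)) :
        k ⊔ muField K L (N * m) ≤ k ⊔ muField K L (N * m * p))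
    have h2 := ih hm' fun j q hj hq hjq => hstep j q hj hq (hjq.mul_left p)
    have h3 := hstep m p hm' hp (by rw [mul_comm])
    rw [mul_comm p m, ← mul_assoc, ← h1, ← h3, ← h2]
    ring

theorem sup_muField_mul_prime_of_dvd (k : IntermediateField K L) {N p : ℕ} [NeZero (N * p)] {ζ : L}
    (hζ : IsPrimitiveRoot ζ (N * p)) :
    k ⊔ muField K L (N * p) = (k ⊔ muField K L N) ⊔ adjoin K {ζ} := by
  rw [sup_assoc, ← muField_eq_adjoin_simple hζ, sup_eq_right.mpr (muField_mono (dvd_mul_right N p))]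

variable [Algebra.IsAlgebraic K L]

theorem relfinrank_sup_muField_eq (k : IntermediateField K L) {n : ℕ} [NeZero n] {ζ : L}
    (hζ : IsPrimitiveRoot ζ n) :
    relfinrank k (k ⊔ muField K L n) = (minpoly k ζ).natDegree := by
  rw [muField_eq_adjoin_simple hζ, relfinrank_sup_adjoin_simple]

/-- X ^ p - ζ ^ p is irreducible as soon as it has no root, and any root differs from ζ by a p-th
root of unity, which is present since p ∣ N. -/
theorem relfinrank_muField_mul_prime_of_notMem (k : IntermediateField K L) {N p : ℕ} (hN : 0 < N)
    (hp : p.Prime) (hpN : p ∣ N) {ζ : L} (hζ : IsPrimitiveRoot ζ (N * p))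
    (hmem : ζ ∉ k ⊔ muField K L N) :
    relfinrank (k ⊔ muField K L N) (k ⊔ muField K L (N * p)) * N.totient = (N * p).totient := by
  have : NeZero (N * p) := ⟨(Nat.mul_pos hN hp.pos).ne'⟩
  rw [mul_comm N p, Nat.totient_mul_of_prime_of_dvd hp hpN, mul_comm p N,
    sup_muField_mul_prime_of_dvd k hζ, relfinrank_sup_adjoin_simple]
  congr 1
  have hmem' : ζ ^ p ∈ k ⊔ muField K L N := (le_sup_right : muField K L N ≤ _)
    (mem_muField (by rw [← pow_mul, mul_comm, hζ.pow_eq_one]))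
  have hirr : Irreducible (X ^ p - C (⟨ζ ^ p, hmem'⟩ : (k ⊔ muField K L N :))) := by
    refine X_pow_sub_C_irreducible_of_prime hp fun b hb => hmem ?_
    have hb' : (b : L) ^ p = ζ ^ p := congrArg Subtype.val hb
    have hb0 : (b : L) ≠ 0 := by
      intro h0
      rw [h0, zero_pow hp.ne_zero] at hb'
      exact pow_ne_zero _ (hζ.ne_zero this.ne) hb'.symm
    have h1 : ζ = (ζ / b) * b := (div_mul_cancel₀ _ hb0).symm
    rw [h1]
    refine mul_mem ((le_sup_right : muField K L N ≤ _) (muField_mono hpN (mem_muField ?_))) b.2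
    rw [div_pow, hb', div_self (pow_ne_zero _ (hζ.ne_zero this.ne))]
  rw [← minpoly.eq_of_irreducible_of_monic hirr (by simp) (monic_X_pow_sub_C _ hp.ne_zero),
    natDegree_X_pow_sub_C]

variable [IsAlgClosed L] [CharZero L]

theorem relfinrank_sup_muField_le (k : IntermediateField K L) {n : ℕ} (hn : 0 < n) :
    relfinrank k (k ⊔ muField K L n) ≤ n.totient := by
  have : NeZero n := ⟨hn.ne'⟩
  obtain ⟨ζ, hζ⟩ := HasEnoughRootsOfUnity.exists_primitiveRoot L n
  rw [relfinrank_sup_muField_eq k hζ, ← natDegree_cyclotomic n k]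
  refine natDegree_le_of_dvd (minpoly.dvd k ζ ?_) (cyclotomic_ne_zero n k)
  rw [aeval_def, ← eval_map, map_cyclotomic]
  exact hζ.isRoot_cyclotomic hn

theorem relfinrank_sup_muField_of_irreducible (k : IntermediateField K L) {n : ℕ} (hn : 0 < n)
    (hirr : Irreducible (cyclotomic n k)) :
    relfinrank k (k ⊔ muField K L n) = n.totient := by
  have : NeZero n := ⟨hn.ne'⟩
  obtain ⟨ζ, hζ⟩ := HasEnoughRootsOfUnity.exists_primitiveRoot L n
  have hroot : aeval ζ (cyclotomic n k) = 0 := by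
    rw [aeval_def, ← eval_map, map_cyclotomic]
    exact hζ.isRoot_cyclotomic hn
  rw [relfinrank_sup_muField_eq k hζ, ← natDegree_cyclotomic n k,
    ← minpoly.eq_of_irreducible_of_monic hirr hroot (cyclotomic.monic n k)]

theorem relfinrank_muField_mul_prime_le (k : IntermediateField K L) {N p : ℕ} (hN : 0 < N)
    (hp : p.Prime) :
    relfinrank (k ⊔ muField K L N) (k ⊔ muField K L (N * p)) * N.totient ≤ (N * p).totient := by
  by_cases h : p ∣ N
  · have : NeZero (N * p) := ⟨(Nat.mul_pos hN hp.pos).ne'⟩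
    obtain ⟨ζ, hζ⟩ := HasEnoughRootsOfUnity.exists_primitiveRoot L (N * p)
    rw [mul_comm N p, Nat.totient_mul_of_prime_of_dvd hp h, mul_comm p N,
      sup_muField_mul_prime_of_dvd k hζ, relfinrank_sup_adjoin_simple]
    refine Nat.mul_le_mul_right _ ?_
    have hmem : ζ ^ p ∈ k ⊔ muField K L N := (le_sup_right : muField K L N ≤ _)
      (mem_muField (by rw [← pow_mul, mul_comm, hζ.pow_eq_one]))
    have h1 := natDegree_le_of_dvd (minpoly.dvd (k ⊔ muField K L N : IntermediateField K L) ζ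
      (p := X ^ p - C ⟨ζ ^ p, hmem⟩) (by simp)) (X_pow_sub_C_ne_zero hp.pos _)
    rwa [natDegree_X_pow_sub_C] at h1
  · have hcop : N.Coprime p := ((Nat.Prime.coprime_iff_not_dvd hp).mpr h).symm
    rw [Nat.totient_mul hcop, mul_comm, muField_mul_of_coprime hcop, ← sup_assoc]
    exact Nat.mul_le_mul_left _ (relfinrank_sup_muField_le _ hp.pos)

/-- Cyclotomic extensions of a field which is unramified at `p`. -/
theorem relfinrank_muField_mul_prime_of_unramified {p : ℕ} [hp : Fact p.Prime] {U : Subfield L}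
    (hU : IsUnramifiedSubfield p U) (k : IntermediateField K L) (hk : ∀ x ∈ k, x ∈ U) {N : ℕ}
    (hN : 0 < N) :
    relfinrank (k ⊔ muField K L N) (k ⊔ muField K L (N * p)) * N.totient = (N * p).totient := by
  -- Adjoining roots of unity of order N' prime to p stays inside U, and over that field the p-power
  -- cyclotomic polynomials are irreducible.
  obtain ⟨v, N', hN', rfl⟩ := Nat.exists_eq_pow_mul_and_not_dvd hN.ne' p hp.out.ne_one
  have hUroot : ∀ ζ : L, ζ ^ N' = 1 → ζ ∈ U := fun ζ hζ =>
    hU.radical_mem 1 ζ N' 1 (one_mem _) (hp.out.not_dvd_one) hN' (by simpa using isIntegral_one)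
      (by simpa using isIntegral_one) one_ne_zero hζ
  set k₁ := k ⊔ muField K L N' with hk₁
  have hk₁U : ∀ x ∈ k₁, x ∈ U := by
    intro x hx
    rw [hk₁, muField, mem_sup_adjoin_iff] at hx
    induction hx using adjoin_induction with
    | mem x hx => exact hUroot x hx
    | algebraMap x => exact hk _ x.2
    | add x y _ _ hx hy => exact add_mem hx hy
    | inv x _ hx => exact inv_mem hx
    | mul x y _ _ hx hy => exact mul_mem hx hy
  have hdeg : ∀ v : ℕ, relfinrank k₁ (k₁ ⊔ muField K L (p ^ v)) = (p ^ v).totient := fun v =>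
    relfinrank_sup_muField_of_irreducible k₁ (pow_pos hp.out.pos v)
      (hU.irreducible_cyclotomic k₁ (algebraMap k₁ L) (fun x => hk₁U _ x.2) v)
  have hcop : ∀ v : ℕ, N'.Coprime (p ^ v) := fun v =>
    (((Nat.Prime.coprime_iff_not_dvd hp.out).mpr hN').symm).pow_right v
  have hsup : ∀ v : ℕ, k ⊔ muField K L (p ^ v * N') = k₁ ⊔ muField K L (p ^ v) := fun v => by
    rw [mul_comm, muField_mul_of_coprime (hcop v), hk₁, sup_assoc]
  have h1 : p ^ v * N' * p = p ^ (v + 1) * N' := by ring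
  have h2 := relfinrank_mul_relfinrank (le_sup_left : k₁ ≤ k₁ ⊔ muField K L (p ^ v))
    (sup_le_sup le_rfl (muField_mono (pow_dvd_pow p (Nat.le_succ v))) :
      k₁ ⊔ muField K L (p ^ v) ≤ k₁ ⊔ muField K L (p ^ (v + 1)))
  rw [hdeg, hdeg] at h2
  rw [h1, hsup, hsup, Nat.totient_mul (hcop _).symm, Nat.totient_mul (hcop _).symm, ← h2]
  ring

theorem relfinrank_muField_mul_le (k : IntermediateField K L) {N : ℕ} (hN : 0 < N) {m : ℕ}
    (hm : 0 < m) :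
    relfinrank (k ⊔ muField K L N) (k ⊔ muField K L (N * m)) * N.totient ≤ (N * m).totient := by
  induction m using induction_on_primes with
  | zero => omega
  | one => rw [mul_one, relfinrank_self, one_mul]
  | prime_mul p m hp ih =>
    have hm' : 0 < m := Nat.pos_of_mul_pos_left hm
    have h1 := relfinrank_mul_relfinrank
      (sup_le_sup le_rfl (muField_mono (dvd_mul_right N m)) :
        k ⊔ muField K L N ≤ k ⊔ muField K L (N * m))
      (sup_le_sup le_rfl (muField_mono (dvd_mul_right (N * m) p)) :
        k ⊔ muField K L (N * m) ≤ k ⊔ muField K L (N * m * p))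
    rw [mul_comm p m, ← mul_assoc, ← h1]
    calc _ = relfinrank (k ⊔ muField K L (N * m)) (k ⊔ muField K L (N * m * p)) *
          (relfinrank (k ⊔ muField K L N) (k ⊔ muField K L (N * m)) * N.totient) := by ring
      _ ≤ _ := (Nat.mul_le_mul_left _ (ih hm')).trans
        (relfinrank_muField_mul_prime_le k (Nat.mul_pos hN hm') hp)

end CyclotomicDegree

/-! ### Roots of unity in Kummer extensions at highly divisible level -/

section HighLevel

open IntermediateField

/-- Each p-th power multiplies the term after 1 by exactly one more p; p ^ 2 ∣ M makes the quadratic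
remainder negligible. -/
theorem exists_one_add_pow_prime_pow {p M : ℕ} (hpM : p ^ 2 ∣ M) (J : ℕ) :
    ∃ c : ℕ, (1 + M) ^ p ^ J = 1 + M * p ^ J * (1 + p * c) := by
  induction J with
  | zero => exact ⟨0, by ring⟩
  | succ J ih =>
    obtain ⟨c, hc⟩ := ih
    obtain ⟨M₁, rfl⟩ := hpM
    obtain ⟨k, hk⟩ := Polynomial.powAddExpansion 1 (p ^ 2 * M₁ * p ^ J * (1 + p * c)) p
    refine ⟨c + M₁ * p ^ J * (1 + p * c) ^ 2 * k, ?_⟩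
    rw [pow_succ p J, pow_mul, hc, hk]
    simp only [one_pow, mul_one, Nat.cast_id]
    ring

variable {K : Type u} {L : Type v} [Field K] [Field L] [Algebra K L]

theorem AlgEquiv.pow_apply_of_root (σ : L ≃ₐ[K] L) {u : ℕ} {ζ : L} (h : σ ζ = ζ ^ u) (i : ℕ) :
    (σ ^ i) ζ = ζ ^ u ^ i := by
  induction i with
  | zero => simp
  | succ i ih => rw [pow_succ', AlgEquiv.mul_apply, ih, map_pow, h, ← pow_mul, pow_succ']

theorem AlgEquiv.pow_apply_of_eigen (σ : L ≃ₐ[K] L) {ξ y : L} (hξ : σ ξ = ξ) (h : σ y = ξ * y)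
    (i : ℕ) : (σ ^ i) y = ξ ^ i * y := by
  induction i with
  | zero => simp
  | succ i ih => rw [pow_succ', AlgEquiv.mul_apply, ih, map_mul, map_pow, h, hξ, pow_succ]; ring

theorem apply_eq_of_mem_muField {σ : L ≃ₐ[K] L} {N : ℕ} (h : ∀ ζ : L, ζ ^ N = 1 → σ ζ = ζ) {x : L}
    (hx : x ∈ muField K L N) : σ x = x := by
  induction hx using adjoin_induction with
  | mem x hx => exact h x hx
  | algebraMap x => exact σ.commutes x
  | add x y _ _ hx hy => rw [map_add, hx, hy]
  | inv x _ hx => rw [map_inv₀, hx]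
  | mul x y _ _ hx hy => rw [map_mul, hx, hy]

theorem pow_pow_eq_self_of_pow_eq_self {M : Type*} [Monoid M] {x : M} {u : ℕ} (h : x ^ u = x)
    (i : ℕ) : x ^ u ^ i = x := by
  induction i with
  | zero => simp
  | succ i ih => rw [pow_succ, pow_mul, ih, h]

variable [NumberField K] [IsAlgClosure K L] [CharZero L]
variable {W : Subgroup Kˣ} {r : ℕ} {a : Fin r → Kˣ} {z : ℕ}

/-- At a highly divisible level `N`, a further root of unity of order `N * p` is not contained in
the Kummer extension of level `n`. -/
theorem IsRadicalBasis.notMem_of_isPrimitiveRoot (hb : IsRadicalBasis L W a z)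
    (hdz : (Module.finrank ℚ K).factorial ∣ z) {p : ℕ} (hp : p.Prime) (hpz : p ∣ z) {n N : ℕ}
    (hN : 0 < N) (hn : z ^ (2 * z + 3) ∣ n) (hnN : n ∣ N) {γ : Fin r → L}
    (hγ : ∀ i, γ i ^ n = algebraMap K L (a i)) {ζ : L} (hζ : IsPrimitiveRoot ζ (N * p)) :
    ζ ∉ muField K L N ⊔ adjoin K (Set.range γ) := by
  intro hmem
  have := IsAlgClosure.isAlgClosed K (K := L)
  have hz0 := hb.pos
  have hn0 : 0 < n := Nat.pos_of_dvd_of_pos hnN hN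
  have hzn : z ∣ n := (dvd_pow_self z (by omega)).trans hn
  have hγ0 : ∀ i, γ i ≠ 0 := fun i => ne_zero_of_pow_eq_unit hn0 (hγ i)
  have hζ0 : ζ ≠ 0 := hζ.ne_zero (Nat.mul_pos hN hp.pos).ne'
  set d := (Module.finrank ℚ K).factorial with hd
  obtain ⟨e, q, hq, hdeq⟩ :=
    Nat.exists_eq_pow_mul_and_not_dvd (Nat.factorial_ne_zero _ : d ≠ 0) p hp.ne_one
  have hez : e ≤ z := by
    have h1 : e < p ^ e := Nat.lt_pow_self hp.one_lt
    have h2 : p ^ e ∣ z := (Dvd.intro q hdeq.symm).trans hdz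
    exact h1.le.trans (Nat.le_of_dvd hz0 h2)
  -- This is where z ^ (2 * z + 3) is needed: 2 for p ^ 2, 1 for z, and e + z ≤ 2 * z for the power
  -- of p.
  obtain ⟨N', hN', hpN', hzN'⟩ : ∃ N', N = N' * p ^ (e + z) ∧ p ^ 2 ∣ N' ∧ z ∣ N' := by
    have h1 : (p ^ 2 * z) * p ^ (e + z) ∣ N := by
      have h2 : (p ^ 2 * z) * p ^ (e + z) ∣ (z ^ 2 * z) * z ^ (e + z) :=
        mul_dvd_mul (mul_dvd_mul (pow_dvd_pow_of_dvd hpz 2) dvd_rfl) (pow_dvd_pow_of_dvd hpz _)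
      refine h2.trans (Dvd.dvd.trans ?_ (hn.trans hnN))
      rw [← pow_succ, ← pow_add]
      exact pow_dvd_pow z (by omega)
    obtain ⟨c, hc⟩ := h1
    exact ⟨p ^ 2 * z * c, by rw [hc]; ring, Dvd.intro (z * c) (by ring), Dvd.intro (p ^ 2 * c) (by ring)⟩
  have hpN'1 : p ∣ N' := (dvd_pow_self p two_ne_zero).trans hpN'
  have hpN : p ∣ N := hN' ▸ hpN'1.mul_right _
  have hzN : z ∣ N := hN' ▸ hzN'.mul_right _
  -- If ζ were in the field, then ζ = x * Γ with x in K(ζ_N) and Γ a product of the γ i. So Γ lies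
  -- in K(ζ_∞), and the radical basis forces Γ ^ z into K.
  obtain ⟨g, x, hx, hζx⟩ := exists_of_mem_sup_adjoin_range (t := n) (m := p) hγ0
    (fun i => hγ i ▸ IntermediateField.algebraMap_mem _ _)
    (fun ω hω => muField_mono hnN (mem_muField hω)) hζ0
    (mem_muField (by rw [← pow_mul, mul_comm, hζ.pow_eq_one]))
    (fun ω hω => muField_mono hpN (mem_muField hω)) hmem
  set Γ := ∏ i, γ i ^ g i with hΓ
  have hΓ0 : Γ ≠ 0 := Finset.prod_ne_zero_iff.mpr fun i _ => zpow_ne_zero _ (hγ0 i)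
  have hx0 : x ≠ 0 := by
    rintro rfl
    rw [zero_mul] at hζx
    exact hζ0 hζx
  have hdvd : ∀ i, (n : ℤ) ∣ z * -g i := by
    refine hb.dvd (x * ζ⁻¹) n _ hn0 (mul_mem (muField_le_cyclotomicInfty hN hx)
      (inv_mem (mem_cyclotomicInfty (Nat.mul_pos hN hp.pos) hζ.pow_eq_one))) ?_
    have h1 : x * ζ⁻¹ = Γ⁻¹ := by
      rw [hζx, mul_inv, mul_inv_cancel_left₀ hx0]
    rw [h1, hΓ, ← Finset.prod_inv_distrib, ← Finset.prod_pow]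
    refine Finset.prod_congr rfl fun i _ => ?_
    rw [zpow_neg, ← hγ i, inv_pow, ← zpow_natCast, ← zpow_natCast, ← zpow_mul, ← zpow_mul, mul_comm]
  choose h hh using hdvd
  have hΓz : Γ ^ z = algebraMap K L (∏ i, (a i : K) ^ (-h i)) := by
    rw [hΓ, ← Finset.prod_pow, map_prod]
    refine Finset.prod_congr rfl fun i _ => ?_
    rw [map_zpow₀, ← hγ i, ← zpow_natCast, ← zpow_natCast, ← zpow_mul, ← zpow_mul]
    congr 1
    linear_combination -hh i
  have hcop : (1 + N').Coprime (N * p) := by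
    have h1 : (1 + N').Coprime N' := by simp
    rw [hN']
    exact (h1.mul_right ((h1.coprime_dvd_right hpN'1).pow_right _)).mul_right
      (h1.coprime_dvd_right hpN'1)
  -- The power σ ^ p ^ z acts on the roots of unity of order N p by the exponent A ^ q with A = 1 +
  -- N (1 + p c). So it fixes K(ζ_N), and in particular x, while it multiplies ζ by (ζ ^ N) ^ q and
  -- Γ by ξ ^ p ^ z, where ξ = σ Γ / Γ; these two factors must agree.
  obtain ⟨σ, hσ⟩ := exists_aut_apply_eq_pow (K := K) (L := L) (Nat.mul_pos hN hp.pos) hcop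
  rw [← hd] at hσ
  set ξ := σ Γ / Γ with hξ
  have hξz : ξ ^ z = 1 := by
    rw [hξ, div_pow, ← map_pow, hΓz, AlgEquiv.commutes, div_self]
    rw [← hΓz]
    exact pow_ne_zero _ hΓ0
  have hσξ : σ ξ = ξ := by
    rw [hσ ξ (by
      obtain ⟨c, hc⟩ := hzN
      rw [hc, mul_assoc, pow_mul, hξz, one_pow])]
    refine pow_pow_eq_self_of_pow_eq_self ?_ d
    obtain ⟨c, hc⟩ := hzN'
    rw [pow_add, pow_one, hc, pow_mul, hξz, one_pow, mul_one]
  obtain ⟨c, hc⟩ := exists_one_add_pow_prime_pow hpN' (e + z)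
  rw [← hN'] at hc
  set A := (1 + N') ^ p ^ (e + z) with hA
  have hexp : ((1 + N') ^ d) ^ p ^ z = A ^ q := by
    rw [hA, hd, hdeq, ← pow_mul, ← pow_mul]
    congr 1
    ring
  have hτ : ∀ ω : L, ω ^ (N * p) = 1 → (σ ^ p ^ z) ω = ω ^ A ^ q := fun ω hω => by
    rw [AlgEquiv.pow_apply_of_root σ (hσ ω hω), hexp]
  have hAN : ∀ ω : L, ω ^ N = 1 → ω ^ A = ω := fun ω hω => by
    rw [hc, pow_add, pow_one, pow_mul, hω, one_pow, mul_one]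
  have hτx : (σ ^ p ^ z) x = x := by
    refine apply_eq_of_mem_muField (N := N) (fun ω hω => ?_) hx
    rw [hτ ω (by rw [pow_mul, hω, one_pow])]
    exact pow_pow_eq_self_of_pow_eq_self (hAN ω hω) q
  have hτΓ : (σ ^ p ^ z) Γ = ξ ^ p ^ z * Γ :=
    AlgEquiv.pow_apply_of_eigen σ hσξ (div_mul_cancel₀ _ hΓ0).symm _
  have hωN : (ζ ^ N) ^ N = 1 := by
    obtain ⟨c, hc⟩ := hpN
    rw [← pow_mul]
    nth_rewrite 2 [hc]
    rw [← mul_assoc, pow_mul, hζ.pow_eq_one, one_pow]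
  have hζA : ζ ^ A = ζ * ζ ^ N := by
    rw [hc, mul_add, mul_one, ← mul_assoc, pow_add, pow_add, pow_one, pow_mul,
      hζ.pow_eq_one, one_pow, mul_one]
  have hζAq : ∀ i : ℕ, ζ ^ A ^ i = ζ * (ζ ^ N) ^ i := by
    intro i
    induction i with
    | zero => simp
    | succ i ih =>
      rw [pow_succ A, pow_mul, ih, mul_pow, hζA, ← pow_mul, mul_comm i A, pow_mul, hAN _ hωN,
        pow_succ]
      ring
  have hkey : (ζ ^ N) ^ q = ξ ^ p ^ z := by
    have h1 := hτ ζ hζ.pow_eq_one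
    rw [hζAq] at h1
    have h2 : (σ ^ p ^ z) ζ = ζ * ξ ^ p ^ z := by
      conv_lhs => rw [hζx, map_mul, hτx, hτΓ]
      rw [hζx]
      ring
    rw [h2] at h1
    exact (mul_left_cancel₀ hζ0 h1).symm
  have hω : IsPrimitiveRoot (ζ ^ N) p := hζ.pow (Nat.mul_pos hN hp.pos) rfl
  -- As p ∤ q, the element ξ ^ p ^ z is a nontrivial p-th root of unity. The resulting order of ξ
  -- exceeds z, although ξ ^ z = 1.
  have hord : orderOf ξ = p ^ (z + 1) := by
    have : Fact p.Prime := ⟨hp⟩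
    refine orderOf_eq_prime_pow ?_ ?_
    · rw [← hkey, hω.pow_eq_one_iff_dvd]
      exact hq
    · rw [pow_succ, pow_mul, ← hkey, ← pow_mul, mul_comm, pow_mul, hω.pow_eq_one, one_pow]
  have h1 := Nat.le_of_dvd hz0 (hord ▸ orderOf_dvd_of_pow_eq_one hξz)
  have h2 : z + 1 < p ^ (z + 1) := Nat.lt_pow_self hp.one_lt
  omega

end HighLevel

/-! ### Intersections of cyclotomic–Kummer fields -/

section Intersections

open IntermediateField

variable {K : Type u} {L : Type v} [Field K] [Field L] [Algebra K L]

theorem IntermediateField.finiteDimensional_of_le {A B : IntermediateField K L} (h : A ≤ B)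
    [FiniteDimensional K B] : FiniteDimensional K A :=
  FiniteDimensional.of_injective (inclusion h).toLinearMap (inclusion_injective h)

theorem relfinrank_pos_of_le {A B : IntermediateField K L} (h : A ≤ B) [FiniteDimensional K B] :
    0 < relfinrank A B := by
  have h1 := relfinrank_mul_relfinrank (bot_le : ⊥ ≤ A) h
  rw [relfinrank_bot_left (A := B)] at h1
  exact Nat.pos_of_mul_pos_left (h1 ▸ Module.finrank_pos)

theorem relfinrank_sup_le_mul {A M H : IntermediateField K L} (hM : A ≤ M) (hH : A ≤ H) :
    relfinrank A (M ⊔ H) ≤ relfinrank A M * relfinrank A H := by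
  rw [relfinrank_eq_finrank_of_le hM, relfinrank_eq_finrank_of_le hH,
    relfinrank_eq_finrank_of_le (hM.trans le_sup_left)]
  have h : extendScalars (hM.trans (le_sup_left : M ≤ M ⊔ H)) = extendScalars hM ⊔ extendScalars hH :=
    (extendScalars_sup hM hH).symm
  rw [h]
  exact finrank_sup_le _ _

/-- Two extensions with large compositum have small intersection. -/
theorem inf_le_of_relfinrank_le {k M H : IntermediateField K L} [FiniteDimensional K M]
    [FiniteDimensional K H] (hkM : k ≤ M) (hkH : k ≤ H)
    (h : relfinrank k M ≤ relfinrank H (M ⊔ H)) : M ⊓ H ≤ k := by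
  have hBM : M ⊓ H ≤ M := inf_le_left
  have hBH : M ⊓ H ≤ H := inf_le_right
  have h1 := relfinrank_sup_le_mul hBM hBH
  rw [← relfinrank_mul_relfinrank hBH le_sup_right, mul_comm] at h1
  -- Now [MH : H] ≤ [M : M ⊓ H]. With [M : k] ≤ [MH : H] this leaves degree one for M ⊓ H over k.
  have h2 := Nat.le_of_mul_le_mul_right h1 (relfinrank_pos_of_le hBH)
  have h3 := relfinrank_mul_relfinrank (le_inf hkM hkH) hBM
  have h4 := relfinrank_pos_of_le hBM
  have : FiniteDimensional K (M ⊓ H : IntermediateField K L) := IntermediateField.finiteDimensional_of_le hBM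
  have h5 := relfinrank_pos_of_le (le_inf hkM hkH)
  have h6 : relfinrank k (M ⊓ H) * relfinrank (M ⊓ H) M ≤ 1 * relfinrank (M ⊓ H) M := by
    rw [h3, one_mul]; exact h.trans h2
  have h7 := Nat.le_of_mul_le_mul_right h6 h4
  exact relfinrank_eq_one_iff.mp (by omega)

/-- `K(ζ_n)` with the elements `γ i` adjoined. -/
def kummerField (n : ℕ) {r : ℕ} (γ : Fin r → L) : IntermediateField K L :=
  muField K L n ⊔ adjoin K (Set.range γ)

theorem muField_le_kummerField (n : ℕ) {r : ℕ} (γ : Fin r → L) :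
    muField K L n ≤ kummerField n γ := le_sup_left

theorem mem_kummerField (n : ℕ) {r : ℕ} (γ : Fin r → L) (i : Fin r) :
    γ i ∈ kummerField (K := K) n γ :=
  (le_sup_right : adjoin K (Set.range γ) ≤ _) (subset_adjoin K _ (Set.mem_range_self i))

theorem kummerField_le_iff {n r : ℕ} {γ : Fin r → L} {k : IntermediateField K L} :
    kummerField n γ ≤ k ↔ muField K L n ≤ k ∧ ∀ i, γ i ∈ k := by
  rw [kummerField, sup_le_iff, adjoin_le_iff, Set.range_subset_iff]
  rfl

variable {W : Subgroup Kˣ} {r : ℕ} {a : Fin r → Kˣ} {z : ℕ}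

theorem IsRadicalBasis.kummerField_le (hb : IsRadicalBasis L W a z) {n : ℕ} {γ : Fin r → L}
    (hγ : ∀ i, γ i ^ n = algebraMap K L (a i)) : kummerField n γ ≤ cyclotomicKummer L W n := by
  rw [kummerField_le_iff]
  exact ⟨adjoin.mono _ _ _ Set.subset_union_left,
    fun i => subset_adjoin K _ (Or.inr ⟨a i, hb.mem i, hγ i⟩)⟩

theorem IsRadicalBasis.cyclotomicKummer_le (hb : IsRadicalBasis L W a z) {n : ℕ} (hn : 0 < n)
    {γ : Fin r → L} (hγ : ∀ i, γ i ^ n = algebraMap K L (a i)) {k : IntermediateField K L}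
    (hγk : ∀ i, γ i ∈ k) (hk : ∀ ζ : L, ζ ^ n ∈ k → (ζ ^ z) ^ n = 1 → ζ ∈ k) :
    cyclotomicKummer L W n ≤ k := by
  refine adjoin_le_iff.mpr (Set.union_subset (fun ζ hζ => ?_) fun x hx => ?_)
  · have hζ' : ζ ^ n = 1 := hζ
    exact hk ζ (hζ' ▸ one_mem k) (by rw [← pow_mul, mul_comm, pow_mul, hζ', one_pow])
  · obtain ⟨e, ζ, ξ, hξ, hζ, rfl⟩ := hb.exists_eq_of_mem_rootsOf hn hγ hx
    refine mul_mem (hk ζ (hζ ▸ IntermediateField.algebraMap_mem _ _) ?_)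
      (prod_mem fun i _ => zpow_mem (hγk i) _)
    rw [← pow_mul, mul_comm, pow_mul, hζ, ← map_pow, ← Units.val_pow_eq_pow_val, hξ, Units.val_one,
      map_one]

theorem IsRadicalBasis.cyclotomicKummer_le_kummerField (hb : IsRadicalBasis L W a z) {m n : ℕ}
    (hn : 0 < n) (hnm : n * z ∣ m) {β : Fin r → L} {γ : Fin r → L}
    (hγ : ∀ i, γ i ^ n = algebraMap K L (a i)) (hγβ : ∀ i, γ i ∈ kummerField (K := K) m β) :
    cyclotomicKummer L W n ≤ kummerField m β :=
  hb.cyclotomicKummer_le hn hγ hγβ fun ζ _ hζ => muField_le_kummerField m β (by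
    refine muField_mono hnm (mem_muField ?_)
    rw [mul_comm, pow_mul, hζ])

/-- An m-th root ζ of a torsion element has ζ ^ m in K and ζ ^ z an m-th root of unity; as m is
coprime to z, Bézout shows that torsion contributes nothing new. -/
theorem IsRadicalBasis.cyclotomicKummer_eq (hb : IsRadicalBasis L W a z) {m : ℕ} (hm : 0 < m)
    (hmz : m.Coprime z) {β : Fin r → L} (hβ : ∀ i, β i ^ m = algebraMap K L (a i)) :
    cyclotomicKummer L W m = kummerField m β :=
  le_antisymm (hb.cyclotomicKummer_le hm hβ (mem_kummerField m β) fun _ h1 h2 =>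
    mem_of_coprime_pow_mem hmz h1 (muField_le_kummerField m β (mem_muField h2)))
    (hb.kummerField_le hβ)

variable [NumberField K] [IsAlgClosure K L] [CharZero L]

theorem finiteDimensional_kummerField {n : ℕ} (hn : 0 < n) {r : ℕ} (γ : Fin r → L) :
    FiniteDimensional K (kummerField (K := K) n γ) := by
  have := IsAlgClosure.isAlgClosed K (K := L)
  have : NeZero n := ⟨hn.ne'⟩
  obtain ⟨ζ, hζ⟩ := HasEnoughRootsOfUnity.exists_primitiveRoot L n
  have : FiniteDimensional K (muField K L n) := by
    rw [muField_eq_adjoin_simple hζ]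
    exact adjoin.finiteDimensional (Algebra.IsIntegral.isIntegral ζ)
  have := finite_adjoin_range (k := K) γ
  exact finiteDimensional_sup _ _

theorem IsRadicalBasis.finiteDimensional_cyclotomicKummer (hb : IsRadicalBasis L W a z) {n : ℕ}
    (hn : 0 < n) : FiniteDimensional K (cyclotomicKummer L W n) := by
  have := IsAlgClosure.isAlgClosed K (K := L)
  choose γ hγ using fun i => IsAlgClosed.exists_pow_nat_eq (algebraMap K L (a i)) hn
  have := finiteDimensional_kummerField (K := K) (Nat.mul_pos hn hb.pos) γ
  exact IntermediateField.finiteDimensional_of_le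
    (hb.cyclotomicKummer_le_kummerField hn dvd_rfl hγ (mem_kummerField _ γ))

/-- The roots of unity contribute at most φ(n m) / φ(n), the radicals at most m ^ r. -/
theorem relfinrank_kummerField_le {n m : ℕ} (hn : 0 < n) (hm : 0 < m) {β : Fin r → L}
    (hβ : ∀ i, β i ≠ 0) :
    relfinrank (kummerField n fun i => β i ^ m) (kummerField (K := K) (n * m) β) * n.totient ≤
      (n * m).totient * m ^ r := by
  have := IsAlgClosure.isAlgClosed K (K := L)
  set k := kummerField (K := K) n fun i => β i ^ m with hk
  have hkn : k ⊔ muField K L n = k := sup_eq_left.mpr (muField_le_kummerField _ _)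
  have h1 := relfinrank_muField_mul_le k hn hm
  rw [hkn] at h1
  have h2 : kummerField (K := K) (n * m) β = (k ⊔ muField K L (n * m)) ⊔ adjoin K (Set.range β) := by
    rw [kummerField, sup_assoc, ← kummerField, eq_comm, sup_eq_right, hk, kummerField_le_iff]
    exact ⟨(muField_mono (dvd_mul_right n m)).trans (muField_le_kummerField _ _),
      fun i => pow_mem (mem_kummerField _ β i) m⟩
  have h3 : relfinrank (k ⊔ muField K L (n * m))
      ((k ⊔ muField K L (n * m)) ⊔ adjoin K (Set.range β)) ≤ m ^ r :=
    relfinrank_sup_adjoin_range_le hm hβ fun i =>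
      (le_sup_left : k ≤ _) (mem_kummerField n (fun i => β i ^ m) i)
  rw [h2, ← relfinrank_mul_relfinrank (le_sup_left : k ≤ k ⊔ muField K L (n * m)) le_sup_left,
    mul_right_comm]
  exact Nat.mul_le_mul h1 h3

/-- The degree of the compositum of a cyclotomic–Kummer field with a field `H` that is
independent of it. -/
theorem IsRadicalBasis.relfinrank_cyclotomicKummer_sup (hb : IsRadicalBasis L W a z) {m : ℕ} (hm : 0 < m)
    (hmz : m.Coprime z) (H : IntermediateField K L)
    (hU : ∀ p : ℕ, [Fact p.Prime] → p ∣ m →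
      ∃ U : Subfield L, IsUnramifiedSubfield p U ∧ ∀ x ∈ H, x ∈ U)
    (hind : ∀ β : Fin r → L, (∀ i, β i ^ m = algebraMap K L (a i)) → ∀ f : Fin r → ℤ,
      ∏ i, β i ^ f i ∈ H ⊔ muField K L m → ∀ i, (m : ℤ) ∣ f i) :
    relfinrank H (cyclotomicKummer L W m ⊔ H) = m.totient * m ^ r := by
  have := IsAlgClosure.isAlgClosed K (K := L)
  choose β hβ using fun i => IsAlgClosed.exists_pow_nat_eq (algebraMap K L (a i)) hm
  have hβ0 : ∀ i, β i ≠ 0 := fun i => ne_zero_of_pow_eq_unit hm (hβ i)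
  have h1 : relfinrank H (H ⊔ muField K L m) = m.totient := by
    -- Starting from level 1, each prime step has maximal degree since H is unramified at p.
    have h2 := relfinrank_muField_mul_eq H (N := 1) hm fun j p hj hp hjp => by
      have : Fact p.Prime := ⟨hp⟩
      obtain ⟨U, hU, hHU⟩ := hU p ((dvd_mul_left p j).trans hjp)
      exact relfinrank_muField_mul_prime_of_unramified hU H hHU (by omega)
    rwa [muField_one, sup_bot_eq, Nat.totient_one, mul_one, one_mul] at h2
  have h3 : relfinrank (H ⊔ muField K L m) ((H ⊔ muField K L m) ⊔ adjoin K (Set.range β)) = m ^ r :=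
    relfinrank_sup_adjoin_range_eq hm hβ0 (fun i => hβ i ▸ IntermediateField.algebraMap_mem _ _)
      (fun ζ hζ => (le_sup_right : muField K L m ≤ _) (mem_muField hζ)) (hind β hβ)
  rw [hb.cyclotomicKummer_eq hm hmz hβ, sup_comm, kummerField, ← sup_assoc,
    ← relfinrank_mul_relfinrank (le_sup_left : H ≤ H ⊔ muField K L m) le_sup_left, h1, h3]

theorem IsRadicalBasis.finrank_cyclotomicKummer (hb : IsRadicalBasis L W a z) {m : ℕ} (hm : 0 < m)
    (hmz : m.Coprime z) (hU : ∀ p : ℕ, [Fact p.Prime] → p ∣ m →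
      ∃ U : Subfield L, IsUnramifiedSubfield p U ∧ ∀ x : K, algebraMap K L x ∈ U) :
    Module.finrank K (cyclotomicKummer L W m) = m.totient * m ^ r := by
  have := IsAlgClosure.isAlgClosed K (K := L)
  rw [← relfinrank_bot_left, ← sup_bot_eq (cyclotomicKummer L W m)]
  refine hb.relfinrank_cyclotomicKummer_sup hm hmz ⊥ (fun p _ hp => ?_) fun β hβ f hf => ?_
  · obtain ⟨U, hU, hKU⟩ := hU p hp
    refine ⟨U, hU, fun x hx => ?_⟩
    obtain ⟨y, rfl⟩ := mem_bot.mp hx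
    exact hKU y
  · refine hb.dvd_of_coprime (t := 1) hm one_pos hmz (Nat.coprime_one_right m) hβ
      (γ := fun i => algebraMap K L (a i)) (fun i => pow_one _) ?_
    rw [bot_sup_eq] at hf
    exact (le_sup_left : cyclotomicInfty K L ≤ _) (muField_le_cyclotomicInfty hm hf)

/-- The degree does not drop when the base is enlarged from K to H. -/
theorem IsRadicalBasis.inf_eq_bot (hb : IsRadicalBasis L W a z) {m : ℕ} (hm : 0 < m)
    (hmz : m.Coprime z) (H : IntermediateField K L) [FiniteDimensional K H]
    (hU : ∀ p : ℕ, [Fact p.Prime] → p ∣ m →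
      ∃ U : Subfield L, IsUnramifiedSubfield p U ∧ ∀ x ∈ H, x ∈ U)
    (hind : ∀ β : Fin r → L, (∀ i, β i ^ m = algebraMap K L (a i)) → ∀ f : Fin r → ℤ,
      ∏ i, β i ^ f i ∈ H ⊔ muField K L m → ∀ i, (m : ℤ) ∣ f i) :
    cyclotomicKummer L W m ⊓ H = ⊥ := by
  have := hb.finiteDimensional_cyclotomicKummer hm
  rw [eq_bot_iff]
  refine inf_le_of_relfinrank_le bot_le bot_le ?_
  rw [hb.relfinrank_cyclotomicKummer_sup hm hmz H hU hind, relfinrank_bot_left,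
    hb.finrank_cyclotomicKummer hm hmz fun p _ hp => ?_]
  obtain ⟨U, hU, hHU⟩ := hU p hp
  exact ⟨U, hU, fun x => hHU _ (IntermediateField.algebraMap_mem H x)⟩

end Intersections

/-! ### Radical bases with good reduction outside `z` -/

section Separation

open IntermediateField

/-- The identity φ(gcd(a, b)) φ(a b) = φ(a) φ(b) gcd(a, b) is applied to the pairs (n t, n m) and
(n, n t m), which have the same product and the same gcd. -/
theorem Nat.totient_mul_mul_totient {n m t : ℕ} (hmt : m.Coprime t) :
    (n * t * m).totient * n.totient = (n * t).totient * (n * m).totient := by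
  have h := Nat.totient_gcd_mul_totient_mul (n * t) (n * m)
  have hg : (n * t).gcd (n * m) = n := by
    rw [Nat.gcd_mul_left, hmt.symm.gcd_eq_one, mul_one]
  have h2 := Nat.totient_gcd_mul_totient_mul n (n * t * m)
  rw [Nat.gcd_eq_left (by rw [mul_assoc]; exact dvd_mul_right n _)] at h2
  rw [hg, show n * t * (n * m) = n * (n * t * m) by ring, h2] at h
  rcases Nat.eq_zero_or_pos n with rfl | hn
  · simp
  · have h3 := Nat.eq_of_mul_eq_mul_right hn h
    rw [mul_comm, h3]

variable {K : Type u} {L : Type v} [Field K] [Field L] [Algebra K L]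
variable {W : Subgroup Kˣ} {r : ℕ} {a : Fin r → Kˣ} {z : ℕ}

/-- For each prime `p` not dividing `z`, the fields `K(ζ_t, W^{1/t})` with `p ∤ t` are
unramified above `p`. -/
def HasGoodReduction (L : Type v) [Field L] [Algebra K L] (W : Subgroup Kˣ) (z : ℕ) : Prop :=
  ∀ p : ℕ, [Fact p.Prime] → ¬ p ∣ z → ∃ U : Subfield L, IsUnramifiedSubfield p U ∧
    ∀ t : ℕ, 0 < t → ¬ p ∣ t → ∀ x ∈ cyclotomicKummer L W t, x ∈ U

variable [NumberField K] [IsAlgClosure K L] [CharZero L]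

/-- A prime p of m either divides z, and then roots of unity grow maximally because the level is
highly divisible, or it does not divide n, and then the field of level n is unramified at p. -/
theorem IsRadicalBasis.relfinrank_kummerField_mul_totient (hb : IsRadicalBasis L W a z)
    (hdz : (Module.finrank ℚ K).factorial ∣ z) (hW : HasGoodReduction L W z) {n m : ℕ} (hn : 0 < n)
    (hzn : z ^ (2 * z + 3) ∣ n) (hm : 0 < m) (hnm : ∀ p : ℕ, p.Prime → p ∣ m → p ∣ n → p ∣ z)
    {β : Fin r → L} (hβ : ∀ i, β i ^ (n * m) = algebraMap K L (a i)) :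
    relfinrank (kummerField n fun i => β i ^ m) (kummerField (K := K) (n * m) β) * n.totient =
      (n * m).totient * m ^ r := by
  have := IsAlgClosure.isAlgClosed K (K := L)
  have hzn' : z ∣ n := (dvd_pow_self z (by omega)).trans hzn
  have hβ0 : ∀ i, β i ≠ 0 := fun i => ne_zero_of_pow_eq_unit (Nat.mul_pos hn hm) (hβ i)
  have hγ : ∀ i, (β i ^ m) ^ n = algebraMap K L (a i) := fun i => by
    rw [← pow_mul, mul_comm, hβ]
  set k := kummerField (K := K) n fun i => β i ^ m with hk
  have hkn : k ⊔ muField K L n = k := sup_eq_left.mpr (muField_le_kummerField _ _)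
  have h1 := relfinrank_muField_mul_eq k (N := n) hm fun j p hj hp hjp => by
    have hnj : 0 < n * j := Nat.mul_pos hn hj
    by_cases hpz : p ∣ z
    · have : NeZero (n * j * p) := ⟨(Nat.mul_pos hnj hp.pos).ne'⟩
      obtain ⟨ζ, hζ⟩ := HasEnoughRootsOfUnity.exists_primitiveRoot L (n * j * p)
      refine relfinrank_muField_mul_prime_of_notMem k hnj hp
        (hpz.trans (hzn'.trans (dvd_mul_right n j))) hζ fun hmem =>
        hb.notMem_of_isPrimitiveRoot hdz hp hpz hnj hzn (dvd_mul_right n j) hγ hζ ?_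
      refine (sup_le (sup_le ?_ le_sup_right) le_sup_left :
        k ⊔ muField K L (n * j) ≤ _) hmem
      exact (muField_mono (dvd_mul_right n j)).trans le_sup_left
    · have : Fact p.Prime := ⟨hp⟩
      obtain ⟨U, hU, hWU⟩ := hW p hpz
      exact relfinrank_muField_mul_prime_of_unramified hU k (fun x hx =>
        hWU n hn (fun h => hpz (hnm p hp ((dvd_mul_left p j).trans hjp) h)) x
          (hb.kummerField_le hγ hx)) hnj
  rw [hkn] at h1
  have h2 : kummerField (K := K) (n * m) β = (k ⊔ muField K L (n * m)) ⊔ adjoin K (Set.range β) := by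
    rw [kummerField, sup_assoc, ← kummerField, eq_comm, sup_eq_right, hk, kummerField_le_iff]
    exact ⟨(muField_mono (dvd_mul_right n m)).trans (muField_le_kummerField _ _),
      fun i => pow_mem (mem_kummerField _ β i) m⟩
  have h3 : relfinrank (k ⊔ muField K L (n * m))
      ((k ⊔ muField K L (n * m)) ⊔ adjoin K (Set.range β)) = m ^ r := by
    refine relfinrank_sup_adjoin_range_eq hm hβ0 (fun i =>
      (le_sup_left : k ≤ _) (mem_kummerField n (fun i => β i ^ m) i))
      (fun ζ hζ => (le_sup_right : muField K L (n * m) ≤ _)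
        (muField_mono (dvd_mul_left m n) (mem_muField hζ))) fun f hf =>
      hb.dvd_of_dvd hm hn hzn' hβ hγ ?_
    have hle := muField_le_cyclotomicInfty (K := K) (L := L) (Nat.mul_pos hn hm)
    refine (sup_le (sup_le_sup ?_ le_rfl) (hle.trans le_sup_left) :
      k ⊔ muField K L (n * m) ≤ _) hf
    exact muField_le_cyclotomicInfty hn
  rw [h2, ← relfinrank_mul_relfinrank (le_sup_left : k ≤ k ⊔ muField K L (n * m)) le_sup_left,
    mul_right_comm, h1, h3]

/-- Cyclotomic–Kummer fields of coprime levels intersect in a field of bounded level. -/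
theorem IsRadicalBasis.inf_le (hb : IsRadicalBasis L W a z)
    (hdz : (Module.finrank ℚ K).factorial ∣ z) (hW : HasGoodReduction L W z) {m t : ℕ}
    (hm : 0 < m) (ht : 0 < t) (hmt : m.Coprime t) :
    cyclotomicKummer L W m ⊓ cyclotomicKummer L W t ≤ cyclotomicKummer L W (z ^ (2 * z + 3)) := by
  have := IsAlgClosure.isAlgClosed K (K := L)
  set n := z ^ (2 * z + 3) with hn
  have hz0 := hb.pos
  have hn0 : 0 < n := Nat.pow_pos hz0
  have hzn : z ∣ n := dvd_pow_self z (by omega)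
  have hntm : 0 < n * t * m := Nat.mul_pos (Nat.mul_pos hn0 ht) hm
  -- A single system of roots at level n t m provides compatible generators at the levels n m, n t
  -- and n.
  choose β hβ using fun i => IsAlgClosed.exists_pow_nat_eq (algebraMap K L (a i)) hntm
  have hβ0 : ∀ i, β i ≠ 0 := fun i => ne_zero_of_pow_eq_unit hntm (hβ i)
  set M := kummerField (K := K) (n * m) fun i => β i ^ t with hM
  set H := kummerField (K := K) (n * t) fun i => β i ^ m with hH
  set k := kummerField (K := K) n fun i => (β i ^ t) ^ m with hk
  have hkM : k ≤ M := kummerField_le_iff.mpr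
    ⟨(muField_mono (dvd_mul_right n m)).trans (muField_le_kummerField _ _),
      fun i => pow_mem (mem_kummerField _ (fun i => β i ^ t) i) m⟩
  have hkH : k ≤ H := kummerField_le_iff.mpr
    ⟨(muField_mono (dvd_mul_right n t)).trans (muField_le_kummerField _ _), fun i => by
      rw [pow_right_comm]; exact pow_mem (mem_kummerField _ (fun i => β i ^ m) i) t⟩
  have := finiteDimensional_kummerField (K := K) (Nat.mul_pos hn0 hm) fun i => β i ^ t
  have := finiteDimensional_kummerField (K := K) (Nat.mul_pos hn0 ht) fun i => β i ^ m
  have hT := finiteDimensional_kummerField (K := K) hntm β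
  have h1 : relfinrank k M * n.totient ≤ (n * m).totient * m ^ r :=
    relfinrank_kummerField_le hn0 hm fun i => pow_ne_zero t (hβ0 i)
  have h2 : relfinrank H (kummerField (n * t * m) β) * (n * t).totient =
      (n * t * m).totient * m ^ r := by
    refine hb.relfinrank_kummerField_mul_totient hdz hW (Nat.mul_pos hn0 ht) (dvd_mul_right n t) hm ?_ hβ
    intro p hp hpm hpnt
    rcases hp.dvd_mul.mp hpnt with h | h
    · exact hp.dvd_of_dvd_pow h
    · exact absurd (Nat.dvd_gcd hpm h) (by rw [hmt.gcd_eq_one]; exact hp.not_dvd_one)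
  have h3 : M ⊔ H = kummerField (n * t * m) β := by
    refine le_antisymm (sup_le (kummerField_le_iff.mpr ⟨?_, fun i => ?_⟩)
      (kummerField_le_iff.mpr ⟨?_, fun i => ?_⟩)) (kummerField_le_iff.mpr ⟨?_, fun i => ?_⟩)
    · exact (muField_mono (Nat.mul_dvd_mul_right (dvd_mul_right n t) m)).trans
        (muField_le_kummerField _ _)
    · exact pow_mem (mem_kummerField _ β i) t
    · exact (muField_mono (dvd_mul_right _ m)).trans (muField_le_kummerField _ _)
    · exact pow_mem (mem_kummerField _ β i) m
    · refine muField_le_iff.mpr fun ζ hζ => mem_of_coprime_pow_mem hmt ?_ ?_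
      · exact (le_sup_right : H ≤ _) (muField_le_kummerField _ _
          (mem_muField (by rw [← pow_mul, mul_comm, hζ])))
      · exact (le_sup_left : M ≤ _) (muField_le_kummerField _ _
          (mem_muField (by rw [← pow_mul, ← hζ]; congr 1; ring)))
    · exact mem_of_coprime_pow_mem hmt
        ((le_sup_right : H ≤ _) (mem_kummerField _ (fun i => β i ^ m) i))
        ((le_sup_left : M ≤ _) (mem_kummerField _ (fun i => β i ^ t) i))
  -- Up to clearing totients, [M : k] ≤ φ(n m) / φ(n) * m^r = φ(n t m) / φ(n t) * m^r = [MH : H].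
  have h4 : M ⊓ H ≤ k := by
    refine inf_le_of_relfinrank_le hkM hkH ?_
    have hpos : 0 < n.totient * (n * t).totient :=
      Nat.mul_pos (Nat.totient_pos.mpr hn0) (Nat.totient_pos.mpr (Nat.mul_pos hn0 ht))
    refine Nat.le_of_mul_le_mul_right ?_ hpos
    rw [h3]
    calc relfinrank k M * (n.totient * (n * t).totient)
        = relfinrank k M * n.totient * (n * t).totient := by ring
      _ ≤ (n * m).totient * m ^ r * (n * t).totient := Nat.mul_le_mul_right _ h1
      _ = (n * t * m).totient * n.totient * m ^ r := by
          rw [Nat.totient_mul_mul_totient hmt]; ring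
      _ = relfinrank H (kummerField (n * t * m) β) * (n * t).totient * n.totient := by
          rw [h2]; ring
      _ = _ := by ring
  -- Since z ∣ n, the levels n m and n t also contain the m-th and t-th roots of the torsion of W.
  refine (inf_le_inf ?_ ?_).trans (h4.trans (hb.kummerField_le fun i => ?_))
  · refine hb.cyclotomicKummer_le_kummerField hm
      (by rw [mul_comm]; exact Nat.mul_dvd_mul_right hzn m)
      (γ := fun i => (β i ^ t) ^ n) (fun i => ?_)
      (fun i => pow_mem (mem_kummerField _ (fun i => β i ^ t) i) n)
    rw [← pow_mul, ← pow_mul, ← hβ]; congr 1; ring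
  · refine hb.cyclotomicKummer_le_kummerField ht
      (by rw [mul_comm]; exact Nat.mul_dvd_mul_right hzn t)
      (γ := fun i => (β i ^ m) ^ n) (fun i => ?_)
      (fun i => pow_mem (mem_kummerField _ (fun i => β i ^ m) i) n)
    rw [← pow_mul, ← pow_mul, ← hβ]; congr 1; ring
  · rw [← pow_mul, ← pow_mul, ← hβ]; congr 1; ring

/-- The field of level t is unramified at the primes of m, and it lies in K(ζ_∞, W^{1/t}), over
which m-th roots of the `a i` remain independent. -/
theorem IsRadicalBasis.inf_eq_bot_of_coprime (hb : IsRadicalBasis L W a z)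
    (hW : HasGoodReduction L W z) {m t : ℕ} (hm : 0 < m) (ht : 0 < t) (hmt : m.Coprime t)
    (hmz : m.Coprime z) : cyclotomicKummer L W m ⊓ cyclotomicKummer L W t = ⊥ := by
  have := IsAlgClosure.isAlgClosed K (K := L)
  have := hb.finiteDimensional_cyclotomicKummer ht
  have hcop : ∀ p n : ℕ, p.Prime → p ∣ m → m.Coprime n → ¬ p ∣ n := fun p n hp hpm hmn hpn =>
    hp.not_dvd_one (hmn.gcd_eq_one ▸ Nat.dvd_gcd hpm hpn)
  refine hb.inf_eq_bot hm hmz _ (fun p hp hpm => ?_) fun β hβ f hf => ?_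
  · obtain ⟨U, hU, hWU⟩ := hW p (hcop p z hp.out hpm hmz)
    exact ⟨U, hU, hWU t ht (hcop p t hp.out hpm hmt)⟩
  · choose γ hγ using fun i => IsAlgClosed.exists_pow_nat_eq (algebraMap K L (a i)) ht
    refine hb.dvd_of_coprime hm ht hmz hmt hβ hγ ?_
    refine (sup_le ?_ ((muField_le_cyclotomicInfty hm).trans le_sup_left) :
      cyclotomicKummer L W t ⊔ muField K L m ≤ _) hf
    exact (hb.cyclotomicKummer_le_kummerField ht dvd_rfl hγ (mem_kummerField _ γ)).trans
      (sup_le_sup (muField_le_cyclotomicInfty (Nat.mul_pos ht hb.pos)) le_rfl)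

theorem IsRadicalBasis.finrank_of_coprime (hb : IsRadicalBasis L W a z)
    (hW : HasGoodReduction L W z) {m : ℕ} (hm : 0 < m) (hmz : m.Coprime z) :
    Module.finrank K (cyclotomicKummer L W m) = m.totient * m ^ r := by
  refine hb.finrank_cyclotomicKummer hm hmz fun p hp hpm => ?_
  obtain ⟨U, hU, hWU⟩ := hW p fun hpz =>
    hp.out.not_dvd_one (hmz.gcd_eq_one ▸ Nat.dvd_gcd hpm hpz)
  exact ⟨U, hU, fun x => hWU 1 one_pos hp.out.not_dvd_one _ (IntermediateField.algebraMap_mem _ x)⟩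

end Separation

/-! ### Disjointness from a given extension -/

section Disjointness

open IntermediateField

variable {K : Type u} {L : Type v} [Field K] [Field L] [Algebra K L]

/-- All conjugates of y are y times m-th roots of unity in k, and up to sign their product is the
constant coefficient of the minimal polynomial. -/
theorem pow_natDegree_minpoly_mem [IsAlgClosed L] [Algebra.IsAlgebraic K L]
    {k : IntermediateField K L} {m : ℕ} (hm : 0 < m)
    (hroots : ∀ ζ : L, ζ ^ m = 1 → ζ ∈ k) {y : L} (hy : y ^ m ∈ k) :
    y ^ (minpoly k y).natDegree ∈ k := by
  by_cases hy0 : y = 0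
  · rw [hy0]; exact pow_mem (zero_mem k) _
  have hint : IsIntegral k y := Algebra.IsIntegral.isIntegral y
  set q := (minpoly k y).map (algebraMap k L) with hq
  have hsplit : q.Splits := IsAlgClosed.splits q
  have hmonic : q.Monic := (minpoly.monic hint).map _
  have hroot : ∀ ρ ∈ q.roots, (ρ * y⁻¹) ^ m = 1 := by
    intro ρ hρ
    have h1 : aeval ρ (minpoly k y) = 0 := by
      rw [aeval_def, ← eval_map]; exact isRoot_of_mem_roots hρ
    have h2 : minpoly k y ∣ X ^ m - C ⟨y ^ m, hy⟩ :=
      minpoly.dvd k y (by simp)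
    have h3 : aeval ρ (X ^ m - C (⟨y ^ m, hy⟩ : k)) = 0 := by
      obtain ⟨g, hg⟩ := h2
      rw [hg, map_mul, h1, zero_mul]
    have h4 : ρ ^ m = y ^ m := by simpa [sub_eq_zero] using h3
    rw [mul_pow, inv_pow, h4, mul_inv_cancel₀ (pow_ne_zero m hy0)]
  have hprod : ∀ s : Multiset L, (∀ ρ ∈ s, (ρ * y⁻¹) ^ m = 1) → s.prod ∈ k →
      y ^ s.card ∈ k := by
    intro s hs hsk
    have h1 : (s.map fun ρ => ρ * y⁻¹).prod = s.prod * (y ^ s.card)⁻¹ := by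
      rw [Multiset.prod_map_mul, Multiset.map_id', Multiset.map_const', Multiset.prod_replicate,
        inv_pow]
    have h2 : (s.map fun ρ => ρ * y⁻¹).prod ∈ k :=
      multiset_prod_mem _ fun x hx => by
        obtain ⟨ρ, hρ, rfl⟩ := Multiset.mem_map.mp hx
        exact hroots _ (hs ρ hρ)
    have h3 : s.prod ≠ 0 := by
      refine Multiset.prod_ne_zero fun h0 => ?_
      have := hs 0 h0
      rw [zero_mul, zero_pow hm.ne'] at this
      exact zero_ne_one this
    have h4 : y ^ s.card = s.prod * ((s.map fun ρ => ρ * y⁻¹).prod)⁻¹ := by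
      rw [h1, mul_inv, inv_inv, mul_inv_cancel_left₀ h3]
    rw [h4]
    exact mul_mem hsk (inv_mem h2)
  have hcard : q.roots.card = (minpoly k y).natDegree := by
    rw [← hsplit.natDegree_eq_card_roots, hq, natDegree_map]
  rw [← hcard]
  refine hprod _ hroot ?_
  have h5 := hsplit.coeff_zero_eq_prod_roots_of_monic hmonic
  have h6 : q.coeff 0 ∈ k := by rw [hq, coeff_map]; exact ((minpoly k y).coeff 0).2
  have h7 : q.roots.prod = (-1) ^ q.natDegree * q.coeff 0 := by
    rw [h5, ← mul_assoc, ← mul_pow, neg_mul_neg, one_mul, one_pow, one_mul]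
  rw [h7]
  exact mul_mem (pow_mem (neg_mem (one_mem k)) _) h6

/-- The degree of y over k is at most that of ρ, hence at most D and coprime to m. So k contains two
powers of y with coprime exponents. -/
theorem mem_of_mem_sup_adjoin_simple [IsAlgClosed L] [Algebra.IsAlgebraic K L]
    {k : IntermediateField K L} {m D : ℕ} (hm : 0 < m)
    (hroots : ∀ ζ : L, ζ ^ m = 1 → ζ ∈ k) (hD : ∀ i : ℕ, 0 < i → i ≤ D → m.Coprime i) {y ρ : L}
    (hym : y ^ m ∈ k) (hρ : (minpoly K ρ).natDegree ≤ D) (hy : y ∈ k ⊔ adjoin K {ρ}) : y ∈ k := by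
  have hle : k ⊔ adjoin K {y} ≤ k ⊔ adjoin K {ρ} :=
    sup_le le_sup_left (adjoin_simple_le_iff.mpr hy)
  have h1 := relfinrank_mul_relfinrank (le_sup_left : k ≤ k ⊔ adjoin K {y}) hle
  rw [relfinrank_sup_adjoin_simple, relfinrank_sup_adjoin_simple] at h1
  have hρi : IsIntegral k ρ := Algebra.IsIntegral.isIntegral ρ
  have h2 := Nat.le_of_dvd (minpoly.natDegree_pos hρi) (Dvd.intro _ h1)
  have h3 : (minpoly k ρ).natDegree ≤ (minpoly K ρ).natDegree := by
    rw [← natDegree_map (p := minpoly K ρ) (algebraMap K k)]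
    exact natDegree_le_of_dvd (minpoly.dvd_map_of_isScalarTower K k ρ)
      ((minpoly.monic (Algebra.IsIntegral.isIntegral ρ)).map _).ne_zero
  exact mem_of_coprime_pow_mem
    (hD _ (minpoly.natDegree_pos (Algebra.IsIntegral.isIntegral y)) (h2.trans (h3.trans hρ))) hym
    (pow_natDegree_minpoly_mem hm hroots hym)

theorem mem_of_mem_sup_adjoin [IsAlgClosed L] [Algebra.IsAlgebraic K L]
    {k : IntermediateField K L} {m D : ℕ} (hm : 0 < m)
    (hroots : ∀ ζ : L, ζ ^ m = 1 → ζ ∈ k) (hD : ∀ i : ℕ, 0 < i → i ≤ D → m.Coprime i) {y : L}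
    (hym : y ^ m ∈ k) {S : Set L} (hS : S.Finite) (hSD : ∀ ρ ∈ S, (minpoly K ρ).natDegree ≤ D)
    (hy : y ∈ k ⊔ adjoin K S) : y ∈ k := by
  induction S, hS using Set.Finite.induction_on with
  | empty => simpa using hy
  | @insert ρ S _ _ ih =>
    refine ih (fun x hx => hSD x (Set.mem_insert_of_mem _ hx)) ?_
    refine mem_of_mem_sup_adjoin_simple hm (fun ζ hζ => (le_sup_left : k ≤ _) (hroots ζ hζ)) hD
      ((le_sup_left : k ≤ _) hym) (hSD ρ (Set.mem_insert _ _)) ?_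
    rwa [sup_assoc, ← adjoin_union, Set.union_singleton]

variable {W : Subgroup Kˣ} {r : ℕ} {a : Fin r → Kˣ} {z : ℕ}
variable [NumberField K] [IsAlgClosure K L] [CharZero L]

/-- A product of m-th roots that lies in K(ζ_∞) after adjoining S lies there already, because the
degrees of the elements of S are too small to create a radical of order m. -/
theorem IsRadicalBasis.inf_adjoin_eq_bot (hb : IsRadicalBasis L W a z) {m D : ℕ} (hm : 0 < m)
    (hmz : m.Coprime z) (hD : ∀ i : ℕ, 0 < i → i ≤ D → m.Coprime i) {S : Set L} (hS : S.Finite)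
    (hSD : ∀ ρ ∈ S, (minpoly K ρ).natDegree ≤ D)
    (hU : ∀ p : ℕ, [Fact p.Prime] → p ∣ m → ∃ U : Subfield L, IsUnramifiedSubfield p U ∧
      ∀ x ∈ adjoin K S, x ∈ U) :
    cyclotomicKummer L W m ⊓ adjoin K S = ⊥ := by
  have := IsAlgClosure.isAlgClosed K (K := L)
  have : Finite S := hS
  have : FiniteDimensional K (adjoin K S) :=
    finiteDimensional_adjoin fun x _ => Algebra.IsIntegral.isIntegral x
  refine hb.inf_eq_bot hm hmz _ hU fun β hβ f hf => ?_
  refine hb.dvd_of_coprime (t := 1) hm one_pos hmz (Nat.coprime_one_right m) hβ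
      (γ := fun i => algebraMap K L (a i)) (fun i => pow_one _)
      ((le_sup_left : cyclotomicInfty K L ≤ _) ?_)
  refine mem_of_mem_sup_adjoin hm (fun ζ hζ => mem_cyclotomicInfty hm hζ) hD ?_ hS hSD
    ((sup_le le_sup_right ((muField_le_cyclotomicInfty hm).trans le_sup_left) :
      adjoin K S ⊔ muField K L m ≤ _) hf)
  rw [← Finset.prod_pow]
  refine prod_mem fun i _ => ?_
  rw [← zpow_natCast, ← zpow_mul, mul_comm, zpow_mul, zpow_natCast, hβ]
  exact zpow_mem (IntermediateField.algebraMap_mem _ _) _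

end Disjointness

/-! ### Heights of codes -/

section Heights

theorem coeff_foldr_eq {R A : Type*} [CommRing R] (g : A → R) (l : List A) (i : ℕ) :
    (l.foldr (fun a q => C (g a) + X * q) 0).coeff i = 0 ∨
      ∃ a ∈ l, (l.foldr (fun a q => C (g a) + X * q) 0).coeff i = g a := by
  induction l generalizing i with
  | nil => exact Or.inl (by simp)
  | cons a l ih =>
    cases i with
    | zero => exact Or.inr ⟨a, by simp, by simp⟩
    | succ i =>
      simp only [List.foldr_cons, coeff_add, coeff_C_succ, coeff_X_mul, zero_add]
      rcases ih i with h | ⟨b, hb, h⟩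
      · exact Or.inl h
      · exact Or.inr ⟨b, List.mem_cons_of_mem _ hb, h⟩

theorem natDegree_foldr_le {R A : Type*} [CommRing R] (g : A → R) (l : List A) :
    (l.foldr (fun a q => C (g a) + X * q) 0).natDegree ≤ l.length := by
  induction l with
  | nil => simp
  | cons a l ih =>
    rw [List.foldr_cons, List.length_cons]
    refine (natDegree_add_le _ _).trans (max_le (by simp) ?_)
    exact natDegree_mul_le.trans (by have := natDegree_X_le (R := R); omega)

theorem natDegree_intPoly_le (l : List ℤ) : (intPoly l).natDegree ≤ l.length :=
  natDegree_foldr_le (fun a : ℤ => a) l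

theorem abs_coeff_intPoly_le {l : List ℤ} {N : ℕ} (h : ∀ a ∈ l, |a| ≤ N) (i : ℕ) :
    |(intPoly l).coeff i| ≤ N := by
  rcases coeff_foldr_eq (fun a : ℤ => a) l i with h0 | ⟨a, ha, h0⟩
  · have h0' : (intPoly l).coeff i = 0 := h0
    rw [h0', abs_zero]; exact Int.natCast_nonneg N
  · have h0' : (intPoly l).coeff i = a := h0
    rw [h0']; exact h a ha

/-- The lengths and the entries of the code are bounded by `N`. -/
structure EltCode.HeightLE (e : EltCode) (N : ℕ) : Prop where
  length_le : e.1.length ≤ N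
  abs_le : ∀ a ∈ e.1, |a| ≤ N
  den_le : e.2 ≤ N

/-- The lengths and the entries of the code are bounded by `N`. -/
structure GroupCode.HeightLE (s : GroupCode) (N : ℕ) : Prop where
  length_le : s.1.length ≤ N
  abs_le : ∀ a ∈ s.1, |a| ≤ N
  length_gens_le : s.2.length ≤ N
  gens_le : ∀ e ∈ s.2, EltCode.HeightLE e N

/-- The pairing function dominates its arguments, so the number encoding an input can serve as a
bound for its height. -/
theorem List.encode_le_encode_of_mem {α : Type*} [Encodable α] {l : List α} {a : α} (h : a ∈ l) :
    Encodable.encode a ≤ Encodable.encode l := by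
  induction l with
  | nil => simp at h
  | cons b l ih =>
    rw [Encodable.encode_list_cons]
    rcases List.mem_cons.mp h with rfl | h
    · exact (Nat.left_le_pair _ _).trans (Nat.le_succ _)
    · exact (ih h).trans ((Nat.right_le_pair _ _).trans (Nat.le_succ _))

theorem Prod.encode_fst_le {α β : Type*} [Encodable α] [Encodable β] (x : α × β) :
    Encodable.encode x.1 ≤ Encodable.encode x := by
  rw [← Prod.mk.eta (p := x), Encodable.encode_prod_val]; exact Nat.left_le_pair _ _

theorem Prod.encode_snd_le {α β : Type*} [Encodable α] [Encodable β] (x : α × β) :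
    Encodable.encode x.2 ≤ Encodable.encode x := by
  rw [← Prod.mk.eta (p := x), Encodable.encode_prod_val]; exact Nat.right_le_pair _ _

theorem Int.abs_le_encode (a : ℤ) : |a| ≤ Encodable.encode a := by
  rcases a with n | n
  · have h : Encodable.encode (Int.ofNat n) = 2 * n := rfl
    rw [h, Int.ofNat_eq_natCast, abs_of_nonneg (Int.natCast_nonneg n)]
    push_cast; omega
  · have h : Encodable.encode (Int.negSucc n) = 2 * n + 1 := rfl
    rw [h, Int.negSucc_eq, abs_neg, abs_of_nonneg (by positivity)]
    push_cast; omega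

theorem EltCode.heightLE_of_encode_le {e : EltCode} {N : ℕ} (h : Encodable.encode e ≤ N) :
    e.HeightLE N where
  length_le := (Encodable.length_le_encode _).trans ((Prod.encode_fst_le e).trans h)
  abs_le a ha := (Int.abs_le_encode a).trans (by
    exact_mod_cast (List.encode_le_encode_of_mem ha).trans ((Prod.encode_fst_le e).trans h))
  den_le := (Prod.encode_snd_le e).trans h

theorem GroupCode.heightLE_of_encode_le {s : GroupCode} {N : ℕ} (h : Encodable.encode s ≤ N) :
    s.HeightLE N where
  length_le := (Encodable.length_le_encode _).trans ((Prod.encode_fst_le s).trans h)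
  abs_le a ha := (Int.abs_le_encode a).trans (by
    exact_mod_cast (List.encode_le_encode_of_mem ha).trans ((Prod.encode_fst_le s).trans h))
  length_gens_le := (Encodable.length_le_encode _).trans ((Prod.encode_snd_le s).trans h)
  gens_le e he := EltCode.heightLE_of_encode_le
    ((List.encode_le_encode_of_mem he).trans ((Prod.encode_snd_le s).trans h))

end Heights

/-! ### Bounds for the elements described by codes of bounded height -/

section ElementBounds

/-- A bound for the absolute values of the conjugates of `g(θ)`, where the height of `g` is at most
`N`. -/
def elementBound (N : ℕ) : ℕ := (N + 1) * N * (N + 2) ^ N + 1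

/-- A bound for the conjugates of the cofactors of `g(θ)` in an integer. -/
def cofactorBound (N : ℕ) : ℕ := (N + 1) * (2 * elementBound N) ^ N * elementBound N ^ N

theorem EltCode.aeval_ne_zero {K : Type*} [Field K] {θ : K} {e : EltCode} (he : e.eval θ ≠ 0) :
    aeval θ (intPoly e.1) ≠ 0 :=
  fun h => he (by rw [EltCode.eval, h, zero_div])

variable {K : Type u} [Field K] [CharZero K]

/-- `θ` is an integral generator of `K`, of degree at most `N` and with conjugates of absolute
value at most `N + 2`. -/
structure IsBoundedGenerator (θ : K) (N : ℕ) : Prop where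
  integral : IsIntegral ℤ θ
  generates : IntermediateField.adjoin ℚ {θ} = ⊤
  finrank_le : Module.finrank ℚ K ≤ N
  norm_le : ∀ φ : K →+* ℂ, ‖φ θ‖ ≤ (N + 2 : ℕ)

theorem norm_le_of_root {q : ℂ[X]} (hq : q ≠ 0) {x : ℂ} (hx : q.IsRoot x) {A : ℝ}
    (hA : ∀ i, ‖q.coeff i‖ ≤ A * ‖q.leadingCoeff‖) : ‖x‖ ≤ A + 1 := by
  have hlc : 0 < ‖q.leadingCoeff‖ := norm_pos_iff.mpr (leadingCoeff_ne_zero.mpr hq)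
  have hA0 : 0 ≤ A := by
    have := (norm_nonneg _).trans (hA 0)
    exact nonneg_of_mul_nonneg_left this hlc
  have h1 := hx.norm_lt_cauchyBound hq
  have h2 : cauchyBound q ≤ A.toNNReal + 1 := by
    rw [cauchyBound]
    gcongr
    rw [div_le_iff₀ (by exact_mod_cast hlc)]
    refine Finset.sup_le fun i _ => ?_
    rw [← NNReal.coe_le_coe, NNReal.coe_mul, Real.coe_toNNReal A hA0]
    exact hA i
  have h3 : (‖x‖₊ : ℝ) ≤ ((A.toNNReal + 1 : NNReal) : ℝ) := NNReal.coe_le_coe.mpr (h1.le.trans h2)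
  rwa [NNReal.coe_add, Real.coe_toNNReal A hA0, NNReal.coe_one, coe_nnnorm] at h3

theorem GroupCode.Describes.isBoundedGenerator {s : GroupCode} {θ : K} {W : Subgroup Kˣ} {N : ℕ}
    (h : s.Describes θ W) (hs : s.HeightLE N) : IsBoundedGenerator θ N where
  integral := h.integral
  generates := h.generates
  finrank_le := by
    rw [← IntermediateField.finrank_top', ← h.generates,
      IntermediateField.adjoin.finrank (h.integral.tower_top (A := ℚ)),
      ← natDegree_minpoly_int h.integral, h.minpoly_eq]
    exact (natDegree_intPoly_le _).trans hs.length_le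
  norm_le φ := by
    have hmon := (minpoly.monic h.integral).map (Int.castRingHom ℂ)
    have hroot : ((minpoly ℤ θ).map (Int.castRingHom ℂ)).IsRoot (φ θ) := by
      have h1 := map_aeval_int φ θ (minpoly ℤ θ)
      rw [minpoly.aeval, map_zero] at h1
      rw [IsRoot, eval_map]
      exact h1.symm
    have h2 := norm_le_of_root (A := N) hmon.ne_zero hroot fun i => by
      rw [hmon.leadingCoeff, norm_one, mul_one, coeff_map, eq_intCast, Complex.norm_intCast,
        h.minpoly_eq]
      exact_mod_cast abs_coeff_intPoly_le hs.abs_le i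
    push_cast
    linarith

variable {θ : K} {N : ℕ}

theorem IsBoundedGenerator.norm_aeval_le (h : IsBoundedGenerator θ N) {e : EltCode}
    (he : e.HeightLE N) (φ : K →+* ℂ) : ‖φ (aeval θ (intPoly e.1))‖ ≤ elementBound N := by
  rw [map_aeval_int]
  have h1 := _root_.norm_aeval_le ((natDegree_intPoly_le e.1).trans he.length_le)
    (abs_coeff_intPoly_le he.abs_le) (by omega) (h.norm_le φ)
  refine h1.trans ?_
  rw [elementBound]
  exact_mod_cast Nat.le_succ _

theorem IsBoundedGenerator.norm_eval_le (h : IsBoundedGenerator θ N) {e : EltCode}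
    (he : e.HeightLE N) (φ : K →+* ℂ) : ‖φ (e.eval θ)‖ ≤ elementBound N := by
  have h1 := h.norm_aeval_le he φ
  have h2 : ‖φ ((e.2 : K) + 1)‖ = (e.2 : ℝ) + 1 := by
    rw [map_add, map_natCast, map_one]
    exact_mod_cast Complex.norm_natCast (e.2 + 1)
  rw [EltCode.eval, map_div₀, norm_div, h2]
  exact (div_le_self (norm_nonneg _) (by linarith [Nat.cast_nonneg (α := ℝ) e.2])).trans h1

theorem EltCode.den_ne_zero (e : EltCode) : (e.2 : K) + 1 ≠ 0 := by
  exact_mod_cast Nat.succ_ne_zero e.2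

theorem IsBoundedGenerator.isIntegral_factorial_mul_eval (h : IsBoundedGenerator θ N) {e : EltCode}
    (he : e.HeightLE N) : IsIntegral ℤ (((N + 1).factorial : K) * e.eval θ) := by
  obtain ⟨c, hc⟩ := Nat.dvd_factorial (Nat.succ_pos e.2) (Nat.succ_le_succ he.den_le)
  have h1 : ((N + 1).factorial : K) * e.eval θ = (c : K) * aeval θ (intPoly e.1) := by
    have h2 := EltCode.den_ne_zero (K := K) e
    rw [hc, EltCode.eval]
    push_cast
    field_simp
  rw [h1]
  exact (isIntegral_natCast (R := ℤ) c).mul (h.integral.aeval_int _)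

variable [NumberField K]

theorem IsBoundedGenerator.exists_cofactor (h : IsBoundedGenerator θ N) {e : EltCode}
    (he : e.HeightLE N) (he0 : e.eval θ ≠ 0) :
    ∃ (n : ℤ) (v : K), n ≠ 0 ∧ |n| ≤ ((2 * elementBound N) ^ N : ℕ) ∧ IsIntegral ℤ v ∧
      aeval θ (intPoly e.1) * v = n ∧ ∀ φ : K →+* ℂ, ‖φ v‖ ≤ cofactorBound N := by
  have hint := h.integral.aeval_int (intPoly e.1)
  obtain ⟨n, q, hn0, hn, hq, hφ⟩ := exists_int_multiple hint (EltCode.aeval_ne_zero he0)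
    (C := elementBound N) (D := N) (Nat.succ_pos _) ((minpoly.natDegree_le _).trans h.finrank_le)
    (h.norm_aeval_le he)
  exact ⟨n, _, hn0, hn, hint.aeval_int q, hq, hφ⟩

end ElementBounds

/-! ### Good reduction at large primes -/

section GoodReduction

open IntermediateField

/-- An element of a field of characteristic zero that is a unit above the prime `p`. -/
def IsPrimeUnit (p : ℕ) {X : Type*} [Field X] (w : X) : Prop :=
  ∃ n : ℕ, ¬ p ∣ n ∧ IsIntegral ℤ ((n : X) * w) ∧ IsIntegral ℤ ((n : X) * w⁻¹)

theorem IsPrimeUnit.one {p : ℕ} (hp : p.Prime) {X : Type*} [Field X] : IsPrimeUnit p (1 : X) :=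
  ⟨1, hp.not_dvd_one, by simpa using isIntegral_one, by simpa using isIntegral_one⟩

theorem IsPrimeUnit.inv {p : ℕ} {X : Type*} [Field X] {w : X} (h : IsPrimeUnit p w) :
    IsPrimeUnit p w⁻¹ := by
  obtain ⟨n, hn, h1, h2⟩ := h
  exact ⟨n, hn, h2, by rwa [inv_inv]⟩

theorem IsPrimeUnit.mul {p : ℕ} (hp : p.Prime) {X : Type*} [Field X] {v w : X}
    (hv : IsPrimeUnit p v) (hw : IsPrimeUnit p w) : IsPrimeUnit p (v * w) := by
  obtain ⟨m, hm, h1, h2⟩ := hv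
  obtain ⟨n, hn, h3, h4⟩ := hw
  refine ⟨m * n, fun h => (hp.dvd_mul.mp h).elim hm hn, ?_, ?_⟩
  · rw [Nat.cast_mul, mul_mul_mul_comm]; exact h1.mul h3
  · rw [Nat.cast_mul, mul_inv, mul_mul_mul_comm]; exact h2.mul h4

theorem IsPrimeUnit.map {p : ℕ} {X Y : Type*} [Field X] [Field Y] (f : X →+* Y) {w : X}
    (h : IsPrimeUnit p w) : IsPrimeUnit p (f w) := by
  obtain ⟨n, hn, h1, h2⟩ := h
  refine ⟨n, hn, ?_, ?_⟩
  · have := h1.map f.toIntAlgHom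
    rwa [RingHom.toIntAlgHom_apply, map_mul, map_natCast] at this
  · have := h2.map f.toIntAlgHom
    rwa [RingHom.toIntAlgHom_apply, map_mul, map_natCast, map_inv₀] at this

theorem Int.not_dvd_of_abs_lt {p : ℕ} {n : ℤ} (hn : n ≠ 0) (h : |n| < p) : ¬ (p : ℤ) ∣ n :=
  fun hd => absurd (Int.le_of_dvd (abs_pos.mpr hn) ((dvd_abs _ _).mpr hd)) (not_le.mpr h)

/-- Above this bound all primes have good reduction. -/
def reductionBound (N : ℕ) : ℕ :=
  separableBound (N + 2) N + (2 * elementBound N) ^ N + (N + 1)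

theorem mem_subfield_of_mem_adjoin {K L : Type*} [Field K] [Field L] [Algebra K L] {U : Subfield L}
    (hK : ∀ x : K, algebraMap K L x ∈ U) {S : Set L} (hS : ∀ x ∈ S, x ∈ U) {x : L}
    (hx : x ∈ adjoin K S) : x ∈ U := by
  induction hx using adjoin_induction with
  | mem x hx => exact hS x hx
  | algebraMap x => exact hK x
  | add x y _ _ hx hy => exact add_mem hx hy
  | inv x _ hx => exact inv_mem hx
  | mul x y _ _ hx hy => exact mul_mem hx hy

variable {K : Type u} [Field K] [NumberField K] {θ : K} {N : ℕ}

/-- The numerator divides a nonzero integer smaller than p, and the denominator is a positive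
integer smaller than p. -/
theorem IsBoundedGenerator.isPrimeUnit_eval (h : IsBoundedGenerator θ N) {e : EltCode}
    (he : e.HeightLE N) (he0 : e.eval θ ≠ 0) {p : ℕ} (hp : p.Prime) (hpN : reductionBound N < p) :
    IsPrimeUnit p (e.eval θ) := by
  obtain ⟨n, v, hn0, hn, hvint, hv, -⟩ := h.exists_cofactor he he0
  have hy0 := EltCode.aeval_ne_zero he0
  have hd0 := EltCode.den_ne_zero (K := K) e
  have hpd : ¬ p ∣ e.2 + 1 := fun hd => by
    have := Nat.le_of_dvd (Nat.succ_pos _) hd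
    have := he.den_le
    rw [reductionBound] at hpN
    omega
  have hpn : ¬ p ∣ n.natAbs := fun hd => by
    refine Int.not_dvd_of_abs_lt hn0 (hn.trans_lt ?_) (Int.natCast_dvd.mpr hd)
    rw [reductionBound] at hpN
    exact_mod_cast (by omega : (2 * elementBound N) ^ N < p)
  have hnK : (n : K) ≠ 0 := by exact_mod_cast hn0
  have habs : ((n.natAbs : ℕ) : K) = n ∨ ((n.natAbs : ℕ) : K) = -n := by
    rcases Int.natAbs_eq n with h1 | h1
    · left; conv_rhs => rw [h1]
      exact (Int.cast_natCast _).symm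
    · right; conv_rhs => rw [h1]
      rw [Int.cast_neg, neg_neg, Int.cast_natCast]
  have hinv : ((n.natAbs : ℕ) : K) * (aeval θ (intPoly e.1))⁻¹ = v ∨
      ((n.natAbs : ℕ) : K) * (aeval θ (intPoly e.1))⁻¹ = -v := by
    rcases habs with h1 | h1
    · left; rw [h1, ← hv]; field_simp
    · right; rw [h1, ← hv]; field_simp
  refine ⟨(e.2 + 1) * n.natAbs, fun hd => (hp.dvd_mul.mp hd).elim hpd hpn, ?_, ?_⟩
  · have h1 : (((e.2 + 1) * n.natAbs : ℕ) : K) * e.eval θ =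
        (n.natAbs : K) * aeval θ (intPoly e.1) := by
      rw [EltCode.eval]; push_cast; field_simp
    rw [h1]
    exact (isIntegral_natCast (R := ℤ) _).mul (h.integral.aeval_int _)
  · have h1 : (((e.2 + 1) * n.natAbs : ℕ) : K) * (e.eval θ)⁻¹ =
        ((e.2 + 1 : ℕ) : K) ^ 2 * ((n.natAbs : ℕ) * (aeval θ (intPoly e.1))⁻¹) := by
      rw [EltCode.eval]; push_cast; field_simp
    rw [h1]
    refine ((isIntegral_natCast (R := ℤ) _).pow 2).mul ?_
    rcases hinv with h2 | h2 <;> rw [h2]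
    · exact hvint
    · exact hvint.neg

variable {L : Type v} [Field L] [Algebra K L]

theorem IsBoundedGenerator.algebraMap_mem (h : IsBoundedGenerator θ N) {p : ℕ} [Fact p.Prime]
    (hpN : reductionBound N < p) {U : Subfield L} (hU : IsUnramifiedSubfield p U) (x : K) :
    algebraMap K L x ∈ U := by
  have : CharZero L := charZero_of_injective_algebraMap (algebraMap K L).injective
  obtain ⟨f, g, n, hn0, hn, hfg⟩ := exists_separable_combination h.integral (C := N + 2) (D := N)
    (by omega) ((minpoly.natDegree_le θ).trans h.finrank_le) h.norm_le
  have hθ : algebraMap K L θ ∈ U := by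
    refine hU.integral_mem _ (h.integral.map (algebraMap K L).toIntAlgHom) f g n
      (Int.not_dvd_of_abs_lt hn0 (hn.trans_lt ?_)) ?_
    · rw [reductionBound] at hpN
      exact_mod_cast (by omega : separableBound (N + 2) N < p)
    · rw [minpoly.algebraMap_eq (algebraMap K L).injective]; exact hfg
  have hx : x ∈ adjoin ℚ {θ} := h.generates ▸ mem_top
  refine mem_subfield_of_mem_adjoin (U := U.comap (algebraMap K L)) (fun q => ?_) ?_ hx
  · rw [Subfield.mem_comap, eq_ratCast, map_ratCast]
    exact SubfieldClass.ratCast_mem U q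
  · rintro _ rfl
    exact hθ

/-- All elements of the group are units above p because the generators are, and roots of such units
of order prime to p are unramified. -/
theorem IsBoundedGenerator.mem_of_mem_cyclotomicKummer (h : IsBoundedGenerator θ N)
    {s : List EltCode} (hs : ∀ e ∈ s, e.HeightLE N) (hs0 : ∀ e ∈ s, e.eval θ ≠ 0) {p : ℕ}
    [hp : Fact p.Prime] (hpN : reductionBound N < p) {U : Subfield L}
    (hU : IsUnramifiedSubfield p U) {t : ℕ} (ht : ¬ p ∣ t) {x : L}
    (hx : x ∈ cyclotomicKummer L
      (Subgroup.closure {u : Kˣ | ∃ e ∈ s, (u : K) = e.eval θ}) t) : x ∈ U := by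
  have hunit : ∀ u ∈ Subgroup.closure {u : Kˣ | ∃ e ∈ s, (u : K) = e.eval θ},
      IsPrimeUnit p (u : K) := by
    intro u hu
    induction hu using Subgroup.closure_induction with
    | mem u hu =>
      obtain ⟨e, he, h1⟩ := hu
      rw [h1]
      exact h.isPrimeUnit_eval (hs e he) (hs0 e he) hp.out hpN
    | one => exact IsPrimeUnit.one hp.out
    | mul x y _ _ hx hy => rw [Units.val_mul]; exact hx.mul hp.out hy
    | inv x _ hx => rw [Units.val_inv_eq_inv_val]; exact hx.inv
  have hrad : ∀ (w x : L), w ∈ U → w ≠ 0 → IsPrimeUnit p w → x ^ t = w → x ∈ U := by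
    rintro w x hw hw0 ⟨n, hn, h1, h2⟩ hxw
    exact hU.radical_mem w x t n hw hn ht h1 h2 hw0 hxw
  refine mem_subfield_of_mem_adjoin (h.algebraMap_mem hpN hU) ?_ hx
  rintro x (hx | ⟨w, hw, hx⟩)
  · exact hrad 1 x (one_mem U) one_ne_zero (IsPrimeUnit.one hp.out) hx
  · exact hrad _ x (h.algebraMap_mem hpN hU w) ((_root_.map_ne_zero _).mpr w.ne_zero)
      ((hunit w hw).map (algebraMap K L)) hx

/-- Good reduction outside all numbers divisible by the small primes. -/
theorem GroupCode.Describes.hasGoodReduction [IsAlgClosure K L] {s : GroupCode} {W : Subgroup Kˣ}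
    (hW : s.Describes θ W) (hs : s.HeightLE N) {z : ℕ}
    (hz : ∀ p : ℕ, p.Prime → ¬ p ∣ z → reductionBound N < p) : HasGoodReduction L W z := by
  intro p hp hpz
  have : CharZero L := charZero_of_injective_algebraMap (algebraMap K L).injective
  have : Algebra.IsAlgebraic ℚ L := Algebra.IsAlgebraic.trans ℚ K L
  obtain ⟨U, hU⟩ := exists_isUnramifiedSubfield p L
  refine ⟨U, hU, fun t _ hpt x hx => ?_⟩
  rw [hW.closure_eq] at hx
  exact (hW.isBoundedGenerator hs).mem_of_mem_cyclotomicKummer hs.gens_le hW.gens_ne_zero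
    (hz p hp.out hpz) hU hpt hx

/-- A bound for the exponent of the saturation of a group modulo the group. -/
def saturationBound (N : ℕ) : ℕ :=
  (2 * (N * (((N + 1).factorial * elementBound N) ^ N * (N + 2) ^ N)) + 1) ^ N

theorem GroupCode.Describes.pow_mem {s : GroupCode} {W : Subgroup Kˣ}
    (hW : s.Describes θ W) (hs : s.HeightLE N) {h : Kˣ} {n : ℕ} (hn : 0 < n) (hh : h ^ n ∈ W) :
    h ^ (saturationBound N).factorial ∈ W := by
  have hb := hW.isBoundedGenerator hs
  let w : Fin s.2.length → Kˣ := fun i =>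
    Units.mk0 (EltCode.eval θ (s.2.get i)) (hW.gens_ne_zero _ (s.2.get_mem i))
  have hrange : {u : Kˣ | ∃ e ∈ s.2, (u : K) = EltCode.eval θ e} = Set.range w := by
    ext u
    constructor
    · rintro ⟨e, he, hu⟩
      obtain ⟨i, rfl⟩ := List.get_of_mem he
      exact ⟨i, Units.ext hu.symm⟩
    · rintro ⟨i, rfl⟩
      exact ⟨_, s.2.get_mem i, rfl⟩
  have hWw : W = Subgroup.closure (Set.range w) := by rw [hW.closure_eq, hrange]
  have hY : 1 ≤ elementBound N := Nat.succ_pos _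
  rw [hWw] at hh ⊢
  refine pow_factorial_mem_of_pow_mem w (Nat.factorial_pos (N + 1)) hY
    (fun i => hb.isIntegral_factorial_mul_eval (hs.gens_le _ (s.2.get_mem i)))
    (fun i φ => hb.norm_eval_le (hs.gens_le _ (s.2.get_mem i)) φ) hb.generates hb.integral
    (R := N + 2) (by omega) hb.norm_le hb.finrank_le ?_ hn hh
  rw [Fintype.card_fin, saturationBound]
  have := Nat.pow_le_pow_right (Nat.mul_pos (Nat.factorial_pos (N + 1)) hY) hs.length_gens_le
  gcongr

end GoodReduction

/-! ### Bounds for the roots of polynomials described by codes of bounded height -/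

section RootBounds

open IntermediateField

/-- A bound for the conjugates of the roots of coded polynomials of height at most `N`. -/
def rootBound (N : ℕ) : ℕ := elementBound N * (cofactorBound N * (N + 1)) + 1

/-- A bound for the conjugates of integral multiples of the roots of coded polynomials. -/
def integralRootBound (N : ℕ) : ℕ :=
  (N + 1).factorial * (2 * elementBound N) ^ N * rootBound N

theorem isIntegral_leadingCoeff_mul {K L : Type*} [Field K] [Field L] [Algebra K L] {P : K[X]}
    (hP : ∀ i, IsIntegral ℤ (P.coeff i)) {ρ : L} (hρ : aeval ρ P = 0) :
    IsIntegral ℤ (algebraMap K L P.leadingCoeff * ρ) := by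
  have hlift : P ∈ lifts (algebraMap (integralClosure ℤ K) K) :=
    (lifts_iff_coeff_lifts P).mpr fun i => ⟨⟨P.coeff i, hP i⟩, rfl⟩
  obtain ⟨Q, rfl⟩ := (mem_lifts P).mp hlift
  rw [leadingCoeff_map_of_injective (FaithfulSMul.algebraMap_injective _ _),
    ← IsScalarTower.algebraMap_apply, ← Algebra.smul_def]
  rw [aeval_map_algebraMap] at hρ
  exact isIntegral_trans _ (isIntegral_leadingCoeff_smul Q ρ hρ)

theorem natDegree_minpoly_rat_le {K L : Type*} [Field K] [NumberField K] [Field L] [CharZero L]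
    [Algebra K L] {ρ : L} (hρ : IsIntegral K ρ) :
    (minpoly ℚ ρ).natDegree ≤ Module.finrank ℚ K * (minpoly K ρ).natDegree := by
  have : FiniteDimensional K (adjoin K {ρ}) := adjoin.finiteDimensional hρ
  have : FiniteDimensional ℚ (adjoin K {ρ}) := FiniteDimensional.trans ℚ K _
  rw [← adjoin.finrank hρ, Module.finrank_mul_finrank]
  have h := minpoly.natDegree_le (A := ℚ) (AdjoinSimple.gen K ρ)
  rwa [← minpoly.algebraMap_eq (algebraMap (adjoin K {ρ}) L).injective,
    AdjoinSimple.algebraMap_gen] at h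

theorem natDegree_codedPoly_le {K : Type*} [Field K] (θ : K) (l : List EltCode) :
    (codedPoly θ l).natDegree ≤ l.length :=
  natDegree_foldr_le (EltCode.eval θ) l

theorem coeff_codedPoly_eq {K : Type*} [Field K] (θ : K) (l : List EltCode) (i : ℕ) :
    (codedPoly θ l).coeff i = 0 ∨ ∃ e ∈ l, (codedPoly θ l).coeff i = e.eval θ :=
  coeff_foldr_eq (EltCode.eval θ) l i

theorem natDegree_minpoly_le_of_mem_rootSet {K L : Type*} [Field K] [Field L] [Algebra K L] {θ : K}
    {l : List EltCode} {ρ : L} (hρ : ρ ∈ (codedPoly θ l).rootSet L) :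
    (minpoly K ρ).natDegree ≤ l.length := by
  rw [mem_rootSet] at hρ
  exact (natDegree_le_of_dvd (minpoly.dvd K ρ hρ.2) hρ.1).trans (natDegree_codedPoly_le θ l)

variable {K : Type u} [Field K] [NumberField K] {θ : K} {N : ℕ}
variable {L : Type v} [Field L] [Algebra K L]

/-- The factor (N+1)! clears the denominators of the coefficients, so (N+1)! times the leading
coefficient makes ρ integral; a bounded integer n divisible by the leading coefficient then replaces
it. -/
theorem IsBoundedGenerator.exists_isIntegral_mul (h : IsBoundedGenerator θ N) {l : List EltCode}
    (hl : ∀ e ∈ l, e.HeightLE N) {ρ : L} (hρ : ρ ∈ (codedPoly θ l).rootSet L) :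
    ∃ m : ℤ, m ≠ 0 ∧ IsIntegral ℤ ((m : L) * ρ) ∧
      ∀ φ : L →+* ℂ, ‖φ ((m : L) * ρ)‖ ≤ integralRootBound N := by
  obtain ⟨hP0, hroot⟩ := mem_rootSet.mp hρ
  set P := codedPoly θ l with hP
  have hlc0 : P.leadingCoeff ≠ 0 := leadingCoeff_ne_zero.mpr hP0
  obtain ⟨e, he, hlc⟩ := (coeff_codedPoly_eq θ l P.natDegree).resolve_left hlc0
  have hlc : P.leadingCoeff = e.eval θ := hlc
  have he0 : e.eval θ ≠ 0 := hlc ▸ hlc0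
  obtain ⟨n, v, hn0, hn, hvint, hv, hvφ⟩ := h.exists_cofactor (hl e he) he0
  have hd0 := EltCode.den_ne_zero (K := K) e
  have hlcv : e.eval θ * ((e.2 + 1) * v) = n := by
    rw [EltCode.eval, ← hv]; field_simp
  have hf0 : ((N + 1).factorial : ℤ) ≠ 0 := by exact_mod_cast Nat.factorial_ne_zero _
  refine ⟨(N + 1).factorial * n, mul_ne_zero hf0 hn0, ?_, fun φ => ?_⟩
  · have hf0' : ((N + 1).factorial : K) ≠ 0 := by exact_mod_cast Nat.factorial_ne_zero _
    have h1 : IsIntegral ℤ (algebraMap K L (C ((N + 1).factorial : K) * P).leadingCoeff * ρ) := by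
      refine isIntegral_leadingCoeff_mul (fun i => ?_) (by rw [map_mul, hroot, mul_zero])
      rw [coeff_C_mul]
      rcases coeff_codedPoly_eq θ l i with h2 | ⟨e', he', h2⟩
      · rw [h2, mul_zero]; exact isIntegral_zero
      · rw [h2]; exact h.isIntegral_factorial_mul_eval (hl e' he')
    rw [leadingCoeff_mul, leadingCoeff_C, hlc] at h1
    have h2 : IsIntegral ℤ (algebraMap K L ((e.2 + 1) * v)) := by
      refine IsIntegral.map (algebraMap K L).toIntAlgHom (IsIntegral.mul ?_ hvint)
      exact (isIntegral_natCast (R := ℤ) e.2).add isIntegral_one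
    have h3 : ((((N + 1).factorial : ℤ) * n : ℤ) : L) * ρ =
        algebraMap K L (((N + 1).factorial : K) * e.eval θ) * ρ *
          algebraMap K L ((e.2 + 1) * v) := by
      have h4 : algebraMap K L (e.eval θ) * algebraMap K L ((e.2 + 1) * v) = n := by
        rw [← map_mul, hlcv, map_intCast]
      rw [map_mul, map_natCast, mul_right_comm, mul_assoc _ (algebraMap K L (e.eval θ)), h4]
      push_cast
      rfl
    rw [h3]
    exact h1.mul h2
  · set ψ : K →+* ℂ := φ.comp (algebraMap K L) with hψ
    have hq0 : P.map ψ ≠ 0 := (Polynomial.map_ne_zero_iff ψ.injective).mpr hP0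
    have hqroot : (P.map ψ).IsRoot (φ ρ) := by
      rw [IsRoot, eval_map, hψ, ← hom_eval₂, ← aeval_def, hroot, map_zero]
    have hn1 : (1 : ℝ) ≤ ‖(n : ℂ)‖ := by
      rw [Complex.norm_intCast]; exact_mod_cast Int.one_le_abs hn0
    -- The leading coefficient times a bounded cofactor is a nonzero integer, so it cannot be small.
    -- This makes Cauchy's root bound effective.
    have hlow : (1 : ℝ) ≤ ‖ψ (e.eval θ)‖ * (cofactorBound N * (N + 1)) := by
      have h1 : ‖ψ (e.eval θ)‖ * (((e.2 : ℝ) + 1) * ‖ψ v‖) = ‖(n : ℂ)‖ := by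
        have h2 := congrArg (fun x => ‖ψ x‖) hlcv
        have h3 : ‖ψ ((e.2 : K) + 1)‖ = (e.2 : ℝ) + 1 := by
          rw [map_add, map_natCast, map_one]
          exact_mod_cast Complex.norm_natCast (e.2 + 1)
        simp only [map_mul, norm_mul, h3, map_intCast] at h2
        exact h2
      have h4 : (e.2 : ℝ) ≤ N := by exact_mod_cast (hl e he).den_le
      refine hn1.trans (h1 ▸ mul_le_mul_of_nonneg_left ?_ (norm_nonneg _))
      rw [mul_comm]
      exact mul_le_mul (hvφ ψ) (by linarith) (by positivity) (by positivity)
    have hρφ : ‖φ ρ‖ ≤ rootBound N := by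
      have h1 := norm_le_of_root (A := elementBound N * (cofactorBound N * (N + 1))) hq0 hqroot
        fun i => by
          rw [leadingCoeff_map, hlc, coeff_map, mul_assoc, mul_comm _ ‖ψ _‖]
          refine le_trans ?_ (le_mul_of_one_le_right (Nat.cast_nonneg _) hlow)
          rcases coeff_codedPoly_eq θ l i with h2 | ⟨e', he', h2⟩
          · rw [h2, map_zero, norm_zero]; exact Nat.cast_nonneg _
          · rw [h2]; exact h.norm_eval_le (hl e' he') ψ
      rw [rootBound]
      push_cast
      exact h1
    have hnR : ‖(n : ℂ)‖ ≤ ((2 * elementBound N) ^ N : ℕ) := by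
      rw [Complex.norm_intCast]; exact_mod_cast hn
    have h5 : ‖φ (((((N + 1).factorial : ℤ) * n : ℤ) : L) * ρ)‖ =
        (N + 1).factorial * ‖(n : ℂ)‖ * ‖φ ρ‖ := by
      rw [map_mul, norm_mul, map_intCast, Int.cast_mul, norm_mul, Int.cast_natCast,
        Complex.norm_natCast]
    rw [h5, integralRootBound, Nat.cast_mul, Nat.cast_mul]
    gcongr

/-- The roots of coded polynomials are unramified above large primes. -/
theorem IsBoundedGenerator.mem_of_mem_rootSet [IsAlgClosure K L] (h : IsBoundedGenerator θ N)
    {l : List EltCode} (hl : ∀ e ∈ l, e.HeightLE N) (hlN : l.length ≤ N) {ρ : L}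
    (hρ : ρ ∈ (codedPoly θ l).rootSet L) {p : ℕ} [Fact p.Prime]
    (hp : separableBound (integralRootBound N) (N * N) < p) {U : Subfield L}
    (hU : IsUnramifiedSubfield p U) : ρ ∈ U := by
  have : CharZero L := charZero_of_injective_algebraMap (algebraMap K L).injective
  have : Algebra.IsAlgebraic ℚ L := Algebra.IsAlgebraic.trans ℚ K L
  obtain ⟨m, hm0, hint, hφ⟩ := h.exists_isIntegral_mul hl hρ
  have hmL : (m : L) ≠ 0 := by exact_mod_cast hm0
  have hdeg : (minpoly ℚ ((m : L) * ρ)).natDegree ≤ N * N := by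
    have h1 : IsIntegral ℚ ρ := Algebra.IsIntegral.isIntegral ρ
    have h2 : (minpoly ℚ ((m : L) * ρ)).natDegree = (minpoly ℚ ρ).natDegree := by
      have h3 : adjoin ℚ {(m : L) * ρ} = adjoin ℚ {ρ} := by
        have hmem : ∀ k : IntermediateField ℚ L, (m : L) ∈ k := fun k => intCast_mem k m
        refine le_antisymm (adjoin_simple_le_iff.mpr (mul_mem (hmem _) (mem_adjoin_simple_self ℚ ρ)))
          (adjoin_simple_le_iff.mpr ?_)
        have h4 := mul_mem (inv_mem (hmem (adjoin ℚ {(m : L) * ρ})))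
          (mem_adjoin_simple_self ℚ ((m : L) * ρ))
        rwa [inv_mul_cancel_left₀ hmL] at h4
      rw [← adjoin.finrank (Algebra.IsIntegral.isIntegral _), h3, adjoin.finrank h1]
    rw [h2]
    refine (natDegree_minpoly_rat_le (K := K) (Algebra.IsIntegral.isIntegral ρ)).trans ?_
    exact Nat.mul_le_mul h.finrank_le ((natDegree_minpoly_le_of_mem_rootSet hρ).trans hlN)
  have hC : 1 ≤ integralRootBound N :=
    Nat.mul_pos (Nat.mul_pos (Nat.factorial_pos _) (Nat.pow_pos (by rw [elementBound]; omega)))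
      (Nat.succ_pos _)
  obtain ⟨f, g, n, hn0, hn, hfg⟩ := exists_separable_combination hint hC hdeg hφ
  have h1 : (m : L) * ρ ∈ U := hU.integral_mem _ hint f g n
    (Int.not_dvd_of_abs_lt hn0 (hn.trans_lt (by exact_mod_cast hp))) hfg
  have h2 := mul_mem (inv_mem (intCast_mem U m)) h1
  rwa [inv_mul_cancel_left₀ hmL] at h2

end RootBounds

/-! ### The bounds are computable -/

section Computability

theorem Primrec.nat_pow : Primrec₂ ((· ^ ·) : ℕ → ℕ → ℕ) := by
  have h : Primrec₂ fun a b : ℕ => Nat.rec (motive := fun _ => ℕ) 1 (fun _ IH => IH * a) b :=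
    Primrec.nat_rec (Primrec.const 1)
      (Primrec.nat_mul.comp (Primrec.snd.comp Primrec.snd) Primrec.fst).to₂
  refine h.of_eq fun a b => ?_
  induction b with
  | zero => rfl
  | succ b ih => rw [pow_succ, ← ih]

theorem Primrec.nat_factorial : Primrec Nat.factorial := by
  have h : Primrec (Nat.rec (motive := fun _ => ℕ) 1 fun n IH => (n + 1) * IH) :=
    Primrec.nat_rec₁ 1 (Primrec.nat_mul.comp (Primrec.succ.comp Primrec.fst) Primrec.snd).to₂
  refine h.of_eq fun n => ?_
  induction n with
  | zero => rfl
  | succ n ih => rw [Nat.factorial_succ, ← ih]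

section

open Primrec

theorem Primrec.add' {α : Type*} [Primcodable α] {f g : α → ℕ} (hf : Primrec f) (hg : Primrec g) :
    Primrec fun a => f a + g a := nat_add.comp hf hg

theorem Primrec.mul' {α : Type*} [Primcodable α] {f g : α → ℕ} (hf : Primrec f) (hg : Primrec g) :
    Primrec fun a => f a * g a := nat_mul.comp hf hg

theorem Primrec.pow' {α : Type*} [Primcodable α] {f g : α → ℕ} (hf : Primrec f) (hg : Primrec g) :
    Primrec fun a => f a ^ g a := nat_pow.comp hf hg

theorem Primrec.factorial' {α : Type*} [Primcodable α] {f : α → ℕ} (hf : Primrec f) :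
    Primrec fun a => (f a).factorial := nat_factorial.comp hf

theorem primrec_elementBound : Primrec elementBound :=
  add' (mul' (mul' (add' .id (.const 1)) .id) (pow' (add' .id (.const 2)) .id)) (.const 1)

theorem primrec_cofactorBound : Primrec cofactorBound :=
  mul' (mul' (add' .id (.const 1)) (pow' (mul' (.const 2) primrec_elementBound) .id))
    (pow' primrec_elementBound .id)

theorem primrec_separableBound {α : Type*} [Primcodable α] {f g : α → ℕ} (hf : Primrec f)
    (hg : Primrec g) : Primrec fun a => separableBound (f a) (g a) :=
  pow' (mul' (.const 2) (add' (mul' (mul' (add' hg (.const 1)) (mul' hg (pow' (mul' (.const 2) hf)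
    hg))) (pow' hf hg)) (.const 1))) hg

theorem primrec_reductionBound : Primrec reductionBound :=
  add' (add' (primrec_separableBound (add' .id (.const 2)) .id)
    (pow' (mul' (.const 2) primrec_elementBound) .id)) (add' .id (.const 1))

theorem primrec_saturationBound : Primrec saturationBound :=
  pow' (add' (mul' (.const 2) (mul' .id (mul' (pow' (mul' (factorial' (add' .id (.const 1)))
    primrec_elementBound) .id) (pow' (add' .id (.const 2)) .id)))) (.const 1)) .id

theorem primrec_rootBound : Primrec rootBound :=
  add' (mul' primrec_elementBound (mul' primrec_cofactorBound (add' .id (.const 1)))) (.const 1)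

theorem primrec_integralRootBound : Primrec integralRootBound :=
  mul' (mul' (factorial' (add' .id (.const 1))) (pow' (mul' (.const 2) primrec_elementBound) .id))
    primrec_rootBound

/-- A bound for all exponents and bad primes of data of height at most `N`. -/
def levelBound (N : ℕ) : ℕ :=
  2 ^ N.factorial * 3 ^ N.factorial * (saturationBound N).factorial + reductionBound N +
    separableBound (integralRootBound N) (N * N) + N

/-- A level that is divisible by all exponents and bad primes of data of height at most `N`. -/
def kummerLevel (N : ℕ) : ℕ := (levelBound N).factorial

theorem primrec_kummerLevel : Primrec kummerLevel :=
  factorial' (add' (add' (add' (mul' (mul' (pow' (.const 2) (factorial' .id))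
    (pow' (.const 3) (factorial' .id))) (factorial' primrec_saturationBound))
    primrec_reductionBound) (primrec_separableBound primrec_integralRootBound (mul' .id .id))) .id)

/-- A code for the polynomial `e * X ^ (n + 1) - 1`. -/
def radicalCode (n : ℕ) (e : EltCode) : List EltCode :=
  ([-1], 0) :: (((List.range n).map fun _ => ([], 0)) ++ [e])

/-- A code for the extension generated by the `n + 1`-st roots of unity and of the inverses of the
listed elements. -/
def kummerCode (n : ℕ) (s : List EltCode) : ExtCode :=
  (([1], 0) :: s).map (radicalCode n)

theorem primrec_radicalCode : Primrec₂ radicalCode := by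
  refine list_cons.comp (.const _) (list_append.comp
    (list_map (list_range.comp fst) (Primrec.const _).to₂) (list_cons.comp snd (.const _)))

theorem primrec_kummerCode : Primrec₂ kummerCode :=
  list_map (list_cons.comp (.const _) snd)
    (primrec_radicalCode.comp (fst.comp fst) snd).to₂

end

end Computability

/-! ### The extension described by a list of radicals -/

section KummerCode

variable {K : Type u} {L : Type v} [Field K] [Field L] [Algebra K L]

open IntermediateField

theorem codedPoly_cons (θ : K) (e : EltCode) (l : List EltCode) :
    codedPoly θ (e :: l) = C (e.eval θ) + X * codedPoly θ l := rfl

theorem codedPoly_radicalCode (θ : K) (n : ℕ) (e : EltCode) :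
    codedPoly θ (radicalCode n e) = C (e.eval θ) * X ^ (n + 1) - 1 := by
  have h0 : EltCode.eval θ ([], 0) = 0 := by simp [EltCode.eval, intPoly]
  have h1 : EltCode.eval θ ([-1], 0) = -1 := by simp [EltCode.eval, intPoly]
  have h2 : ∀ l : List ℕ, codedPoly θ ((l.map fun _ => ([], 0)) ++ [e]) =
      X ^ l.length * C (e.eval θ) := by
    intro l
    induction l with
    | nil => simp [codedPoly]
    | cons a l ih =>
      rw [List.map_cons, List.cons_append, codedPoly_cons, ih, h0, List.length_cons]
      simp only [map_zero]
      ring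
  rw [radicalCode, codedPoly_cons, h2, h1, List.length_range]
  simp only [map_neg, map_one]
  ring

theorem mem_rootSet_radicalCode {θ : K} {n : ℕ} {e : EltCode} {x : L}
    (hx : algebraMap K L (e.eval θ) * x ^ (n + 1) = 1) :
    x ∈ (codedPoly θ (radicalCode n e)).rootSet L := by
  rw [codedPoly_radicalCode, mem_rootSet]
  refine ⟨fun h => ?_, by simp [hx]⟩
  have := congrArg (fun p : K[X] => p.coeff 0) h
  simp at this

/-- Roots of generators enter through their inverses. A root of a product differs from a product of
chosen roots by a root of unity, which the code [1] supplies. -/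
theorem cyclotomicKummer_le_field_kummerCode [IsAlgClosed L] {θ : K} {n : ℕ} {s : List EltCode}
    (hs : ∀ e ∈ s, e.eval θ ≠ 0) :
    cyclotomicKummer L (Subgroup.closure {u : Kˣ | ∃ e ∈ s, (u : K) = e.eval θ}) (n + 1) ≤
      ExtCode.field L θ (kummerCode n s) := by
  set k := ExtCode.field L θ (kummerCode n s) with hk
  have hmem : ∀ e ∈ (([1], 0) :: s : List EltCode), ∀ x : L,
      algebraMap K L (e.eval θ) * x ^ (n + 1) = 1 → x ∈ k := fun e he x hx =>
    subset_adjoin K _ ⟨_, List.mem_map_of_mem he, mem_rootSet_radicalCode hx⟩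
  have hone : ∀ ζ : L, ζ ^ (n + 1) = 1 → ζ ∈ k := fun ζ hζ =>
    hmem ([1], 0) List.mem_cons_self ζ (by simp [EltCode.eval, intPoly, hζ])
  refine adjoin_le_iff.mpr (Set.union_subset hone ?_)
  rintro x ⟨w, hw, hx⟩
  induction hw using Subgroup.closure_induction generalizing x with
  | mem w hw =>
    obtain ⟨e, he, h1⟩ := hw
    have h2 : x⁻¹ ∈ k := by
      refine hmem e (List.mem_cons_of_mem _ he) _ ?_
      rw [inv_pow, hx, h1, mul_inv_cancel₀ ((_root_.map_ne_zero _).mpr (hs e he))]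
    rw [← inv_inv x]
    exact inv_mem h2
  | one => exact hone x (by rw [hx, Units.val_one, map_one])
  | mul v w _ _ hv hw =>
    obtain ⟨α, hα⟩ := IsAlgClosed.exists_pow_nat_eq (algebraMap K L v) n.succ_pos
    obtain ⟨β, hβ⟩ := IsAlgClosed.exists_pow_nat_eq (algebraMap K L w) n.succ_pos
    have hα0 := ne_zero_of_pow_eq_unit n.succ_pos hα
    have hβ0 := ne_zero_of_pow_eq_unit n.succ_pos hβ
    have h1 : x = x * (α * β)⁻¹ * (α * β) := (inv_mul_cancel_right₀ (mul_ne_zero hα0 hβ0) x).symm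
    rw [h1]
    refine mul_mem (hone _ ?_) (mul_mem (hv hα) (hw hβ))
    rw [mul_pow, inv_pow, mul_pow, hα, hβ, hx, Units.val_mul, map_mul, mul_inv_cancel₀]
    exact mul_ne_zero ((_root_.map_ne_zero _).mpr v.ne_zero) ((_root_.map_ne_zero _).mpr w.ne_zero)
  | inv w _ hw =>
    rw [← inv_inv x]
    refine inv_mem (hw ?_)
    rw [inv_pow, hx, Units.val_inv_eq_inv_val, map_inv₀, inv_inv]

theorem ExtCode.finite_roots (θ : K) (E : ExtCode) :
    {x : L | ∃ l ∈ E, x ∈ (codedPoly θ l).rootSet L}.Finite := by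
  have h : {x : L | ∃ l ∈ E, x ∈ (codedPoly θ l).rootSet L} =
      ⋃ l ∈ {l | l ∈ E}, (codedPoly θ l).rootSet L := by
    ext x; simp
  rw [h]
  exact (List.finite_toSet E).biUnion fun l _ => rootSet_finite _ _

theorem ExtCode.finiteDimensional_field [Algebra.IsAlgebraic K L] (θ : K) (E : ExtCode) :
    FiniteDimensional K (ExtCode.field L θ E) := by
  have : Finite {x : L | ∃ l ∈ E, x ∈ (codedPoly θ l).rootSet L} := ExtCode.finite_roots θ E
  exact finiteDimensional_adjoin fun x _ => Algebra.IsIntegral.isIntegral x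

theorem ExtCode.isGalois_field [IsGalois K L] (θ : K) (E : ExtCode) :
    IsGalois K (ExtCode.field L θ E) := by
  have : Normal K (ExtCode.field L θ E) := by
    rw [normal_iff_forall_map_le]
    intro σ
    rw [ExtCode.field, adjoin_map, adjoin_le_iff]
    rintro _ ⟨x, ⟨l, hl, hx⟩, rfl⟩
    refine subset_adjoin K _ ⟨l, hl, ?_⟩
    rw [mem_rootSet] at hx ⊢
    exact ⟨hx.1, by rw [aeval_algHom_apply, hx.2, map_zero]⟩
  exact ⟨⟩

end KummerCode

/-! ### The constants -/

section Constants

/-- Coprimality sees only the prime divisors, so a constant may be replaced by its radical. -/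
theorem Nat.Coprime.of_prod_primeFactors {m N : ℕ} (hN : N ≠ 0)
    (h : m.Coprime (∏ p ∈ N.primeFactors, p)) : m.Coprime N := by
  by_contra hc
  obtain ⟨p, hp, hpm, hpN⟩ := Nat.Prime.not_coprime_iff_dvd.mp hc
  have h1 : p ∣ ∏ p ∈ N.primeFactors, p :=
    Finset.dvd_prod_of_mem _ (Nat.mem_primeFactors.mpr ⟨hp, hpN, hN⟩)
  exact hp.not_dvd_one (h.gcd_eq_one ▸ Nat.dvd_gcd hpm h1)

theorem kummerLevel_pos (N : ℕ) : 0 < kummerLevel N := Nat.factorial_pos _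

theorem dvd_kummerLevel {N i : ℕ} (hi : 0 < i) (h : i ≤ levelBound N) : i ∣ kummerLevel N :=
  Nat.dvd_factorial hi h

theorem levelBound_lt_of_not_dvd {N p : ℕ} (hp : 0 < p) (h : ¬ p ∣ kummerLevel N) :
    levelBound N < p := by
  by_contra! hle
  exact h (dvd_kummerLevel hp hle)

variable {K : Type u} [Field K] [NumberField K] {θ : K} {W : Subgroup Kˣ} {s : GroupCode} {N : ℕ}

theorem cyclotomicExponent_mul_dvd_kummerLevel (hK : Module.finrank ℚ K ≤ N) :
    cyclotomicExponent K * (saturationBound N).factorial ∣ kummerLevel N := by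
  refine dvd_kummerLevel (Nat.mul_pos cyclotomicExponent_pos (Nat.factorial_pos _)) ?_
  have h1 : cyclotomicExponent K ≤ 2 ^ N.factorial * 3 ^ N.factorial :=
    Nat.mul_le_mul
      ((Nat.sub_le _ _).trans (Nat.pow_le_pow_right (by norm_num) (Nat.factorial_le hK)))
      ((Nat.sub_le _ _).trans (Nat.pow_le_pow_right (by norm_num) (Nat.factorial_le hK)))
  have h2 := Nat.mul_le_mul_right (saturationBound N).factorial h1
  rw [levelBound]
  omega

variable (L : Type v) [Field L] [Algebra K L] [IsAlgClosure K L]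

theorem GroupCode.Describes.hasGoodReduction_kummerLevel (hW : s.Describes θ W)
    (hs : s.HeightLE N) : HasGoodReduction L W (kummerLevel N) :=
  hW.hasGoodReduction hs fun p hp h => by
    have := levelBound_lt_of_not_dvd hp.pos h
    rw [levelBound] at this
    omega

theorem GroupCode.Describes.fg (hW : s.Describes θ W) : W.FG := by
  rw [hW.closure_eq]
  refine (Subgroup.fg_iff _).mpr ⟨_, rfl, ?_⟩
  have h : Set.InjOn (fun u : Kˣ => (u : K)) {u : Kˣ | ∃ e ∈ s.2, (u : K) = EltCode.eval θ e} :=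
    fun u _ v _ huv => Units.ext huv
  refine Set.Finite.of_finite_image (Set.Finite.subset
    ((List.finite_toSet s.2).image (EltCode.eval θ)) ?_) h
  rintro _ ⟨u, ⟨e, he, hu⟩, rfl⟩
  exact ⟨e, he, hu.symm⟩

theorem GroupCode.Describes.exists_isRadicalBasis (hW : s.Describes θ W) (hs : s.HeightLE N) :
    ∃ a : Fin (groupRank W) → Kˣ, IsRadicalBasis L W a (kummerLevel N) := by
  have : CharZero L := charZero_of_injective_algebraMap (algebraMap K L).injective
  obtain ⟨a, ha⟩ := _root_.exists_isRadicalBasis L hW.fg fun h n hn hh => hW.pow_mem hs hn hh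
  exact ⟨a, ha _ (kummerLevel_pos N)
    (cyclotomicExponent_mul_dvd_kummerLevel (hW.isBoundedGenerator hs).finrank_le)⟩

theorem GroupCode.Describes.relfinrank_eq (hW : s.Describes θ W) (hs : s.HeightLE N) {t : ℕ}
    (ht : 0 < t) :
    IntermediateField.relfinrank (cyclotomicInftyKummer L W (kummerLevel N))
      (cyclotomicInftyKummer L W (kummerLevel N * t)) = t ^ groupRank W := by
  have : IsAlgClosed L := IsAlgClosure.isAlgClosed K
  obtain ⟨a, ha⟩ := hW.exists_isRadicalBasis L hs
  exact ha.relfinrank_cyclotomicInftyKummer ht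

theorem GroupCode.Describes.inf_le (hW : s.Describes θ W) (hs : s.HeightLE N) {m t : ℕ}
    (hm : 0 < m) (ht : 0 < t) (hmt : m.Coprime t) :
    cyclotomicKummer L W m ⊓ cyclotomicKummer L W t ≤
      ExtCode.field L θ (kummerCode (kummerLevel N ^ (2 * kummerLevel N + 3) - 1) s.2) := by
  have : IsAlgClosed L := IsAlgClosure.isAlgClosed K
  have : CharZero L := charZero_of_injective_algebraMap (algebraMap K L).injective
  obtain ⟨a, ha⟩ := hW.exists_isRadicalBasis L hs
  have hd : (Module.finrank ℚ K).factorial ∣ kummerLevel N := by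
    refine Nat.factorial_dvd_factorial ((hW.isBoundedGenerator hs).finrank_le.trans ?_)
    rw [levelBound]
    exact Nat.le_add_left _ _
  refine (ha.inf_le hd (hW.hasGoodReduction_kummerLevel L hs) hm ht hmt).trans ?_
  -- `kummerCode n` describes roots of order n + 1, hence the subtraction of one.
  have h := cyclotomicKummer_le_field_kummerCode (L := L)
    (n := kummerLevel N ^ (2 * kummerLevel N + 3) - 1) hW.gens_ne_zero
  rwa [Nat.sub_add_cancel (Nat.pow_pos (kummerLevel_pos N)), ← hW.closure_eq] at h

theorem GroupCode.Describes.isIndependenceConstant (hW : s.Describes θ W) (hs : s.HeightLE N)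
    {c : ℕ} (hc : ∀ m : ℕ, m.Coprime c → m.Coprime (kummerLevel N)) :
    IsIndependenceConstant L W c := by
  intro m t hm ht hmt hmc
  have : CharZero L := charZero_of_injective_algebraMap (algebraMap K L).injective
  obtain ⟨a, ha⟩ := hW.exists_isRadicalBasis L hs
  have hred := hW.hasGoodReduction_kummerLevel L hs
  exact ⟨ha.inf_eq_bot_of_coprime hred hm ht hmt (hc m hmc),
    ha.finrank_of_coprime hred hm (hc m hmc)⟩

/-- A number coprime to the level has only prime factors beyond `levelBound N`, hence beyond the
degrees of the roots that generate the extension and the primes where these roots might fail to be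
unramified. -/
theorem GroupCode.Describes.isDisjointnessConstant (hW : s.Describes θ W) (hs : s.HeightLE N)
    {E : ExtCode} (hE : Encodable.encode E ≤ N) {c : ℕ}
    (hc : ∀ m : ℕ, m.Coprime c → m.Coprime (kummerLevel N)) :
    IsDisjointnessConstant L W (ExtCode.field L θ E) c := by
  intro m hm hmc
  have hmN := hc m hmc
  have : CharZero L := charZero_of_injective_algebraMap (algebraMap K L).injective
  have : Algebra.IsAlgebraic ℚ L := Algebra.IsAlgebraic.trans ℚ K L
  obtain ⟨a, ha⟩ := hW.exists_isRadicalBasis L hs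
  have hgen := hW.isBoundedGenerator hs
  have hlen : ∀ l ∈ E, l.length ≤ N := fun l hl =>
    (Encodable.length_le_encode l).trans ((List.encode_le_encode_of_mem hl).trans hE)
  have hheight : ∀ l ∈ E, ∀ e ∈ l, EltCode.HeightLE e N := fun l hl e he =>
    EltCode.heightLE_of_encode_le ((List.encode_le_encode_of_mem he).trans
      ((List.encode_le_encode_of_mem hl).trans hE))
  refine ha.inf_adjoin_eq_bot (D := N) hm hmN (fun i hi hiN => ?_) (ExtCode.finite_roots θ E) ?_
    fun p hp hpm => ?_
  · refine hmN.coprime_dvd_right (dvd_kummerLevel hi (hiN.trans ?_))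
    rw [levelBound]
    exact Nat.le_add_left _ _
  · rintro ρ ⟨l, hl, hρ⟩
    exact (natDegree_minpoly_le_of_mem_rootSet hρ).trans (hlen l hl)
  · have hlt := levelBound_lt_of_not_dvd hp.out.pos fun h =>
      hp.out.not_dvd_one (hmN.gcd_eq_one ▸ Nat.dvd_gcd hpm h)
    rw [levelBound] at hlt
    obtain ⟨U, hU⟩ := exists_isUnramifiedSubfield p L
    refine ⟨U, hU, fun x hx =>
      mem_subfield_of_mem_adjoin (hgen.algebraMap_mem (by omega) hU) ?_ hx⟩
    rintro ρ ⟨l, hl, hρ⟩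
    exact hgen.mem_of_mem_rootSet (hheight l hl) (hlen l hl) hρ (by omega) hU

end Constants

/-! ### The algorithms and their correctness -/

theorem mainTheorem9 :
    ∃ (z : GroupCode →. ℕ) (k : GroupCode →. ExtCode) (c : GroupCode →. ℕ)
      (c' : GroupCode × ExtCode × ℕ →. ℕ),
      Partrec z ∧ Partrec k ∧ Partrec c ∧ Partrec c' ∧
      ∀ (K : Type u) (L : Type v) [Field K] [NumberField K] [Field L] [Algebra K L]
        [IsAlgClosure K L] (θ : K) (W : Subgroup Kˣ) (s : GroupCode),
        s.Describes θ W → 0 < groupRank W →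
        -- (i)
        (∃ Z ∈ z s, 0 < Z ∧ ∀ t : ℕ, 0 < t →
          IntermediateField.relfinrank (cyclotomicInftyKummer L W Z)
            (cyclotomicInftyKummer L W (Z * t)) = t ^ groupRank W) ∧
        -- (ii)
        (∃ E ∈ k s, FiniteDimensional K (ExtCode.field L θ E) ∧
          IsGalois K (ExtCode.field L θ E) ∧
          ∀ m t : ℕ, 0 < m → 0 < t → m.Coprime t →
            cyclotomicKummer L W m ⊓ cyclotomicKummer L W t ≤ ExtCode.field L θ E) ∧
        -- (iii)
        (∃ N ∈ c s, 0 < N ∧ IsIndependenceConstant L W N ∧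
          IsIndependenceConstant L W (∏ p ∈ N.primeFactors, p)) ∧
        -- (iii), with the additional requirements
        (∀ (F : IntermediateField K L) [FiniteDimensional K F] [IsGalois K F] (E : ExtCode) (d : ℕ),
          F = ExtCode.field L θ E → 0 < d →
          ∃ N ∈ c' (s, E, d), 0 < N ∧ d ∣ N ∧
            IsIndependenceConstant L W N ∧ IsDisjointnessConstant L W F N ∧
            IsIndependenceConstant L W (∏ p ∈ N.primeFactors, p) ∧
            IsDisjointnessConstant L W F (∏ p ∈ N.primeFactors, p)) := by
  -- All four algorithms are primitive recursive, hence total; the encoding of the input is used as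
  -- its height.
  have hlevel : Primrec fun s : GroupCode => kummerLevel (Encodable.encode s) :=
    primrec_kummerLevel.comp Primrec.encode
  have hcode : Primrec fun s : GroupCode =>
      kummerCode (kummerLevel (Encodable.encode s) ^
        (2 * kummerLevel (Encodable.encode s) + 3) - 1) s.2 :=
    primrec_kummerCode.comp (Primrec.nat_sub.comp (Primrec.pow' hlevel
      (Primrec.add' (Primrec.mul' (Primrec.const 2) hlevel) (Primrec.const 3))) (Primrec.const 1))
      Primrec.snd
  have hlevel' : Primrec fun x : GroupCode × ExtCode × ℕ =>
      x.2.2 * kummerLevel (Encodable.encode x) :=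
    Primrec.mul' (Primrec.snd.comp Primrec.snd) (primrec_kummerLevel.comp Primrec.encode)
  refine ⟨_, _, _, _, hlevel.to_comp.partrec, hcode.to_comp.partrec, hlevel.to_comp.partrec,
    hlevel'.to_comp.partrec, ?_⟩
  intro K L _ _ _ _ _ θ W s hW _
  have : CharZero L := charZero_of_injective_algebraMap (algebraMap K L).injective
  have hs := GroupCode.heightLE_of_encode_le (le_refl (Encodable.encode s))
  have hpos := kummerLevel_pos (Encodable.encode s)
  refine ⟨⟨_, Part.mem_some _, hpos, fun t ht => hW.relfinrank_eq L hs ht⟩,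
    ⟨_, Part.mem_some _, ExtCode.finiteDimensional_field θ _, ExtCode.isGalois_field θ _,
      fun m t hm ht hmt => hW.inf_le L hs hm ht hmt⟩,
    ⟨_, Part.mem_some _, hpos, hW.isIndependenceConstant L hs fun _ h => h,
      hW.isIndependenceConstant L hs fun _ h => h.of_prod_primeFactors hpos.ne'⟩, ?_⟩
  rintro F _ _ E d rfl hd
  set x : GroupCode × ExtCode × ℕ := (s, E, d) with hx
  have hs' : s.HeightLE (Encodable.encode x) :=
    GroupCode.heightLE_of_encode_le (Prod.encode_fst_le x)
  have hE : Encodable.encode E ≤ Encodable.encode x :=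
    (Prod.encode_fst_le x.2).trans (Prod.encode_snd_le x)
  have hpos' : 0 < d * kummerLevel (Encodable.encode x) := Nat.mul_pos hd (kummerLevel_pos _)
  -- Both properties depend on c only through coprimality with the level, so the extra factor d and
  -- the passage to the radical do no harm.
  have h1 : ∀ m : ℕ, m.Coprime (d * kummerLevel (Encodable.encode x)) →
      m.Coprime (kummerLevel (Encodable.encode x)) := fun m h => h.coprime_mul_left_right
  have h2 : ∀ m : ℕ, m.Coprime (∏ p ∈ (d * kummerLevel (Encodable.encode x)).primeFactors, p) →
      m.Coprime (kummerLevel (Encodable.encode x)) := fun m h =>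
    h1 m (h.of_prod_primeFactors hpos'.ne')
  exact ⟨_, Part.mem_some _, hpos', dvd_mul_right _ _, hW.isIndependenceConstant L hs' h1,
    hW.isDisjointnessConstant L hs' hE h1, hW.isIndependenceConstant L hs' h2,
    hW.isDisjointnessConstant L hs' hE h2⟩
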